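/- Fix $\omega\in\mathbb R^2$ that is $(C,\tau)$-Diophantine, i.e. $|\omega\cdot k|\ge C(|k_1|+|k_2|)^{-\tau}$ for all $k\in\mathbb Z^2\setminus\{0\}$, with $C>0$, $\tau\ge1$, and put $\omega^\perp=(-\omega_2,\omega_1)$. Let $f(\varphi)=\sum_{|k_1|+|k_2|\le\Gamma}f_k\cos(k\cdot\varphi)$ with $f_k=f_{-k}>0$. On $T^*(\mathbb S^1\times\mathbb T^2)\ni(q,\varphi,p,A)$ consider the Hamiltonian $$H=\omega\cdot A+\tfrac{p^2}{2}+(\cos q-1)+\mu(1-\cos q)f(\varphi),\qquad \mu>0,$$ and its invariant tori $\mathcal T(B)=\{p=0,\ q=0,\ A=B\}$, $B\in\mathbb R^2$. Let $W^{s}(\mathcal T(B))$, resp. $W^u(\mathcal T(B))$, be the positive branch of the stable, resp. unstable, whisker: the set of points whose motion tends to $\mathcal T(B)$ as $t\to+\infty$, resp. $t\to-\infty$, and satisfies $0<q<2\pi$, $p>0$ for all $t\ge0$, resp. $t\le0$. For small $\mu$, over the angles $(q,\varphi)$ with $q$ bounded away from $0$ and $2\pi$, these are graphs $$p=p_0(q)+\mu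 p^{s,u}(q,\varphi,\mu),\quad A=B+\mu A^{s,u}(q,\varphi,\mu),\qquad p_0(q)=\sqrt{2(1-\cos q)}.$$ Put $\Delta A=A^s-A^u$ and $M_{se}=\partial\Delta A/\partial\varphi$. For $m>0$, the splitting condition with constant $m$ holds at $\varphi^0=(\varphi^0_1,\varphi^0_2)$ for the parameter $\mu$ if $$\Delta A(\pi,\varphi^0,\mu)=0\quad\text{and}\quad \det M_{se}(\pi,\varphi^0,\mu)\ge m.$$ Lemma. For every $m>0$ there are positive constants $\mu_0,\kappa,K$, depending only on $f,\omega,m$, such that the following holds for all $0<\mu<\mu_0$ and all $\varphi^0$ at which the splitting condition with constant $m$ holds. Put $\bar\delta=\kappa\mu$. There are $C^1$ functions $q,\varphi_1:(-\bar\delta,\bar\delta)\to\mathbb R$ with $q(0)=\pi$, $\varphi_1(0)=\varphi_1^0$ such that, for all $|\delta|<\bar\delta$ and all $B\in\mathbb R^2$, the whiskers $W^u(\mathcal T(B))$ and $W^s(\mathcal T(B+\delta\omega^\perp))$ intersect at the point of $W^u(\mathcal T(B))$ over the angles $(q(\delta),\varphi_1(\delta),\varphi_2^0)$, and the intersection is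 transversal in the energy level: near this point both whiskers are three-dimensional $C^1$ submanifolds, and their tangent spaces there together span the tangent space $\ker dH$ of the energy level. Moreover, for all $|\delta|<\bar\delta$, $$\frac{d\varphi_1}{d\delta}(\delta)\ne0,\qquad \Big|\frac{d\varphi_1}{d\delta}(\delta)\Big|\le\frac K\mu,\qquad \Big|\frac{dq}{d\delta}(\delta)\Big|\le\frac K\mu.$$ -/

import Mathlib

noncomputable section

namespace Isochronous

/-- Points `(q, φ, p, A)` of the phase space `T^*(S¹ × T²)`, the angles `q`, `φ₁`, `φ₂` being lifted
to the real line; everything below is `2π`-periodic in the angles. -/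
abbrev Phase : Type := ℝ × (Fin 2 → ℝ) × ℝ × (Fin 2 → ℝ)

/-- The wave vectors `k ∈ ℤ²` with `|k₁| + |k₂| ≤ Γ`. -/
def waveVectors (Γ : ℕ) : Finset (ℤ × ℤ) :=
  (Finset.Icc (-(Γ : ℤ)) Γ ×ˢ Finset.Icc (-(Γ : ℤ)) Γ).filter fun k => |k.1| + |k.2| ≤ (Γ : ℤ)

/-- `f(φ) = ∑_{|k₁| + |k₂| ≤ Γ} f_k cos (k · φ)`, where `c k` is the coefficient `f_k`. -/
def trigPoly (Γ : ℕ) (c : ℤ × ℤ → ℝ) (φ : Fin 2 → ℝ) : ℝ :=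
  ∑ k ∈ waveVectors Γ, c k * Real.cos (k.1 * φ 0 + k.2 * φ 1)

/-- `ω` is a `(C, τ)`-Diophantine vector. -/
def IsDiophantine (ω : Fin 2 → ℝ) (C τ : ℝ) : Prop :=
  0 < C ∧ 1 ≤ τ ∧
    ∀ k : ℤ × ℤ, k ≠ 0 → C * (|(k.1 : ℝ)| + |(k.2 : ℝ)|) ^ (-τ) ≤ |ω 0 * k.1 + ω 1 * k.2|

/-- `ω^⊥`. -/
def perp (ω : Fin 2 → ℝ) : Fin 2 → ℝ := ![-ω 1, ω 0]

/-- `H = ω · A + p² / 2 + (cos q - 1) + μ (1 - cos q) f(φ)`. -/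
def hamiltonian (f : (Fin 2 → ℝ) → ℝ) (ω : Fin 2 → ℝ) (μ : ℝ) : Phase → ℝ :=
  fun (q, φ, p, A) =>
    (ω 0 * A 0 + ω 1 * A 1) + p ^ 2 / 2 + (Real.cos q - 1) + μ * ((1 - Real.cos q) * f φ)

/-- The Hamiltonian vector field of `H`:
`q' = ∂H/∂p`, `φ' = ∂H/∂A`, `p' = -∂H/∂q`, `A' = -∂H/∂φ`. -/
def hamiltonianField (H : Phase → ℝ) (z : Phase) : Phase :=
  (fderiv ℝ H z (0, 0, 1, 0),
   fun i => fderiv ℝ H z (0, 0, 0, Pi.single i 1),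
   -fderiv ℝ H z (1, 0, 0, 0),
   fun i => -fderiv ℝ H z (0, Pi.single i 1, 0, 0))

/-- The invariant torus `T(B) = {p = 0, q = 0 mod 2π, A = B}`. -/
def torus (B : Fin 2 → ℝ) : Set Phase :=
  {z | ∃ n : ℤ, ∃ φ : Fin 2 → ℝ, z = (2 * Real.pi * n, φ, 0, B)}

/-- The positive branch of the stable whisker `W^s(T(B))`: the points whose motion tends to `T(B)`
as `t → +∞` and has `p > 0`, `0 < q < 2π` for all `t ≥ 0`. -/
def stableWhisker (H : Phase → ℝ) (B : Fin 2 → ℝ) : Set Phase :=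
  {z | ∃ γ : ℝ → Phase, IsIntegralCurve γ (fun _ => hamiltonianField H) ∧ γ 0 = z ∧
    Filter.Tendsto (fun t => Metric.infDist (γ t) (torus B)) Filter.atTop (nhds 0) ∧
    ∀ t, 0 ≤ t → 0 < (γ t).1 ∧ (γ t).1 < 2 * Real.pi ∧ 0 < (γ t).2.2.1}

/-- The positive branch of the unstable whisker `W^u(T(B))`: the points whose motion tends to `T(B)`
as `t → -∞` and has `p > 0`, `0 < q < 2π` for all `t ≤ 0`. -/
def unstableWhisker (H : Phase → ℝ) (B : Fin 2 → ℝ) : Set Phase :=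
  {z | ∃ γ : ℝ → Phase, IsIntegralCurve γ (fun _ => hamiltonianField H) ∧ γ 0 = z ∧
    Filter.Tendsto (fun t => Metric.infDist (γ t) (torus B)) Filter.atBot (nhds 0) ∧
    ∀ t, t ≤ 0 → 0 < (γ t).1 ∧ (γ t).1 < 2 * Real.pi ∧ 0 < (γ t).2.2.1}

/-- The momenta `(p, A)` of the point of `W` with angles `(q, φ)`, for a set `W` that is a graph
over the angles near `(q, φ)`. -/
def graphMomenta (W : Set Phase) (q : ℝ) (φ : Fin 2 → ℝ) : ℝ × (Fin 2 → ℝ) :=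
  Classical.epsilon fun y : ℝ × (Fin 2 → ℝ) => (q, φ, y.1, y.2) ∈ W

/-- The unperturbed separatrix `p₀(q)`. -/
def p₀ (q : ℝ) : ℝ := Real.sqrt (2 * (1 - Real.cos q))

/- The graph functions `p^u, A^u, p^s, A^s`, defined by
`W^{u,s}(T(B)) = {(q, φ, p₀(q) + μ p^{u,s}(q, φ), B + μ A^{u,s}(q, φ))}`. They do not depend on `B`,
as the equations of motion do not contain `A`, so they are read off at `B = 0`. -/

/-- `p^u`. -/
def pU (f : (Fin 2 → ℝ) → ℝ) (ω : Fin 2 → ℝ) (μ q : ℝ) (φ : Fin 2 → ℝ) : ℝ :=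
  μ⁻¹ * ((graphMomenta (unstableWhisker (hamiltonian f ω μ) 0) q φ).1 - p₀ q)

/-- `A^u`. -/
def AU (f : (Fin 2 → ℝ) → ℝ) (ω : Fin 2 → ℝ) (μ q : ℝ) (φ : Fin 2 → ℝ) : Fin 2 → ℝ :=
  μ⁻¹ • (graphMomenta (unstableWhisker (hamiltonian f ω μ) 0) q φ).2

/-- `A^s`. -/
def AS (f : (Fin 2 → ℝ) → ℝ) (ω : Fin 2 → ℝ) (μ q : ℝ) (φ : Fin 2 → ℝ) : Fin 2 → ℝ :=
  μ⁻¹ • (graphMomenta (stableWhisker (hamiltonian f ω μ) 0) q φ).2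

/-- `ΔA = A^s - A^u`. -/
def ΔA (f : (Fin 2 → ℝ) → ℝ) (ω : Fin 2 → ℝ) (μ q : ℝ) (φ : Fin 2 → ℝ) : Fin 2 → ℝ :=
  AS f ω μ q φ - AU f ω μ q φ

/-- `F(q, φ, δ) = δ ω^⊥ + μ ΔA(q, φ)`. -/
def splittingMap (f : (Fin 2 → ℝ) → ℝ) (ω : Fin 2 → ℝ) (μ q : ℝ) (φ : Fin 2 → ℝ) (δ : ℝ) :
    Fin 2 → ℝ :=
  δ • perp ω + μ • ΔA f ω μ q φ

/-- The south-east block `M_se = ∂ ΔA / ∂ φ` of the splitting matrix `∂(Δp, ΔA) / ∂(q, φ)`. -/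
def Mse (f : (Fin 2 → ℝ) → ℝ) (ω : Fin 2 → ℝ) (μ q : ℝ) (φ : Fin 2 → ℝ) :
    Matrix (Fin 2) (Fin 2) ℝ :=
  Matrix.of fun i j => fderiv ℝ (fun x => ΔA f ω μ q x i) φ (Pi.single j 1)

/-- The splitting condition: `(π, φ₀)` is a homoclinic point, and `det M_se(π, φ₀)` is positive and
of order one, the order being quantified by the constant `m > 0`. -/
def SplittingCondition (f : (Fin 2 → ℝ) → ℝ) (ω : Fin 2 → ℝ) (m μ : ℝ) (φ₀ : Fin 2 → ℝ) : Prop :=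
  splittingMap f ω μ Real.pi φ₀ 0 = 0 ∧ m ≤ (Mse f ω μ Real.pi φ₀).det

/-- Near `z`, the set `S` is a `C¹` submanifold of codimension `k`, with tangent space `T` at `z`. -/
def HasTangentSpaceAt (k : ℕ) (S : Set Phase) (z : Phase) (T : Submodule ℝ Phase) : Prop :=
  ∃ (U : Set Phase) (G : Phase → Fin k → ℝ), IsOpen U ∧ z ∈ U ∧ ContDiffOn ℝ 1 G U ∧
    S ∩ U = {x ∈ U | G x = 0} ∧ Function.Surjective (fderiv ℝ G z) ∧
    T = LinearMap.ker (fderiv ℝ G z : Phase →ₗ[ℝ] (Fin k → ℝ))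

/-- The three-dimensional sets `S` and `S'` intersect transversally at `z` inside the
five-dimensional energy level of `H` through `z`: their tangent spaces span that of the level. -/
def TransversalAt (H : Phase → ℝ) (S S' : Set Phase) (z : Phase) : Prop :=
  z ∈ S ∧ z ∈ S' ∧ ∃ T T' : Submodule ℝ Phase,
    HasTangentSpaceAt 3 S z T ∧ HasTangentSpaceAt 3 S' z T' ∧
    T ⊔ T' = LinearMap.ker (fderiv ℝ H z : Phase →ₗ[ℝ] ℝ)

/-- The point of `W^u(T(B))` over the angles `(q, φ)`. -/
def unstablePoint (f : (Fin 2 → ℝ) → ℝ) (ω : Fin 2 → ℝ) (μ : ℝ) (B : Fin 2 → ℝ) (q : ℝ)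
    (φ : Fin 2 → ℝ) : Phase :=
  (q, φ, p₀ q + μ * pU f ω μ q φ, B + μ • AU f ω μ q φ)

end Isochronous

end

/-!
Put `T = -cos (q / 2)` and `p = 2 (1 + u) sin (q / 2)`. The unperturbed separatrix is `T = tanh t`,
`u = 0`, and writing `T = tanh t - e^{-t} d` turns the motions on the stable whisker into the zeros
`(d, u)` of a system of integral equations in bounded continuous functions on `[0, ∞)`. Its
linearization at `0` is invertible, so the implicit function theorem, with compactness in `φ`, shows
that the stable whisker is a `C¹` graph `(q, φ) ↦ (p, A)`. Since `f` is even, the time reversal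
`(q, φ) ↦ (2π - q, -φ)` yields the unstable whisker.

The two whiskers of `T(B)` and `T(B + δ ω^⊥)` meet where `μ ΔA = -δ ω^⊥`. There `ω · ΔA = 0`, so by
conservation of energy the momenta `p` agree as well, and the direction `(p, ω)` of the flow lies in
the kernel of `∂ΔA/∂(q, φ)`. The whiskers being Lagrangian, `∂ΔA/∂φ` is symmetric. At a point of
splitting `∂ΔA/∂φ` is invertible, and since the flow is transversal to the `(q, φ₁)`-plane
(`ω₂ ≠ 0`), `ΔA` is a local diffeomorphism in `(q, φ₁)`, uniformly in `μ` and `φ`; inverting it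
along `-(δ / μ) ω^⊥` gives the curve. Surjectivity of `∂ΔA` amounts to transversality, and
`dφ₁/dδ ≠ 0` because a symmetric `2 × 2` matrix of positive determinant is definite.
-/

noncomputable section

namespace Isochronous

open MeasureTheory Set Filter Topology Real

/-! ### Linear operators on bounded functions of time -/

/-- Bounded continuous functions of time. Only their values at times `t ≥ 0` matter; the line is
used instead of the half-line so that derivatives and integrals in `t` need no coercions. -/
abbrev BC : Type := BoundedContinuousFunction ℝ ℝ

/-- The bounded continuous function that agrees with `f` on `[0, ∞)` and is constant on
`(-∞, 0]`. -/
def ofHalfLine (f : ℝ → ℝ) (hf : Continuous f) (C : ℝ) (hC : ∀ t, 0 ≤ t → |f t| ≤ C) : BC :=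
  .ofNormedAddCommGroup (fun t => f (max t 0)) (by fun_prop) C fun t => hC _ (le_max_right t 0)

section OfHalfLine

variable {f : ℝ → ℝ} {hf : Continuous f} {C : ℝ} {hC : ∀ t, 0 ≤ t → |f t| ≤ C}

theorem ofHalfLine_apply (t : ℝ) : ofHalfLine f hf C hC t = f (max t 0) := rfl

theorem ofHalfLine_of_nonneg {t : ℝ} (ht : 0 ≤ t) : ofHalfLine f hf C hC t = f t := by
  rw [ofHalfLine_apply, max_eq_left ht]

theorem ofHalfLine_max (t : ℝ) : ofHalfLine f hf C hC (max t 0) = ofHalfLine f hf C hC t := by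
  simp only [ofHalfLine_apply, max_eq_left (le_max_right t 0)]

theorem ofHalfLine_eventuallyEq {t : ℝ} (ht : 0 < t) : ofHalfLine f hf C hC =ᶠ[𝓝 t] f := by
  filter_upwards [lt_mem_nhds ht] with s hs using ofHalfLine_of_nonneg hs.le

theorem norm_ofHalfLine_le : ‖ofHalfLine f hf C hC‖ ≤ C :=
  BoundedContinuousFunction.norm_ofNormedAddCommGroup_le _ ((abs_nonneg _).trans (hC 0 le_rfl)) _

end OfHalfLine

theorem BC.abs_apply_le (h : BC) (t : ℝ) : |h t| ≤ ‖h‖ := h.norm_coe_le_norm t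

/-- The bounded operator on `BC` given by a linear map whose values are bounded for `t ≥ 0`. -/
def halfLineOp (T : BC →ₗ[ℝ] ℝ → ℝ) (hT : ∀ h, Continuous (T h)) (C : ℝ)
    (hC : ∀ h t, 0 ≤ t → |T h t| ≤ C * ‖h‖) : BC →L[ℝ] BC :=
  LinearMap.mkContinuous
    { toFun := fun h => ofHalfLine (T h) (hT h) (C * ‖h‖) (hC h)
      map_add' := fun h k => by ext t; simp only [ofHalfLine_apply, map_add]; rfl
      map_smul' := fun c h => by ext t; simp only [ofHalfLine_apply, map_smul]; rfl }
    C fun h => norm_ofHalfLine_le (hf := hT h) (hC := hC h)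

theorem halfLineOp_apply (T : BC →ₗ[ℝ] ℝ → ℝ) (hT : ∀ h, Continuous (T h)) (C : ℝ)
    (hC : ∀ h t, 0 ≤ t → |T h t| ≤ C * ‖h‖) (h : BC) :
    halfLineOp T hT C hC h = ofHalfLine (T h) (hT h) (C * ‖h‖) (hC h) := rfl

theorem halfLineOp_max (T : BC →ₗ[ℝ] ℝ → ℝ) (hT : ∀ h, Continuous (T h)) (C : ℝ)
    (hC : ∀ h t, 0 ≤ t → |T h t| ≤ C * ‖h‖) (h : BC) (t : ℝ) :
    halfLineOp T hT C hC h (max t 0) = halfLineOp T hT C hC h t :=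
  ofHalfLine_max (hf := hT h) (hC := hC h) t

theorem halfLineOp_eventuallyEq (T : BC →ₗ[ℝ] ℝ → ℝ) (hT : ∀ h, Continuous (T h)) (C : ℝ)
    (hC : ∀ h t, 0 ≤ t → |T h t| ≤ C * ‖h‖) (h : BC) {t : ℝ} (ht : 0 < t) :
    halfLineOp T hT C hC h =ᶠ[𝓝 t] T h :=
  ofHalfLine_eventuallyEq (hf := hT h) (hC := hC h) ht

section VariationOfConstants

variable {E : ℝ → ℝ} (hE : Continuous E) (hpos : ∀ t, 0 < E t)

include hE hpos

theorem continuous_inv_mul (h : BC) : Continuous fun r => (E r)⁻¹ * h r :=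
  (hE.inv₀ fun t => (hpos t).ne').mul h.continuous

/-- The variation of constants integral over the past: `y t = E t ∫₀ᵗ E⁻¹ h` solves
`y' = (E' / E) y + h`, `y 0 = 0`. -/
def pastIntegral : BC →ₗ[ℝ] ℝ → ℝ where
  toFun h t := E t * ∫ r in (0 : ℝ)..t, (E r)⁻¹ * h r
  map_add' h k := by
    ext t
    have integrable (h : BC) :=
      (continuous_inv_mul hE hpos h).intervalIntegrable (μ := volume) 0 t
    simp only [BoundedContinuousFunction.coe_add, Pi.add_apply, mul_add]
    rw [intervalIntegral.integral_add (integrable h) (integrable k), mul_add]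
  map_smul' c h := by
    ext t
    simp only [BoundedContinuousFunction.coe_smul, smul_eq_mul, RingHom.id_apply, Pi.smul_apply,
      mul_left_comm _ c, intervalIntegral.integral_const_mul]

theorem continuous_pastIntegral (h : BC) : Continuous (pastIntegral hE hpos h) :=
  hE.mul (intervalIntegral.continuous_primitive
    (fun a b => (continuous_inv_mul hE hpos h).intervalIntegrable a b) 0)

theorem hasDerivAt_pastIntegral {a t : ℝ} (hEt : HasDerivAt E (E t * a) t) (h : BC) :
    HasDerivAt (pastIntegral hE hpos h) (a * pastIntegral hE hpos h t + h t) t := by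
  have hprim := ((continuous_inv_mul hE hpos h).integral_hasStrictDerivAt 0 t).hasDerivAt
  refine (hEt.mul hprim).congr_deriv ?_
  change _ = a * (E t * _) + h t
  rw [mul_inv_cancel_left₀ (hpos t).ne']
  ring

theorem abs_pastIntegral_le {C t : ℝ} (ht : 0 ≤ t) (hC : E t * ∫ r in (0 : ℝ)..t, (E r)⁻¹ ≤ C)
    (h : BC) : |pastIntegral hE hpos h t| ≤ C * ‖h‖ := by
  have integral_le : |∫ r in (0 : ℝ)..t, (E r)⁻¹ * h r| ≤ ∫ r in (0 : ℝ)..t, (E r)⁻¹ * ‖h‖ := by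
    have hcont : Continuous fun r => (E r)⁻¹ * ‖h‖ :=
      (hE.inv₀ fun t => (hpos t).ne').mul continuous_const
    rw [← norm_eq_abs]
    refine intervalIntegral.norm_integral_le_of_norm_le ht (.of_forall fun r _ => ?_)
      (hcont.intervalIntegrable _ _)
    rw [norm_mul, norm_of_nonneg (inv_pos.2 (hpos r)).le]
    exact mul_le_mul_of_nonneg_left (h.norm_coe_le_norm r) (inv_pos.2 (hpos r)).le
  rw [intervalIntegral.integral_mul_const] at integral_le
  calc |pastIntegral hE hpos h t|
      = E t * |∫ r in (0 : ℝ)..t, (E r)⁻¹ * h r| :=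
        (abs_mul _ _).trans (by rw [abs_of_pos (hpos t)])
    _ ≤ E t * ((∫ r in (0 : ℝ)..t, (E r)⁻¹) * ‖h‖) :=
        mul_le_mul_of_nonneg_left integral_le (hpos t).le
    _ ≤ C * ‖h‖ := by
        rw [← mul_assoc]
        exact mul_le_mul_of_nonneg_right hC (norm_nonneg h)

/-- `pastIntegral` as a bounded operator, when it maps bounded functions to bounded functions. -/
def pastOp (C : ℝ) (hC : ∀ t, 0 ≤ t → E t * ∫ r in (0 : ℝ)..t, (E r)⁻¹ ≤ C) : BC →L[ℝ] BC :=
  halfLineOp (pastIntegral hE hpos) (continuous_pastIntegral hE hpos) C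
    fun h t ht => abs_pastIntegral_le hE hpos ht (hC t ht) h

variable (hinv : ∀ t, IntegrableOn (fun r => (E r)⁻¹) (Ioi t))

include hinv

omit hE hpos in
theorem integrableOn_inv_mul (h : BC) (t : ℝ) :
    IntegrableOn (fun r => (E r)⁻¹ * h r) (Ioi t) :=
  (hinv t).mul_bdd h.continuous.aestronglyMeasurable (.of_forall h.norm_coe_le_norm)

omit hE hpos in
/-- The variation of constants integral over the future: `y t = E t ∫ₜ^∞ E⁻¹ h` solves
`y' = (E' / E) y - h`. -/
def futureIntegral : BC →ₗ[ℝ] ℝ → ℝ where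
  toFun h t := E t * ∫ r in Ioi t, (E r)⁻¹ * h r
  map_add' h k := by
    ext t
    simp only [BoundedContinuousFunction.coe_add, Pi.add_apply, mul_add]
    rw [integral_add (integrableOn_inv_mul hinv h t) (integrableOn_inv_mul hinv k t), mul_add]
  map_smul' c h := by
    ext t
    simp only [BoundedContinuousFunction.coe_smul, smul_eq_mul, RingHom.id_apply, Pi.smul_apply,
      mul_left_comm _ c, integral_const_mul]

theorem futureIntegral_eq (h : BC) :
    futureIntegral hinv h =
      (∫ r in Ioi (0 : ℝ), (E r)⁻¹ * h r) • E - pastIntegral hE hpos h := by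
  ext t
  have hsub := intervalIntegral.integral_Ioi_sub_Ioi'
    (integrableOn_inv_mul hinv h 0) (integrableOn_inv_mul hinv h t)
  change E t * _ = _ * E t - E t * _
  rw [← hsub]
  ring

theorem continuous_futureIntegral (h : BC) : Continuous (futureIntegral hinv h) := by
  rw [futureIntegral_eq hE hpos]
  exact (hE.const_smul _).sub (continuous_pastIntegral hE hpos h)

theorem hasDerivAt_futureIntegral {a t : ℝ} (hEt : HasDerivAt E (E t * a) t) (h : BC) :
    HasDerivAt (futureIntegral hinv h) (a * futureIntegral hinv h t - h t) t := by
  rw [futureIntegral_eq hE hpos]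
  refine ((hEt.const_smul _).sub (hasDerivAt_pastIntegral hE hpos hEt h)).congr_deriv ?_
  simp only [Pi.sub_apply, Pi.smul_apply, smul_eq_mul]
  ring

omit hE in
theorem abs_futureIntegral_le {C t : ℝ} (hC : E t * ∫ r in Ioi t, (E r)⁻¹ ≤ C) (h : BC) :
    |futureIntegral hinv h t| ≤ C * ‖h‖ := by
  have integral_le : |∫ r in Ioi t, (E r)⁻¹ * h r| ≤ ∫ r in Ioi t, (E r)⁻¹ * ‖h‖ := by
    rw [← norm_eq_abs]
    refine norm_integral_le_of_norm_le ((hinv t).mul_const _) (.of_forall fun r => ?_)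
    rw [norm_mul, norm_of_nonneg (inv_pos.2 (hpos r)).le]
    exact mul_le_mul_of_nonneg_left (h.norm_coe_le_norm r) (inv_pos.2 (hpos r)).le
  rw [integral_mul_const] at integral_le
  calc |futureIntegral hinv h t|
      = E t * |∫ r in Ioi t, (E r)⁻¹ * h r| :=
        (abs_mul _ _).trans (by rw [abs_of_pos (hpos t)])
    _ ≤ E t * ((∫ r in Ioi t, (E r)⁻¹) * ‖h‖) :=
        mul_le_mul_of_nonneg_left integral_le (hpos t).le
    _ ≤ C * ‖h‖ := by
        rw [← mul_assoc]
        exact mul_le_mul_of_nonneg_right hC (norm_nonneg h)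

/-- `futureIntegral` as a bounded operator, when it maps bounded functions to bounded functions. -/
def futureOp (C : ℝ) (hC : ∀ t, 0 ≤ t → E t * ∫ r in Ioi t, (E r)⁻¹ ≤ C) : BC →L[ℝ] BC :=
  halfLineOp (futureIntegral hinv) (continuous_futureIntegral hE hpos hinv) C
    fun h t ht => abs_futureIntegral_le hpos hinv (hC t ht) h

theorem hasDerivAt_futureOp {C : ℝ} (hC : ∀ t, 0 ≤ t → E t * ∫ r in Ioi t, (E r)⁻¹ ≤ C) (h : BC)
    {a t : ℝ} (ht : 0 < t) (hEt : HasDerivAt E (E t * a) t) :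
    HasDerivAt (futureOp hE hpos hinv C hC h) (a * futureOp hE hpos hinv C hC h t - h t) t := by
  have heq : futureOp hE hpos hinv C hC h =ᶠ[𝓝 t] futureIntegral hinv h :=
    halfLineOp_eventuallyEq _ _ _ _ h ht
  rw [heq.eq_of_nhds]
  exact (hasDerivAt_futureIntegral hE hpos _ hEt h).congr_of_eventuallyEq heq

end VariationOfConstants

/-! ### The linearization at the separatrix -/

theorem cosh_le_exp {t : ℝ} (ht : 0 ≤ t) : cosh t ≤ exp t := by
  rw [cosh_eq]
  linarith [exp_le_exp.2 (show -t ≤ t by linarith)]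

theorem exp_le_two_mul_cosh (t : ℝ) : exp t ≤ 2 * cosh t := by
  rw [cosh_eq]
  linarith [exp_pos (-t)]

theorem hasDerivAt_tanh (t : ℝ) : HasDerivAt tanh (1 - tanh t ^ 2) t := by
  rw [show tanh = sinh / cosh from funext tanh_eq_sinh_div_cosh]
  refine ((hasDerivAt_sinh t).div (hasDerivAt_cosh t) (cosh_pos t).ne').congr_deriv ?_
  rw [Pi.div_apply, div_pow, one_sub_div (pow_pos (cosh_pos t) 2).ne']
  ring

theorem continuous_tanh : Continuous tanh :=
  continuous_iff_continuousAt.2 fun t => (hasDerivAt_tanh t).continuousAt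

theorem one_sub_tanh_sq (t : ℝ) : 1 - tanh t ^ 2 = (cosh t ^ 2)⁻¹ := by
  rw [tanh_eq_sinh_div_cosh, div_pow, one_sub_div (pow_pos (cosh_pos t) 2).ne', cosh_sq_sub_sinh_sq,
    one_div]

theorem one_sub_tanh (t : ℝ) : 1 - tanh t = exp (-t) / cosh t := by
  rw [tanh_eq_sinh_div_cosh, one_sub_div (cosh_pos t).ne', cosh_sub_sinh]

theorem tendsto_tanh_atTop : Tendsto tanh atTop (𝓝 1) := by
  have lim : Tendsto (fun t => 1 - exp (-t)) atTop (𝓝 1) := by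
    simpa using (tendsto_exp_neg_atTop_nhds_zero).const_sub 1
  refine tendsto_of_tendsto_of_tendsto_of_le_of_le lim tendsto_const_nhds (fun t => ?_)
    fun t => (tanh_lt_one t).le
  have : exp (-t) / cosh t ≤ exp (-t) := div_le_self (exp_pos _).le (one_le_cosh t)
  linarith [one_sub_tanh t]

theorem continuous_cosh_sq : Continuous fun t => cosh t ^ 2 := by fun_prop

theorem cosh_sq_pos (t : ℝ) : 0 < cosh t ^ 2 := pow_pos (cosh_pos t) 2

theorem hasDerivAt_cosh_sq (t : ℝ) :
    HasDerivAt (fun t => cosh t ^ 2) (cosh t ^ 2 * (2 * tanh t)) t := by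
  refine ((hasDerivAt_cosh t).pow 2).congr_deriv ?_
  rw [tanh_eq_sinh_div_cosh]
  simp only [Nat.cast_ofNat, Nat.add_one_sub_one, pow_one]
  field_simp

theorem integrableOn_inv_cosh_sq (t : ℝ) : IntegrableOn (fun r => (cosh r ^ 2)⁻¹) (Ioi t) := by
  simp only [← one_sub_tanh_sq]
  exact integrableOn_Ioi_deriv_of_nonneg' (fun r _ => hasDerivAt_tanh r)
    (fun r _ => by rw [one_sub_tanh_sq]; exact (inv_pos.2 (cosh_sq_pos r)).le) tendsto_tanh_atTop

theorem integral_Ioi_inv_cosh_sq (t : ℝ) : ∫ r in Ioi t, (cosh r ^ 2)⁻¹ = 1 - tanh t := by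
  simp only [← one_sub_tanh_sq]
  exact integral_Ioi_of_hasDerivAt_of_nonneg' (fun r _ => hasDerivAt_tanh r)
    (fun r _ => by rw [one_sub_tanh_sq]; exact (inv_pos.2 (cosh_sq_pos r)).le) tendsto_tanh_atTop

theorem cosh_sq_mul_integral_le {t : ℝ} (ht : 0 ≤ t) :
    cosh t ^ 2 * ∫ r in Ioi t, (cosh r ^ 2)⁻¹ ≤ 1 := by
  calc cosh t ^ 2 * ∫ r in Ioi t, (cosh r ^ 2)⁻¹ = cosh t * exp (-t) := by
        rw [integral_Ioi_inv_cosh_sq, one_sub_tanh]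
        field_simp
    _ ≤ exp t * exp (-t) := mul_le_mul_of_nonneg_right (cosh_le_exp ht) (exp_pos _).le
    _ = 1 := by rw [← exp_add, add_neg_cancel, exp_zero]

/-- `e^t / cosh² t`, which is bounded for `t ≥ 0` and solves the linear equation
`y' = (1 - 2 tanh t) y`. -/
def expSech (t : ℝ) : ℝ := exp t / cosh t ^ 2

theorem expSech_pos (t : ℝ) : 0 < expSech t := div_pos (exp_pos t) (cosh_sq_pos t)

theorem continuous_expSech : Continuous expSech :=
  continuous_exp.div continuous_cosh_sq fun t => (cosh_sq_pos t).ne'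

theorem hasDerivAt_expSech (t : ℝ) :
    HasDerivAt expSech (expSech t * (1 - 2 * tanh t)) t := by
  refine ((hasDerivAt_exp t).div (hasDerivAt_cosh_sq t) (cosh_sq_pos t).ne').congr_deriv ?_
  have := (cosh_pos t).ne'
  simp only [expSech]
  field_simp

theorem exp_mul_expSech_le (t : ℝ) : exp t * expSech t ≤ 4 := by
  rw [expSech, mul_div_assoc', div_le_iff₀ (cosh_sq_pos t)]
  nlinarith [exp_le_two_mul_cosh t, exp_pos t]

theorem exp_neg_mul_expSech (t : ℝ) : exp (-t) * expSech t = 1 - tanh t ^ 2 := by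
  rw [one_sub_tanh_sq, expSech, mul_div_assoc', ← exp_add, neg_add_cancel, exp_zero, one_div]

theorem expSech_le {t : ℝ} (ht : 0 ≤ t) : expSech t ≤ 4 :=
  (le_mul_of_one_le_left (expSech_pos t).le (one_le_exp ht)).trans (exp_mul_expSech_le t)

theorem inv_expSech_le {t : ℝ} (ht : 0 ≤ t) : (expSech t)⁻¹ ≤ exp t := by
  rw [expSech, inv_div, div_le_iff₀ (exp_pos t), ← sq]
  exact pow_le_pow_left₀ (cosh_pos t).le (cosh_le_exp ht) 2

theorem expSech_mul_integral_le {t : ℝ} (ht : 0 ≤ t) :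
    expSech t * ∫ r in (0 : ℝ)..t, (expSech r)⁻¹ ≤ 4 := by
  have integral_le : ∫ r in (0 : ℝ)..t, (expSech r)⁻¹ ≤ exp t :=
    calc ∫ r in (0 : ℝ)..t, (expSech r)⁻¹ ≤ ∫ r in (0 : ℝ)..t, exp r :=
          intervalIntegral.integral_mono_on ht
            ((continuous_expSech.inv₀ fun r => (expSech_pos r).ne').intervalIntegrable _ _)
            (continuous_exp.intervalIntegrable _ _) fun r hr => inv_expSech_le hr.1
      _ ≤ exp t := by rw [integral_exp, exp_zero]; linarith
  calc expSech t * ∫ r in (0 : ℝ)..t, (expSech r)⁻¹ ≤ expSech t * exp t :=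
        mul_le_mul_of_nonneg_left integral_le (expSech_pos t).le
    _ ≤ 4 := by rw [mul_comm]; exact exp_mul_expSech_le t

/-- The operator `h ↦ y`, where `y' = (1 - 2 tanh t) y + h`, `y 0 = 0`. -/
def forwardOp : BC →L[ℝ] BC :=
  pastOp continuous_expSech expSech_pos 4 fun _ => expSech_mul_integral_le

/-- The operator `h ↦ y`, where `y` is the bounded solution of `y' = 2 tanh t y - h`. -/
def backwardOp : BC →L[ℝ] BC :=
  futureOp continuous_cosh_sq cosh_sq_pos integrableOn_inv_cosh_sq 1
    fun _ => cosh_sq_mul_integral_le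

theorem hasDerivAt_forwardOp (h : BC) {t : ℝ} (ht : 0 < t) :
    HasDerivAt (forwardOp h) ((1 - 2 * tanh t) * forwardOp h t + h t) t := by
  have heq : forwardOp h =ᶠ[𝓝 t] pastIntegral continuous_expSech expSech_pos h :=
    halfLineOp_eventuallyEq _ _ _ _ h ht
  rw [heq.eq_of_nhds]
  exact (hasDerivAt_pastIntegral _ _ (hasDerivAt_expSech t) h).congr_of_eventuallyEq heq

theorem hasDerivAt_backwardOp (h : BC) {t : ℝ} (ht : 0 < t) :
    HasDerivAt (backwardOp h) (2 * tanh t * backwardOp h t - h t) t :=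
  hasDerivAt_futureOp _ _ _ _ h ht (hasDerivAt_cosh_sq t)

/-- The operator `h ↦ y`, where `y` is the bounded solution of `y' = y - h`. -/
def tailOp : BC →L[ℝ] BC :=
  futureOp continuous_exp exp_pos
    (fun t => by simpa only [exp_neg] using integrableOn_exp_neg_Ioi t) 1
    fun t _ => by
      simp only [← exp_neg, integral_exp_neg_Ioi]
      rw [← exp_add, add_neg_cancel, exp_zero]

theorem hasDerivAt_tailOp (h : BC) {t : ℝ} (ht : 0 < t) :
    HasDerivAt (tailOp h) (tailOp h t - h t) t := by
  have hderiv : HasDerivAt (tailOp h) (1 * tailOp h t - h t) t :=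
    hasDerivAt_futureOp _ _ _ _ h ht ((hasDerivAt_exp t).congr_deriv (mul_one _).symm)
  rwa [one_mul] at hderiv

theorem forwardOp_max (h : BC) (t : ℝ) : forwardOp h (max t 0) = forwardOp h t :=
  halfLineOp_max _ _ _ _ h t

theorem backwardOp_max (h : BC) (t : ℝ) : backwardOp h (max t 0) = backwardOp h t :=
  halfLineOp_max _ _ _ _ h t

theorem forwardOp_zero_time (h : BC) : forwardOp h 0 = 0 := by
  rw [forwardOp, pastOp, halfLineOp_apply, ofHalfLine_of_nonneg le_rfl]
  change expSech 0 * ∫ r in (0 : ℝ)..0, (expSech r)⁻¹ * h r = 0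
  rw [intervalIntegral.integral_same, mul_zero]

/-! ### The integral equations of the stable whisker -/

/-- `e^{-t}` as an element of `BC`. -/
def expNegBC : BC :=
  ofHalfLine (fun t => exp (-t)) (by fun_prop) 1 fun t ht => by
    rw [abs_exp]; exact exp_le_one_iff.2 (neg_nonpos.2 ht)

/-- `e^t / cosh² t` as an element of `BC`. -/
def expSechBC : BC :=
  ofHalfLine expSech continuous_expSech 4 fun t ht => by
    rw [abs_of_pos (expSech_pos t)]; exact expSech_le ht

/-- `tanh t` as an element of `BC`. -/
def tanhBC : BC :=
  ofHalfLine tanh continuous_tanh 1 fun t _ => (abs_tanh_lt_one t).le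

theorem expNegBC_apply {t : ℝ} (ht : 0 ≤ t) : expNegBC t = exp (-t) := ofHalfLine_of_nonneg ht

theorem expSechBC_apply {t : ℝ} (ht : 0 ≤ t) : expSechBC t = expSech t := ofHalfLine_of_nonneg ht

theorem tanhBC_apply {t : ℝ} (ht : 0 ≤ t) : tanhBC t = tanh t := ofHalfLine_of_nonneg ht

/-- `T = tanh t - e^{-t} d`, the value of `-cos (q / 2)` along a motion; `d = 0` on the unperturbed
separatrix through `q = π`. In the variables `(d, u)`, where `p = 2 (1 + u) sin (q / 2)`, the
equations of motion are polynomial. -/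
def negCosHalf (d : BC) : BC := tanhBC - expNegBC * d

/-- `e^t (1 - T²)` for `T = negCosHalf d`, that is `e^t sin² (q / 2)` along a motion. -/
def scaledSinSq (d : BC) : BC := expSechBC + (2 : ℝ) • (tanhBC * d) - expNegBC * (d * d)

/-- The inhomogeneity `h` in the equation `d' = (1 - 2 tanh t) d + h`. -/
def forwardSource (d u : BC) : BC := expNegBC * (d * d) - scaledSinSq d * u

/-- The inhomogeneity `h` in the equation `u' = 2 tanh t u + h`. -/
def backwardSource (G d u : BC) : BC := negCosHalf d * (u * u + G) - (2 : ℝ) • (expNegBC * d * u)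

theorem negCosHalf_apply (d : BC) (t : ℝ) :
    negCosHalf d t = tanhBC t - expNegBC t * d t := rfl

theorem scaledSinSq_apply (d : BC) (t : ℝ) :
    scaledSinSq d t = expSechBC t + 2 * (tanhBC t * d t) - expNegBC t * (d t * d t) := rfl

theorem forwardSource_apply (d u : BC) (t : ℝ) :
    forwardSource d u t = expNegBC t * (d t * d t) - scaledSinSq d t * u t := rfl

theorem backwardSource_apply (G d u : BC) (t : ℝ) : backwardSource G d u t =
    negCosHalf d t * (u t * u t + G t) - 2 * (expNegBC t * d t * u t) := rfl

/-- The defect in the integral equations of the stable whisker: `z.1 = (D₀, G)` holds the initial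
value of `d` and the forcing, `z.2 = (d, u)` the unknowns. -/
def defect (z : (ℝ × BC) × (BC × BC)) : BC × BC :=
  (z.2.1 - z.1.1 • expSechBC - forwardOp (forwardSource z.2.1 z.2.2),
    z.2.2 + backwardOp (backwardSource z.1.2 z.2.1 z.2.2))

theorem defect_eq_zero_iff {D₀ : ℝ} {G d u : BC} :
    defect ((D₀, G), (d, u)) = 0 ↔
      d = D₀ • expSechBC + forwardOp (forwardSource d u) ∧
        u = -backwardOp (backwardSource G d u) := by
  simp only [defect, Prod.mk_eq_zero, sub_sub, sub_eq_zero, add_eq_zero_iff_eq_neg]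

theorem contDiff_defect : ContDiff ℝ 1 defect := by
  unfold defect forwardSource backwardSource scaledSinSq negCosHalf
  fun_prop

theorem defect_zero : defect 0 = 0 := by
  simp [defect, forwardSource, backwardSource]

/-- The derivative of `forwardSource` at `(d, u)` in the direction `(d', u')`. -/
def forwardSourceDeriv (d u d' u' : BC) : BC :=
  (2 : ℝ) • (expNegBC * d * d') - ((2 : ℝ) • (negCosHalf d * d') * u + scaledSinSq d * u')

/-- The derivative of `backwardSource` at `(G, d, u)` in the direction `(G', d', u')`. -/
def backwardSourceDeriv (G d u G' d' u' : BC) : BC :=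
  negCosHalf d * ((2 : ℝ) • (u * u') + G') - expNegBC * d' * (u * u + G)
    - (2 : ℝ) • (expNegBC * (d' * u + d * u'))

section Derivatives

variable {G d u : ℝ → BC} {G' d' u' : BC} {s : ℝ}

theorem hasDerivAt_negCosHalf (hd : HasDerivAt d d' s) :
    HasDerivAt (fun s => negCosHalf (d s)) (-(expNegBC * d')) s :=
  (hd.const_mul expNegBC).const_sub tanhBC

theorem hasDerivAt_scaledSinSq (hd : HasDerivAt d d' s) :
    HasDerivAt (fun s => scaledSinSq (d s)) ((2 : ℝ) • (negCosHalf (d s) * d')) s := by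
  refine ((((hd.const_mul tanhBC).const_smul (2 : ℝ)).const_add expSechBC).sub
    ((hd.mul hd).const_mul expNegBC)).congr_deriv ?_
  simp only [negCosHalf, two_smul]
  ring

theorem hasDerivAt_forwardSource (hd : HasDerivAt d d' s) (hu : HasDerivAt u u' s) :
    HasDerivAt (fun s => forwardSource (d s) (u s)) (forwardSourceDeriv (d s) (u s) d' u') s := by
  refine (((hd.mul hd).const_mul expNegBC).sub
    ((hasDerivAt_scaledSinSq hd).mul hu)).congr_deriv ?_
  simp only [forwardSourceDeriv, two_smul]
  ring

theorem hasDerivAt_backwardSource (hG : HasDerivAt G G' s) (hd : HasDerivAt d d' s)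
    (hu : HasDerivAt u u' s) :
    HasDerivAt (fun s => backwardSource (G s) (d s) (u s))
      (backwardSourceDeriv (G s) (d s) (u s) G' d' u') s := by
  refine (((hasDerivAt_negCosHalf hd).mul ((hu.mul hu).add hG)).sub
    (((hd.const_mul expNegBC).mul hu).const_smul (2 : ℝ))).congr_deriv ?_
  simp only [backwardSourceDeriv, two_smul, Pi.add_apply, Pi.mul_apply]
  ring

theorem hasDerivAt_defect {D₀ : ℝ → ℝ} {D₀' : ℝ} (hD₀ : HasDerivAt D₀ D₀' s)
    (hG : HasDerivAt G G' s) (hd : HasDerivAt d d' s) (hu : HasDerivAt u u' s) :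
    HasDerivAt (fun s => defect ((D₀ s, G s), (d s, u s)))
      (d' - D₀' • expSechBC - forwardOp (forwardSourceDeriv (d s) (u s) d' u'),
        u' + backwardOp (backwardSourceDeriv (G s) (d s) (u s) G' d' u')) s :=
  ((hd.sub (hD₀.smul_const expSechBC)).sub
      (forwardOp.hasFDerivAt.comp_hasDerivAt s (hasDerivAt_forwardSource hd hu))).prodMk
    (hu.add (backwardOp.hasFDerivAt.comp_hasDerivAt s (hasDerivAt_backwardSource hG hd hu)))

end Derivatives

theorem fderiv_defect_zero_inr (y : BC × BC) :
    fderiv ℝ defect 0 (0, y) = (y.1 + forwardOp (expSechBC * y.2), y.2) := by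
  have hline : HasLineDerivAt ℝ defect (y.1 + forwardOp (expSechBC * y.2), y.2) 0 (0, y) := by
    have hderiv := hasDerivAt_defect (s := 0) (hasDerivAt_const (0 : ℝ) (0 : ℝ))
      (hasDerivAt_const (0 : ℝ) (0 : BC)) ((hasDerivAt_id (0 : ℝ)).smul_const y.1)
      ((hasDerivAt_id (0 : ℝ)).smul_const y.2)
    have hpath : (fun s : ℝ => defect (0 + s • ((0 : ℝ × BC), y))) =
        fun s => defect ((0, 0), (id s • y.1, id s • y.2)) := by
      simp [Prod.smul_def, ← Prod.zero_eq_mk]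
    rw [HasLineDerivAt, hpath]
    exact hderiv.congr_deriv (by simp [forwardSourceDeriv, backwardSourceDeriv, scaledSinSq])
  rw [← (contDiff_defect.differentiable one_ne_zero 0).lineDeriv_eq_fderiv, hline.lineDeriv]

theorem isInvertible_fderiv_defect :
    (fderiv ℝ defect 0 ∘L .inr ℝ (ℝ × BC) (BC × BC)).IsInvertible := by
  let shear : BC →L[ℝ] BC := forwardOp ∘L ContinuousLinearMap.mul ℝ BC expSechBC
  refine .of_inverse (g := (.fst ℝ BC BC - shear ∘L .snd ℝ BC BC).prod (.snd ℝ BC BC)) ?_ ?_ <;>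
  · refine ContinuousLinearMap.ext fun y => ?_
    simp [fderiv_defect_zero_inr, shear]

theorem exists_solutionMap : ∃ (Ψ : ℝ × BC → BC × BC) (ε : ℝ), 0 < ε ∧
    ContDiffOn ℝ 1 Ψ (Metric.ball 0 ε) ∧
    (∀ x ∈ Metric.ball (0 : ℝ × BC) ε, ‖Ψ x‖ < 1 ∧ defect (x, Ψ x) = 0) ∧
    ∀ x ∈ Metric.ball (0 : ℝ × BC) ε, ∀ y ∈ Metric.ball (0 : BC × BC) ε,
      defect (x, y) = 0 → y = Ψ x := by
  have hC1 : ContDiffAt ℝ 1 defect 0 := contDiff_defect.contDiffAt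
  let Ψ := hC1.implicitFunction one_ne_zero isInvertible_fderiv_defect
  have hΨ : ContDiffAt ℝ 1 Ψ 0 := hC1.contDiffAt_implicitFunction _ _
  have hΨ0 : Ψ 0 = 0 := hC1.implicitFunction_apply_self _ _
  have solves : ∀ᶠ x in 𝓝 (0 : ℝ × BC), defect (x, Ψ x) = 0 := by
    have := hC1.eventually_apply_implicitFunction one_ne_zero isInvertible_fderiv_defect
    rwa [defect_zero] at this
  have unique : ∀ᶠ v in 𝓝 (0 : (ℝ × BC) × (BC × BC)), defect v = 0 ↔ Ψ v.1 = v.2 := by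
    simpa only [defect_zero] using
      hC1.eventually_apply_eq_iff_implicitFunction one_ne_zero isInvertible_fderiv_defect
  have regular : ∀ᶠ x in 𝓝 (0 : ℝ × BC), ContDiffAt ℝ 1 Ψ x := hΨ.eventually (by simp)
  have small : ∀ᶠ x in 𝓝 (0 : ℝ × BC), ‖Ψ x‖ < 1 :=
    hΨ.continuousAt.norm.eventually_lt_const (by simp [hΨ0])
  obtain ⟨ε₁, hε₁, hball₁⟩ := Metric.eventually_nhds_iff_ball.1 (solves.and (regular.and small))
  obtain ⟨ε₂, hε₂, hball₂⟩ := Metric.eventually_nhds_iff_ball.1 unique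
  refine ⟨Ψ, min ε₁ ε₂, lt_min hε₁ hε₂, fun x hx => ?_, fun x hx => ?_, fun x hx y hy hxy => ?_⟩
  · exact (hball₁ x (Metric.ball_subset_ball (min_le_left _ _) hx)).2.1.contDiffWithinAt
  · obtain ⟨heq, -, hlt⟩ := hball₁ x (Metric.ball_subset_ball (min_le_left _ _) hx)
    exact ⟨hlt, heq⟩
  · have hxy_mem : (x, y) ∈ Metric.ball (0 : (ℝ × BC) × (BC × BC)) ε₂ := by
      rw [mem_ball_zero_iff] at hx hy ⊢
      exact max_lt (hx.trans_le (min_le_right _ _)) (hy.trans_le (min_le_right _ _))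
    exact ((hball₂ (x, y) hxy_mem).1 hxy).symm

/-! ### Functions on the torus and their values along linear orbits -/

theorem exists_bound_of_periodic {V X : Type*} [SeminormedAddCommGroup V]
    [SeminormedAddCommGroup X] {F : V → X} {K D : Set V} (hK : IsCompact K)
    (hF : ∀ x ∈ K, ContinuousAt F x) (hD : ∀ x ∈ D, ∃ v, Function.Periodic F v ∧ x + v ∈ K) :
    ∃ C, 0 ≤ C ∧ ∀ x ∈ D, ‖F x‖ ≤ C := by
  obtain ⟨C, hC⟩ := hK.exists_bound_of_continuousOn fun x hx => (hF x hx).continuousWithinAt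
  refine ⟨max C 0, le_max_right _ _, fun x hx => ?_⟩
  obtain ⟨v, hv, hxv⟩ := hD x hx
  exact (hv x ▸ hC _ hxv).trans (le_max_left _ _)

theorem exists_dist_lt_of_periodic {V X : Type*} [SeminormedAddCommGroup V]
    [PseudoMetricSpace X] {F : V → X} {K D : Set V} (hK : IsCompact K)
    (hF : ∀ x ∈ K, ContinuousAt F x) (hD : ∀ x ∈ D, ∃ v, Function.Periodic F v ∧ x + v ∈ K)
    {ε : ℝ} (hε : 0 < ε) : ∃ r > 0, ∀ x ∈ D, ∀ y, dist x y < r → dist (F x) (F y) < ε := by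
  obtain ⟨r, hr, hclose⟩ := Metric.mem_uniformity_dist.1
    (hK.uniformContinuousAt_of_continuousAt F hF (Metric.dist_mem_uniformity hε))
  refine ⟨r, hr, fun x hx y hxy => ?_⟩
  obtain ⟨v, hv, hxv⟩ := hD x hx
  have hshift : dist (F (x + v)) (F (y + v)) < ε :=
    @hclose (x + v) (y + v) (by rwa [dist_add_right]) hxv
  rwa [hv, hv] at hshift

/-- The vector of `(2πℤ)²` with integer coordinates `n`. -/
def angleShift (n : Fin 2 → ℤ) : Fin 2 → ℝ := fun i => 2 * π * n i

theorem angleShift_apply (n : Fin 2 → ℤ) (i : Fin 2) : angleShift n i = 2 * π * n i := rfl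

theorem exists_add_angleShift_mem_Icc (φ : Fin 2 → ℝ) :
    ∃ n, φ + angleShift n ∈ Icc (0 : Fin 2 → ℝ) fun _ => 2 * π := by
  have hmem : ∀ i, φ i + 2 * π * (-toIcoDiv two_pi_pos 0 (φ i) : ℤ) ∈ Ico 0 (2 * π) := fun i => by
    have hmod := toIcoMod_mem_Ico' two_pi_pos (φ i)
    rw [← self_sub_toIcoDiv_zsmul, zsmul_eq_mul] at hmod
    convert hmod using 1
    push_cast
    ring
  exact ⟨fun i => -toIcoDiv two_pi_pos 0 (φ i), fun i => (hmem i).1, fun i => (hmem i).2.le⟩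

theorem uniformContinuous_of_periodic {X : Type*} [PseudoMetricSpace X] {F : (Fin 2 → ℝ) → X}
    (hF : Continuous F) (hper : ∀ k, Function.Periodic F (angleShift k)) :
    UniformContinuous F := by
  refine Metric.uniformContinuous_iff.2 fun ε hε => ?_
  obtain ⟨r, hr, hclose⟩ := exists_dist_lt_of_periodic (F := F) (D := univ) isCompact_Icc
    (fun φ _ => hF.continuousAt) (fun φ _ =>
      (exists_add_angleShift_mem_Icc φ).imp' _ fun k hk => ⟨hper k, hk⟩) hε
  exact ⟨r, hr, fun x y hxy => hclose x (mem_univ x) y hxy⟩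

/-- The functions of class `Cⁿ` on the torus `T²`, lifted to the plane. -/
structure IsTorusFunction (n : ℕ) (g : (Fin 2 → ℝ) → ℝ) : Prop where
  contDiff : ContDiff ℝ n g
  periodic (k : Fin 2 → ℤ) : Function.Periodic g (angleShift k)

/-- The partial derivative `∂ᵢ g`. -/
def partialDeriv {E : Type*} [NormedAddCommGroup E] [NormedSpace ℝ E] (i : Fin 2)
    (g : (Fin 2 → ℝ) → E) (φ : Fin 2 → ℝ) : E :=
  fderiv ℝ g φ (Pi.single i 1)

theorem hasDerivAt_add_smul_single {E : Type*} [NormedAddCommGroup E] [NormedSpace ℝ E]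
    {g : (Fin 2 → ℝ) → E} {φ : Fin 2 → ℝ} {i : Fin 2} {s : ℝ}
    (hg : DifferentiableAt ℝ g (φ + s • Pi.single i 1)) :
    HasDerivAt (fun s : ℝ => g (φ + s • Pi.single i 1))
      (partialDeriv i g (φ + s • Pi.single i 1)) s := by
  refine hg.hasFDerivAt.comp_hasDerivAt s ?_
  simpa using ((hasDerivAt_id s).smul_const (Pi.single i (1 : ℝ) : Fin 2 → ℝ)).const_add φ

theorem fderiv_eq_sum_partialDeriv {E : Type*} [NormedAddCommGroup E] [NormedSpace ℝ E]
    (g : (Fin 2 → ℝ) → E) (φ v : Fin 2 → ℝ) :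
    fderiv ℝ g φ v = ∑ i, v i • partialDeriv i g φ := by
  conv_lhs => rw [pi_eq_sum_univ' v, map_sum]
  simp [partialDeriv]

theorem partialDeriv_comm {g : (Fin 2 → ℝ) → ℝ} (hg : ContDiff ℝ 2 g) (i j : Fin 2) :
    partialDeriv i (partialDeriv j g) = partialDeriv j (partialDeriv i g) := by
  have hsecond : ∀ i j φ, partialDeriv i (partialDeriv j g) φ =
      fderiv ℝ (fderiv ℝ g) φ (Pi.single i 1) (Pi.single j 1) := fun i j φ => by
    have hg' : DifferentiableAt ℝ (fderiv ℝ g) φ :=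
      (hg.fderiv_right (m := 1) le_rfl).differentiable one_ne_zero φ
    exact congr($(fderiv_clm_apply hg' (differentiableAt_const (Pi.single j 1))) _).trans
      (by simp)
  funext φ
  rw [hsecond, hsecond]
  exact (hg.contDiffAt.isSymmSndFDerivAt (by simp)).eq _ _

theorem fderiv_periodic {V E : Type*} [NormedAddCommGroup V] [NormedSpace ℝ V]
    [NormedAddCommGroup E] [NormedSpace ℝ E] {F : V → E} {v : V} (hF : Function.Periodic F v) :
    Function.Periodic (fderiv ℝ F) v := fun x => by
  rw [← fderiv_comp_add_right, hF.funext]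

namespace IsTorusFunction

variable {n : ℕ} {g : (Fin 2 → ℝ) → ℝ}

theorem partialDeriv (hg : IsTorusFunction (n + 1) g) (i : Fin 2) :
    IsTorusFunction n (partialDeriv i g) where
  contDiff := (hg.contDiff.fderiv_right (m := n) (by norm_cast)).clm_apply contDiff_const
  periodic k φ := congr($(fderiv_periodic (hg.periodic k) φ) (Pi.single i 1))

theorem exists_bound (hg : IsTorusFunction n g) : ∃ C, 0 ≤ C ∧ ∀ φ, |g φ| ≤ C := by
  obtain ⟨C, hC, hbound⟩ := exists_bound_of_periodic (F := g) (D := univ) isCompact_Icc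
    (fun φ _ => hg.contDiff.continuous.continuousAt) fun φ _ =>
      (exists_add_angleShift_mem_Icc φ).imp' _ fun k hk => ⟨hg.periodic k, hk⟩
  exact ⟨C, hC, fun φ => hbound φ (mem_univ φ)⟩

theorem uniformContinuous (hg : IsTorusFunction n g) : UniformContinuous g :=
  uniformContinuous_of_periodic hg.contDiff.continuous hg.periodic

/-- The function `t ↦ g (φ + t ω)`, an element of `BC`. -/
def orbit (hg : IsTorusFunction n g) (ω φ : Fin 2 → ℝ) : BC :=
  .ofNormedAddCommGroup (fun t => g (φ + t • ω)) (hg.contDiff.continuous.comp (by fun_prop))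
    hg.exists_bound.choose fun _ => hg.exists_bound.choose_spec.2 _

theorem orbit_apply (hg : IsTorusFunction n g) (ω φ : Fin 2 → ℝ) (t : ℝ) :
    hg.orbit ω φ t = g (φ + t • ω) := rfl

theorem orbit_add_angleShift (hg : IsTorusFunction n g) (ω φ : Fin 2 → ℝ) (k : Fin 2 → ℤ) :
    hg.orbit ω (φ + angleShift k) = hg.orbit ω φ := by
  ext t
  rw [orbit_apply, orbit_apply, add_right_comm, hg.periodic k]

theorem exists_norm_orbit_le (hg : IsTorusFunction n g) (ω : Fin 2 → ℝ) :
    ∃ C, 0 ≤ C ∧ ∀ φ, ‖hg.orbit ω φ‖ ≤ C := by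
  obtain ⟨C, hC, hbound⟩ := hg.exists_bound
  exact ⟨C, hC, fun φ => (BoundedContinuousFunction.norm_le hC).2 fun t => hbound _⟩

theorem continuous_orbit (hg : IsTorusFunction n g) (ω : Fin 2 → ℝ) :
    Continuous (hg.orbit ω) := by
  refine (Metric.uniformContinuous_iff.2 fun ε hε => ?_).continuous
  obtain ⟨r, hr, hclose⟩ :=
    Metric.uniformContinuous_iff.1 hg.uniformContinuous (ε / 2) (half_pos hε)
  refine ⟨r, hr, fun φ ψ hφψ => lt_of_le_of_lt ?_ (half_lt_self hε)⟩
  refine (BoundedContinuousFunction.dist_le (half_pos hε).le).2 fun t => ?_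
  exact (hclose (by rwa [dist_add_right])).le

theorem exists_abs_sub_sub_fderiv_le (hg : IsTorusFunction (n + 1) g) {ε : ℝ} (hε : 0 < ε) :
    ∃ r > 0, ∀ φ ψ, dist ψ φ < r → |g ψ - g φ - fderiv ℝ g φ (ψ - φ)| ≤ ε * ‖ψ - φ‖ := by
  have hC1 : ContDiff ℝ 1 g := hg.contDiff.of_le (by norm_cast; omega)
  have hunif : UniformContinuous (fderiv ℝ g) := uniformContinuous_of_periodic
    (hC1.continuous_fderiv one_ne_zero) fun k => fderiv_periodic (hg.periodic k)
  obtain ⟨r, hr, hclose⟩ := Metric.uniformContinuous_iff.1 hunif ε hε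
  refine ⟨r, hr, fun φ ψ hψ => (convex_ball φ r).norm_image_sub_le_of_norm_fderiv_le'
    (fun χ _ => hC1.differentiable one_ne_zero χ) (fun χ hχ => ?_) (Metric.mem_ball_self hr) hψ⟩
  exact (dist_eq_norm _ _).symm.trans_le (hclose hχ).le

theorem hasFDerivAt_orbit (hg : IsTorusFunction (n + 1) g) (ω φ : Fin 2 → ℝ) :
    HasFDerivAt (hg.orbit ω)
      (∑ i, (ContinuousLinearMap.proj (R := ℝ) i).smulRight ((hg.partialDeriv i).orbit ω φ)) φ := by
  refine hasFDerivAt_iff_isLittleO.2 (Asymptotics.isLittleO_iff.2 fun ε hε => ?_)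
  obtain ⟨r, hr, happrox⟩ := hg.exists_abs_sub_sub_fderiv_le hε
  filter_upwards [Metric.ball_mem_nhds φ hr] with ψ hψ
  refine (BoundedContinuousFunction.norm_le (by positivity)).2 fun t => ?_
  have hshift : ψ + t • ω - (φ + t • ω) = ψ - φ := add_sub_add_right_eq_sub _ _ _
  have := happrox (φ + t • ω) (ψ + t • ω) (by rwa [dist_add_right])
  rw [hshift, fderiv_eq_sum_partialDeriv] at this
  simpa [orbit_apply] using this

theorem contDiff_orbit (hg : IsTorusFunction (n + 1) g) (ω : Fin 2 → ℝ) :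
    ContDiff ℝ 1 (hg.orbit ω) := by
  refine contDiff_one_iff_hasFDerivAt.2 ⟨_, ?_, hg.hasFDerivAt_orbit ω⟩
  exact continuous_finsetSum _ fun i _ =>
    (ContinuousLinearMap.smulRightL ℝ _ _ _).continuous.comp
      ((hg.partialDeriv i).continuous_orbit ω)

theorem partialDeriv_orbit (hg : IsTorusFunction (n + 1) g) (ω : Fin 2 → ℝ) (i : Fin 2) :
    Isochronous.partialDeriv i (hg.orbit ω) = (hg.partialDeriv i).orbit ω := by
  funext φ
  fin_cases i <;>
  simp [Isochronous.partialDeriv, (hg.hasFDerivAt_orbit ω φ).fderiv]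

end IsTorusFunction

/-! ### The flow -/

/-- The perturbations for which the splitting is studied: even functions of class `C²` on the
torus. The evenness makes the flow reversible. -/
structure IsPotential (f : (Fin 2 → ℝ) → ℝ) : Prop extends IsTorusFunction 2 f where
  even : Function.Even f

theorem partialDeriv_neg {g : (Fin 2 → ℝ) → ℝ} (hg : Function.Even g) (i : Fin 2) (φ : Fin 2 → ℝ) :
    partialDeriv i g (-φ) = -partialDeriv i g φ := by
  have hcomp := (ContinuousLinearEquiv.neg ℝ (M := Fin 2 → ℝ)).comp_right_fderiv (f := g) (x := φ)
  have hg_comp : g ∘ ContinuousLinearEquiv.neg ℝ (M := Fin 2 → ℝ) = g := funext hg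
  rw [hg_comp] at hcomp
  simp [partialDeriv, hcomp]

/-- The Hamiltonian vector field of `hamiltonian f ω μ` in explicit form. -/
def flowField (f : (Fin 2 → ℝ) → ℝ) (ω : Fin 2 → ℝ) (μ : ℝ) (z : Phase) : Phase :=
  (z.2.2.1, ω, sin z.1 * (1 - μ * f z.2.1),
    fun i => -(μ * ((1 - cos z.1) * partialDeriv i f z.2.1)))

theorem contDiff_hamiltonian {f : (Fin 2 → ℝ) → ℝ} {n : WithTop ℕ∞} (hf : ContDiff ℝ n f)
    (ω : Fin 2 → ℝ) (μ : ℝ) : ContDiff ℝ n (hamiltonian f ω μ) := by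
  unfold hamiltonian
  fun_prop

theorem fderiv_hamiltonian_apply {f : (Fin 2 → ℝ) → ℝ} {z : Phase}
    (hf : DifferentiableAt ℝ f z.2.1) (ω : Fin 2 → ℝ) (μ : ℝ) (v : Phase) :
    fderiv ℝ (hamiltonian f ω μ) z v =
      ω 0 * v.2.2.2 0 + ω 1 * v.2.2.2 1 + z.2.2.1 * v.2.2.1
        - sin z.1 * (1 - μ * f z.2.1) * v.1
        + μ * ((1 - cos z.1) * fderiv ℝ f z.2.1 v.2.1) := by
  have hq : HasFDerivAt (fun z : Phase => z.1) (.fst ℝ _ _) z := hasFDerivAt_fst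
  have hφ : HasFDerivAt (fun z : Phase => z.2.1) (.fst ℝ _ _ ∘L .snd ℝ _ _) z :=
    hasFDerivAt_snd.fst
  have hp : HasFDerivAt (fun z : Phase => z.2.2.1) (.fst ℝ _ _ ∘L .snd ℝ _ _ ∘L .snd ℝ _ _) z :=
    hasFDerivAt_snd.snd.fst
  have hA : HasFDerivAt (fun z : Phase => z.2.2.2) (.snd ℝ _ _ ∘L .snd ℝ _ _ ∘L .snd ℝ _ _) z :=
    hasFDerivAt_snd.snd.snd
  have hA_apply := hasFDerivAt_pi'.1 hA
  have hH := (((((hA_apply 0).const_mul (ω 0)).add ((hA_apply 1).const_mul (ω 1))).add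
    ((hp.pow 2).mul_const (1 / 2))).add (hq.cos.sub_const 1)).add
    (((hq.cos.const_sub 1).mul (hf.hasFDerivAt.comp z hφ)).const_mul μ)
  have hderiv : HasFDerivAt (hamiltonian f ω μ) _ z :=
    hH.congr_of_eventuallyEq (.of_forall fun z => by
      simp only [hamiltonian, Pi.mul_apply, Function.comp_apply, Pi.add_apply]
      ring)
  rw [hderiv.fderiv]
  simp only [Nat.add_one_sub_one, pow_one, nsmul_eq_mul, Nat.cast_ofNat, Function.comp_apply,
    smul_neg, smul_add, add_apply, smul_apply, ContinuousLinearMap.comp_apply,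
    ContinuousLinearMap.coe_snd', ContinuousLinearMap.proj_apply, smul_eq_mul,
    ContinuousLinearMap.coe_fst', neg_apply]
  ring

theorem hamiltonianField_hamiltonian {f : (Fin 2 → ℝ) → ℝ} (hf : Differentiable ℝ f)
    (ω : Fin 2 → ℝ) (μ : ℝ) : hamiltonianField (hamiltonian f ω μ) = flowField f ω μ := by
  funext z
  refine Prod.ext ?_ (Prod.ext (funext fun i => ?_) (Prod.ext ?_ (funext fun i => ?_)))
  · simp [hamiltonianField, flowField, fderiv_hamiltonian_apply (hf _)]
  · fin_cases i <;> simp [hamiltonianField, flowField, fderiv_hamiltonian_apply (hf _)]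
  · simp [hamiltonianField, flowField, fderiv_hamiltonian_apply (hf _)]
  · simp [hamiltonianField, flowField, fderiv_hamiltonian_apply (hf _), partialDeriv]

theorem isPicardLindelof_of_norm_le {E : Type*} [NormedAddCommGroup E] [NormedSpace ℝ E]
    [ProperSpace E] {v : E → E} (hv : ContDiff ℝ 1 v) {C : ℝ} (hC : 0 ≤ C)
    (hvC : ∀ x, ‖v x‖ ≤ ‖x‖ + C) (x : E) :
    ∃ a L K : NNReal, IsPicardLindelof (fun _ => v) (tmin := -(1 / 2)) (tmax := 1 / 2)
      ⟨0, by norm_num, by norm_num⟩ x a 0 L K := by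
  obtain ⟨R, hR⟩ : ∃ R : NNReal, (R : ℝ) = ‖x‖ + C + 1 := ⟨⟨_, by positivity⟩, rfl⟩
  obtain ⟨K, hK⟩ := (isCompact_closedBall x R).exists_bound_of_continuousOn
    (hv.continuous_fderiv one_ne_zero).continuousOn
  refine ⟨R, 2 * R, K.toNNReal, .of_time_independent (fun y hy => (hvC y).trans ?_) ?_ ?_⟩
  · have htriangle : ‖y‖ ≤ ‖y - x‖ + ‖x‖ := by simpa using norm_add_le (y - x) x
    rw [mem_closedBall_iff_norm] at hy
    rw [NNReal.coe_mul, NNReal.coe_ofNat]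
    linarith
  · exact (convex_closedBall x R).lipschitzOnWith_of_nnnorm_fderiv_le
      (fun y _ => hv.differentiable one_ne_zero y)
      fun y hy => NNReal.le_toNNReal_of_coe_le (hK y hy)
  · norm_num
    linarith

theorem exists_isIntegralCurve_of_norm_le {E : Type*} [NormedAddCommGroup E] [NormedSpace ℝ E]
    [ProperSpace E] {v : E → E} (hv : ContDiff ℝ 1 v) {C : ℝ} (hC : 0 ≤ C)
    (hvC : ∀ x, ‖v x‖ ≤ ‖x‖ + C) (x : E) :
    ∃ γ : ℝ → E, γ 0 = x ∧ IsIntegralCurve γ fun _ => v := by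
  have hlocal : ∀ x : E, ∃ γ : ℝ → E, γ 0 = x ∧
      IsMIntegralCurveOn (I := modelWithCornersSelf ℝ E) γ v (Ioo (-(1 / 2)) (1 / 2)) := fun x => by
    obtain ⟨a, L, K, hPL⟩ := isPicardLindelof_of_norm_le hv hC hvC x
    obtain ⟨γ, hγ0, hγ⟩ := hPL.exists_eq_forall_mem_Icc_hasDerivWithinAt₀
    exact ⟨γ, hγ0, fun t ht => ((hγ t (Ioo_subset_Icc_self ht)).mono
      Ioo_subset_Icc_self).hasFDerivWithinAt.hasMFDerivWithinAt⟩
  obtain ⟨γ, hγ0, hγ⟩ := exists_isMIntegralCurve_of_isMIntegralCurveOn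
    (I := modelWithCornersSelf ℝ E) (v := v)
    (contMDiff_vectorSpace_iff_contDiff.2 hv) (by norm_num : (0 : ℝ) < 1 / 2) hlocal x
  refine ⟨γ, hγ0, fun t => ?_⟩
  have hγ_fderiv : HasFDerivAt γ ((1 : ℝ →L[ℝ] ℝ).smulRight (v (γ t))) t := (hγ t).hasFDerivAt
  simpa using hγ_fderiv.hasDerivAt

section Potential

variable {f : (Fin 2 → ℝ) → ℝ}

theorem contDiff_flowField (hf : ContDiff ℝ 2 f) (ω : Fin 2 → ℝ) (μ : ℝ) :
    ContDiff ℝ 1 (flowField f ω μ) := by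
  have : ContDiff ℝ 1 f := hf.of_le one_le_two
  have : ∀ i, ContDiff ℝ 1 (partialDeriv i f) := fun i =>
    (hf.fderiv_right (m := 1) le_rfl).clm_apply contDiff_const
  unfold flowField
  fun_prop

theorem norm_flowField_le {C : ℝ} (hC : 0 ≤ C) (hfC : ∀ φ, |f φ| ≤ C)
    (hfC' : ∀ i φ, |partialDeriv i f φ| ≤ C) (ω : Fin 2 → ℝ) (μ : ℝ) (z : Phase) :
    ‖flowField f ω μ z‖ ≤ ‖z‖ + (‖ω‖ + (1 + |μ| * C) + |μ| * (2 * C)) := by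
  have hz : 0 ≤ ‖z‖ := norm_nonneg z
  have hω : 0 ≤ ‖ω‖ := norm_nonneg ω
  have hμC : 0 ≤ |μ| * C := by positivity
  refine max_le ?_ (max_le ?_ (max_le ?_ ((pi_norm_le_iff_of_nonneg (by linarith)).2 fun i => ?_)))
  · have : ‖z.2.2.1‖ ≤ ‖z‖ := (norm_fst_le _).trans ((norm_snd_le _).trans (norm_snd_le _))
    exact this.trans (by linarith)
  · change ‖ω‖ ≤ _
    linarith
  · calc |sin z.1 * (1 - μ * f z.2.1)| ≤ 1 * (|1| + |μ| * |f z.2.1|) := by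
          rw [abs_mul, ← abs_mul μ]
          gcongr
          exacts [abs_sin_le_one _, abs_sub _ _]
      _ ≤ 1 + |μ| * C := by rw [one_mul, abs_one]; gcongr; exact hfC _
      _ ≤ _ := by linarith
  · calc |-(μ * ((1 - cos z.1) * partialDeriv i f z.2.1))|
        = |μ| * ((1 - cos z.1) * |partialDeriv i f z.2.1|) := by
          rw [abs_neg, abs_mul, abs_mul, abs_of_nonneg (sub_nonneg.2 (cos_le_one _))]
      _ ≤ |μ| * (2 * C) := by
          gcongr
          exacts [by linarith [neg_one_le_cos z.1], hfC' _ _]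
      _ ≤ _ := by linarith

theorem IsTorusFunction.exists_motion (hf : IsTorusFunction 2 f) (ω : Fin 2 → ℝ) (μ : ℝ)
    (z : Phase) : ∃ γ : ℝ → Phase, γ 0 = z ∧ IsIntegralCurve γ fun _ => flowField f ω μ := by
  obtain ⟨C, hC, hfC⟩ := hf.exists_bound
  choose C' hC' hfC' using fun i => (hf.partialDeriv i).exists_bound
  have hle : ∀ i, C' i ≤ C + C' 0 + C' 1 :=
    Fin.forall_fin_two.2 ⟨by linarith [hC' 1], by linarith [hC' 0]⟩
  refine exists_isIntegralCurve_of_norm_le (contDiff_flowField hf.contDiff ω μ) ?_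
    (norm_flowField_le (C := C + C' 0 + C' 1) ?_ (fun φ => (hfC φ).trans ?_)
      (fun i φ => (hfC' i φ).trans (hle i)) ω μ) z
  · have := hC' 0; have := hC' 1; positivity
  · linarith [hC' 0, hC' 1]
  · linarith [hC' 0, hC' 1]

end Potential

/-! ### Motions from solutions of the integral equations -/

theorem eqOn_const_of_hasDerivAt_zero {g : ℝ → ℝ} (hg : ContinuousOn g (Ici 0))
    (hg' : ∀ t, 0 < t → HasDerivAt g 0 t) : EqOn g (fun _ => g 0) (Ici 0) := by
  intro t ht
  rcases (mem_Ici.1 ht).eq_or_lt with rfl | ht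
  · rfl
  obtain ⟨-, -, hslope⟩ := exists_hasDerivAt_eq_slope g (fun _ => 0) ht
    (hg.mono Icc_subset_Ici_self) fun r hr => hg' r hr.1
  rwa [eq_comm, div_eq_zero_iff, or_iff_left (sub_pos.2 ht).ne', sub_eq_zero] at hslope

theorem eqOn_zero_of_hasDerivAt_zero_of_tendsto {g : ℝ → ℝ} (hg : ContinuousOn g (Ici 0))
    (hg' : ∀ t, 0 < t → HasDerivAt g 0 t) (hlim : Tendsto g atTop (𝓝 0)) :
    EqOn g 0 (Ici 0) := by
  have hconst := eqOn_const_of_hasDerivAt_zero hg hg'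
  have hconst_ev : (fun _ => g 0) =ᶠ[atTop] g :=
    (eventually_ge_atTop 0).mono fun s hs => (hconst (mem_Ici.2 hs)).symm
  have hzero : g 0 = 0 := tendsto_nhds_unique (tendsto_const_nhds.congr' hconst_ev) hlim
  exact fun t ht => (hconst ht).trans hzero

theorem pos_of_hasDerivAt_mul {g a : ℝ → ℝ} (ha : Continuous a) (hg : Continuous g)
    (hg' : ∀ t, 0 < t → HasDerivAt g (a t * g t) t) (hg0 : 0 < g 0) {t : ℝ} (ht : 0 ≤ t) :
    0 < g t := by
  set I : ℝ → ℝ := fun t => ∫ r in (0 : ℝ)..t, a r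
  have hI : ∀ t, HasDerivAt I (a t) t := fun t => (ha.integral_hasStrictDerivAt 0 t).hasDerivAt
  have : Continuous I := continuous_iff_continuousAt.2 fun t => (hI t).continuousAt
  have hderiv : ∀ s ∈ interior (Icc 0 t), HasDerivWithinAt (fun s => g s * exp (-I s)) 0
      (interior (Icc 0 t)) s := fun s hs => by
    rw [interior_Icc] at hs
    exact (((hg' s hs.1).mul (hI s).neg.exp).congr_deriv (by ring)).hasDerivWithinAt
  have hmono := monotoneOn_of_hasDerivWithinAt_nonneg (convex_Icc 0 t)
    (f := fun s => g s * exp (-I s)) (f' := 0) (by fun_prop) hderiv fun _ _ => le_rfl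
  have hle := hmono (left_mem_Icc.2 ht) (right_mem_Icc.2 ht) ht
  exact pos_of_mul_pos_left (lt_of_lt_of_le (mul_pos hg0 (exp_pos _)) hle) (exp_pos _).le

theorem hasDerivAt_expNegBC {t : ℝ} (ht : 0 < t) : HasDerivAt expNegBC (-expNegBC t) t := by
  refine ((hasDerivAt_neg t).exp.congr_of_eventuallyEq (ofHalfLine_eventuallyEq ht)).congr_deriv ?_
  rw [expNegBC_apply ht.le, mul_neg_one]

theorem hasDerivAt_tanhBC {t : ℝ} (ht : 0 < t) : HasDerivAt tanhBC (1 - tanh t ^ 2) t :=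
  (hasDerivAt_tanh t).congr_of_eventuallyEq (ofHalfLine_eventuallyEq ht)

theorem hasDerivAt_expSechBC {t : ℝ} (ht : 0 < t) :
    HasDerivAt expSechBC ((1 - 2 * tanh t) * expSechBC t) t := by
  refine ((hasDerivAt_expSech t).congr_of_eventuallyEq (ofHalfLine_eventuallyEq ht)).congr_deriv ?_
  rw [expSechBC_apply ht.le, mul_comm]

theorem tendsto_expNegBC_mul (h : BC) : Tendsto (fun t => expNegBC t * h t) atTop (𝓝 0) := by
  have hlim : Tendsto (fun t => exp (-t) * ‖h‖) atTop (𝓝 0) := by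
    simpa only [zero_mul] using tendsto_exp_neg_atTop_nhds_zero.mul_const ‖h‖
  refine squeeze_zero_norm' ?_ hlim
  filter_upwards [eventually_ge_atTop 0] with t ht
  rw [expNegBC_apply ht, norm_mul, norm_of_nonneg (exp_pos _).le]
  exact mul_le_mul_of_nonneg_left (h.norm_coe_le_norm t) (exp_pos _).le

theorem one_sub_negCosHalf_sq (d : BC) {t : ℝ} (ht : 0 ≤ t) :
    1 - negCosHalf d t ^ 2 = expNegBC t * scaledSinSq d t := by
  have hexp : expNegBC t * expSechBC t = 1 - tanh t ^ 2 := by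
    rw [expNegBC_apply ht, expSechBC_apply ht, exp_neg_mul_expSech]
  rw [negCosHalf_apply, scaledSinSq_apply, tanhBC_apply ht]
  linear_combination -hexp

theorem tendsto_negCosHalf (d : BC) : Tendsto (negCosHalf d) atTop (𝓝 1) := by
  have hlim : Tendsto tanhBC atTop (𝓝 1) := tendsto_tanh_atTop.congr' <|
    (eventually_ge_atTop 0).mono fun t ht => (tanhBC_apply ht).symm
  have hsub := hlim.sub (tendsto_expNegBC_mul d)
  rwa [sub_zero] at hsub

section Defect

variable {D₀ : ℝ} {G d u : BC} (hz : defect ((D₀, G), (d, u)) = 0)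

include hz

theorem hasDerivAt_negCosHalf_of_defect {t : ℝ} (ht : 0 < t) :
    HasDerivAt (negCosHalf d) ((1 - negCosHalf d t ^ 2) * (1 + u t)) t := by
  have hd_eq := (defect_eq_zero_iff.1 hz).1
  have hd : HasDerivAt d ((1 - 2 * tanh t) * d t + forwardSource d u t) t := by
    have hsum := ((hasDerivAt_expSechBC ht).const_mul D₀).add
      (hasDerivAt_forwardOp (forwardSource d u) ht)
    have hd_apply : ∀ s, d s = D₀ * expSechBC s + forwardOp (forwardSource d u) s :=
      DFunLike.congr_fun hd_eq
    refine (hsum.congr_of_eventuallyEq (.of_forall hd_apply)).congr_deriv ?_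
    linear_combination (2 * tanh t - 1) * hd_apply t
  refine ((hasDerivAt_tanhBC ht).sub ((hasDerivAt_expNegBC ht).mul hd)).congr_deriv ?_
  rw [one_sub_negCosHalf_sq d ht.le, ← exp_neg_mul_expSech, ← expSechBC_apply ht.le,
    ← expNegBC_apply ht.le, ← tanhBC_apply ht.le]
  rw [forwardSource_apply, scaledSinSq_apply]
  ring

theorem hasDerivAt_of_defect {t : ℝ} (ht : 0 < t) :
    HasDerivAt u (negCosHalf d t * ((1 + u t) ^ 2 - 1 + G t)) t := by
  have hu_apply : ∀ s, u s = -backwardOp (backwardSource G d u) s :=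
    DFunLike.congr_fun (defect_eq_zero_iff.1 hz).2
  refine ((hasDerivAt_backwardOp (backwardSource G d u) ht).neg.congr_of_eventuallyEq
    (.of_forall hu_apply)).congr_deriv ?_
  have hneg : backwardOp (backwardSource G d u) t = -u t := (neg_eq_iff_eq_neg.2 (hu_apply t)).symm
  rw [hneg, ← tanhBC_apply ht.le, backwardSource_apply, negCosHalf_apply]
  ring

theorem negCosHalf_zero_of_defect : negCosHalf d 0 = -D₀ := by
  have hd : d 0 = D₀ * expSechBC 0 + forwardOp (forwardSource d u) 0 :=
    DFunLike.congr_fun (defect_eq_zero_iff.1 hz).1 0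
  rw [negCosHalf_apply, hd, forwardOp_zero_time, tanhBC_apply le_rfl, expNegBC_apply le_rfl,
    expSechBC_apply le_rfl, expSech]
  simp

theorem negCosHalf_mem_Ioo (hD₀ : |D₀| < 1) {t : ℝ} (ht : 0 ≤ t) :
    negCosHalf d t ∈ Ioo (-1) 1 := by
  have hT := (negCosHalf d).continuous
  have hu := u.continuous
  have hpos : 0 < 1 - negCosHalf d t ^ 2 := by
    refine pos_of_hasDerivAt_mul (g := fun s => 1 - negCosHalf d s ^ 2)
      (a := fun s => -(2 * negCosHalf d s * (1 + u s))) (by fun_prop) (by fun_prop)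
      (fun s hs => ?_) ?_ ht
    · refine (((hasDerivAt_negCosHalf_of_defect hz hs).fun_pow 2).const_sub 1).congr_deriv ?_
      rw [Nat.cast_ofNat, Nat.add_one_sub_one, pow_one]
      ring
    · rw [negCosHalf_zero_of_defect hz, neg_sq, sub_pos]
      exact (sq_lt_one_iff_abs_lt_one D₀).2 hD₀
  exact abs_lt.1 ((sq_lt_one_iff_abs_lt_one _).1 (sub_pos.1 hpos))

end Defect

theorem exists_isIntegralCurve_eqOn {E : Type*} [NormedAddCommGroup E] [NormedSpace ℝ E] {v : E → E}
    (hv : Continuous v) {γ η : ℝ → E} (hγ : Continuous γ)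
    (hγ' : ∀ t, 0 < t → HasDerivAt γ (v (γ t)) t) (hη : IsIntegralCurve η fun _ => v)
    (h0 : η 0 = γ 0) : ∃ ζ : ℝ → E, IsIntegralCurve ζ (fun _ => v) ∧ EqOn ζ γ (Ici 0) := by
  have hγ0 : HasDerivWithinAt γ (v (γ 0)) (Ici 0) 0 := by
    refine hasDerivWithinAt_Ici_of_tendsto_deriv (s := Ioi 0)
      (fun s hs => (hγ' s hs).differentiableAt.differentiableWithinAt)
      hγ.continuousAt.continuousWithinAt self_mem_nhdsWithin ?_
    refine (((hv.comp hγ).tendsto 0).mono_left nhdsWithin_le_nhds).congr' ?_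
    filter_upwards [self_mem_nhdsWithin] with s hs using (hγ' s hs).deriv.symm
  set ζ : ℝ → E := (Iic 0).piecewise η γ
  have hζη : EqOn ζ η (Iic 0) := piecewise_eqOn _ _ _
  have hζγ : EqOn ζ γ (Ici 0) := fun t (ht : 0 ≤ t) => by
    rcases ht.eq_or_lt with rfl | ht
    exacts [(hζη self_mem_Iic).trans h0, piecewise_eq_of_notMem _ _ _ ht.not_ge]
  refine ⟨ζ, fun t => ?_, hζγ⟩
  rcases lt_trichotomy t 0 with ht | rfl | ht
  · rw [hζη ht.le]
    exact (hη t).congr_of_eventuallyEq (hζη.eventuallyEq_of_mem (Iic_mem_nhds ht))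
  · have hleft : HasDerivWithinAt ζ (v (ζ 0)) (Iic 0) 0 := by
      rw [hζη self_mem_Iic]
      exact (hη 0).hasDerivWithinAt.congr hζη (hζη self_mem_Iic)
    have hright : HasDerivWithinAt ζ (v (ζ 0)) (Ici 0) 0 := by
      rw [hζγ self_mem_Ici]
      exact hγ0.congr hζγ (hζγ self_mem_Ici)
    simpa only [Iic_union_Ici, hasDerivWithinAt_univ] using hleft.union hright
  · rw [hζγ ht.le]
    exact (hγ' t ht).congr_of_eventuallyEq (hζγ.eventuallyEq_of_mem (Ici_mem_nhds ht))

section Motion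

variable {f : (Fin 2 → ℝ) → ℝ} (hf : IsTorusFunction 2 f) (ω : Fin 2 → ℝ) (μ : ℝ) (B φ : Fin 2 → ℝ)
  (d u : BC)

/-- Along the motion of a solution `(d, u)` of the integral equations, the actions are
`B + μ e^{-t} y` for the bounded function `y = actionTail hf ω φ d`. -/
def actionTail (i : Fin 2) : BC :=
  tailOp ((2 : ℝ) • (scaledSinSq d * (hf.partialDeriv i).orbit ω φ))

/-- The motion belonging to a solution `(d, u)` of the integral equations. -/
def whiskerMotion (t : ℝ) : Phase :=
  (2 * arccos (-negCosHalf d t), φ + t • ω, 2 * √(1 - negCosHalf d t ^ 2) * (1 + u t),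
    fun i => B i + μ * (expNegBC t * actionTail hf ω φ d i t))

theorem continuous_whiskerMotion : Continuous (whiskerMotion hf ω μ B φ d u) := by
  have := (negCosHalf d).continuous
  have := u.continuous
  have := expNegBC.continuous
  have := fun i => (actionTail hf ω φ d i).continuous
  have := continuous_arccos
  unfold whiskerMotion
  fun_prop

theorem hasDerivAt_expNegBC_mul_actionTail (i : Fin 2) {t : ℝ} (ht : 0 < t) :
    HasDerivAt (fun t => expNegBC t * actionTail hf ω φ d i t)
      (-(2 * (1 - negCosHalf d t ^ 2) * partialDeriv i f (φ + t • ω))) t := by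
  refine ((hasDerivAt_expNegBC ht).mul (hasDerivAt_tailOp _ ht)).congr_deriv ?_
  rw [one_sub_negCosHalf_sq d ht.le, ← IsTorusFunction.orbit_apply (hf.partialDeriv i)]
  simp only [BoundedContinuousFunction.coe_smul, BoundedContinuousFunction.coe_mul, Pi.mul_apply,
    smul_eq_mul]
  ring

variable {hf ω μ B φ d u}

theorem hasDerivAt_two_mul_arccos_neg {T : ℝ → ℝ} {w t : ℝ}
    (hT : HasDerivAt T ((1 - T t ^ 2) * w) t) (hmem : T t ∈ Ioo (-1) 1) :
    HasDerivAt (fun t => 2 * arccos (-T t)) (2 * √(1 - T t ^ 2) * w) t := by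
  have hpos : 0 < 1 - T t ^ 2 := sub_pos.2 ((sq_lt_one_iff_abs_lt_one _).2 (abs_lt.2 hmem))
  have harccos := hasDerivAt_arccos (x := -T t) (by linarith [hmem.2]) (by linarith [hmem.1])
  refine ((harccos.comp t hT.neg).const_mul 2).congr_deriv ?_
  have := (sqrt_pos.2 hpos).ne'
  rw [neg_sq]
  field_simp
  rw [sq_sqrt hpos.le]

theorem hasDerivAt_two_mul_sqrt_one_sub_sq_mul {T w : ℝ → ℝ} {g t : ℝ}
    (hT : HasDerivAt T ((1 - T t ^ 2) * w t) t)
    (hw : HasDerivAt w (T t * (w t ^ 2 - 1 + g)) t) (hmem : T t ∈ Ioo (-1) 1) :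
    HasDerivAt (fun t => 2 * √(1 - T t ^ 2) * w t) (sin (2 * arccos (-T t)) * (1 - g)) t := by
  have hpos : 0 < 1 - T t ^ 2 := sub_pos.2 ((sq_lt_one_iff_abs_lt_one _).2 (abs_lt.2 hmem))
  refine (((((hT.fun_pow 2).const_sub 1).sqrt hpos.ne').const_mul 2).mul hw).congr_deriv ?_
  rw [sin_two_mul, cos_arccos (by linarith [hmem.2]) (by linarith [hmem.1]), sin_arccos, neg_sq]
  have hsq := sq_sqrt hpos.le
  have := (sqrt_pos.2 hpos).ne'
  generalize √(1 - T t ^ 2) = s at *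
  rw [← hsq]
  field_simp
  simp only [Nat.cast_ofNat, Nat.add_one_sub_one, pow_one]
  ring

theorem hasDerivAt_whiskerMotion {D₀ : ℝ} (hD₀ : |D₀| < 1)
    (hz : defect ((D₀, μ • hf.orbit ω φ), (d, u)) = 0) {t : ℝ} (ht : 0 < t) :
    HasDerivAt (whiskerMotion hf ω μ B φ d u)
      (flowField f ω μ (whiskerMotion hf ω μ B φ d u t)) t := by
  have hmem := negCosHalf_mem_Ioo hz hD₀ ht.le
  have hT := hasDerivAt_negCosHalf_of_defect hz ht
  have hw : HasDerivAt (fun t => 1 + u t) _ t := (hasDerivAt_of_defect hz ht).const_add 1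
  refine (hasDerivAt_two_mul_arccos_neg hT hmem).prodMk (.prodMk ?_
    ((hasDerivAt_two_mul_sqrt_one_sub_sq_mul hT hw hmem).prodMk (hasDerivAt_pi.2 fun i => ?_)))
  · exact (((hasDerivAt_id t).smul_const ω).const_add φ).congr_deriv (one_smul ℝ ω)
  · refine (((hasDerivAt_expNegBC_mul_actionTail hf ω φ d i ht).const_mul μ).const_add
      (B i)).congr_deriv ?_
    simp only [whiskerMotion]
    rw [cos_two_mul, cos_arccos (by linarith [hmem.2]) (by linarith [hmem.1])]
    ring

theorem whiskerMotion_zero {q : ℝ} (hq : q ∈ Ioo 0 (2 * π))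
    (hz : defect ((cos (q / 2), μ • hf.orbit ω φ), (d, u)) = 0) :
    whiskerMotion hf ω μ B φ d u 0 =
      (q, φ, 2 * sin (q / 2) * (1 + u 0), B + μ • fun i => actionTail hf ω φ d i 0) := by
  obtain ⟨hq_pos, hq_lt⟩ := hq
  have hangle : 2 * arccos (cos (q / 2)) = q := by
    rw [arccos_cos (by linarith) (by linarith)]; ring
  have hsin : √(1 - cos (q / 2) ^ 2) = sin (q / 2) := by
    rw [← sin_sq, sqrt_sq (sin_nonneg_of_nonneg_of_le_pi (by linarith) (by linarith))]
  simp only [whiskerMotion, negCosHalf_zero_of_defect hz, neg_neg, neg_sq, hangle, hsin, zero_smul,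
    add_zero, expNegBC_apply le_rfl, neg_zero, exp_zero, one_mul]
  rfl

theorem tendsto_mul_of_tendsto_zero {g : ℝ → ℝ} (hg : Tendsto g atTop (𝓝 0)) (h : BC) :
    Tendsto (fun t => g t * h t) atTop (𝓝 0) :=
  hg.zero_mul_isBoundedUnder_le (isBoundedUnder_of ⟨‖h‖, h.norm_coe_le_norm⟩)

theorem tendsto_infDist_torus {γ : ℝ → Phase} (hq : Tendsto (fun t => (γ t).1) atTop (𝓝 (2 * π)))
    (hp : Tendsto (fun t => (γ t).2.2.1) atTop (𝓝 0))
    (hA : Tendsto (fun t => (γ t).2.2.2) atTop (𝓝 B)) :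
    Tendsto (fun t => Metric.infDist (γ t) (torus B)) atTop (𝓝 0) := by
  have hdist : Tendsto (fun t => dist (γ t) (2 * π, (γ t).2.1, 0, B)) atTop (𝓝 0) := by
    have hmax := (tendsto_iff_dist_tendsto_zero.1 hq).max
      ((tendsto_const_nhds (x := (0 : ℝ))).max
        ((tendsto_iff_dist_tendsto_zero.1 hp).max (tendsto_iff_dist_tendsto_zero.1 hA)))
    simpa only [Prod.dist_eq, dist_self, max_self] using hmax
  refine squeeze_zero (fun t => Metric.infDist_nonneg) (fun t => ?_) hdist
  exact Metric.infDist_le_dist_of_mem ⟨1, (γ t).2.1, by rw [Int.cast_one, mul_one]⟩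

theorem tendsto_infDist_whiskerMotion :
    Tendsto (fun t => Metric.infDist (whiskerMotion hf ω μ B φ d u t) (torus B)) atTop (𝓝 0) := by
  have hT := tendsto_negCosHalf d
  have hsqrt : Tendsto (fun t => 2 * √(1 - negCosHalf d t ^ 2)) atTop (𝓝 0) := by
    simpa using ((hT.pow 2).const_sub 1).sqrt.const_mul 2
  refine tendsto_infDist_torus ?_ (tendsto_mul_of_tendsto_zero hsqrt (1 + u))
    (tendsto_pi_nhds.2 fun i => ?_)
  · have hangle := ((continuous_arccos.tendsto (-1)).comp hT.neg).const_mul 2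
    rwa [arccos_neg_one] at hangle
  · have htail := ((tendsto_expNegBC_mul (actionTail hf ω φ d i)).const_mul μ).const_add (B i)
    rwa [mul_zero, add_zero] at htail

theorem mem_stableWhisker_of_defect {q : ℝ} (hq : q ∈ Ioo 0 (2 * π)) (hu : ‖u‖ < 1)
    (hz : defect ((cos (q / 2), μ • hf.orbit ω φ), (d, u)) = 0) :
    ((q, φ, 2 * sin (q / 2) * (1 + u 0), B + μ • fun i => actionTail hf ω φ d i 0) : Phase) ∈
      stableWhisker (hamiltonian f ω μ) B := by
  have hcos : |cos (q / 2)| < 1 := by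
    rw [← sq_lt_one_iff_abs_lt_one, cos_sq', sub_lt_self_iff]
    exact pow_pos (sin_pos_of_pos_of_lt_pi (by linarith [hq.1]) (by linarith [hq.2])) 2
  obtain ⟨η, hη0, hη⟩ := hf.exists_motion ω μ (whiskerMotion hf ω μ B φ d u 0)
  obtain ⟨ζ, hζ, hζ_eq⟩ := exists_isIntegralCurve_eqOn
    (contDiff_flowField hf.contDiff ω μ).continuous (continuous_whiskerMotion hf ω μ B φ d u)
    (fun t ht => hasDerivAt_whiskerMotion hcos hz ht) hη hη0
  refine ⟨ζ, ?_, ?_, ?_, fun t ht => ?_⟩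
  · rwa [hamiltonianField_hamiltonian (hf.contDiff.differentiable two_ne_zero)]
  · rw [hζ_eq self_mem_Ici, whiskerMotion_zero hq hz]
  · exact (tendsto_infDist_whiskerMotion (hf := hf) (ω := ω) (φ := φ) (d := d) (u := u)).congr'
      ((eventually_ge_atTop 0).mono fun t ht =>
        congrArg (Metric.infDist · (torus B)) (hζ_eq ht).symm)
  · obtain ⟨hneg, hlt⟩ := negCosHalf_mem_Ioo hz hcos ht
    rw [hζ_eq ht]
    refine ⟨mul_pos two_pos (arccos_pos.2 (by linarith)),
      mul_lt_mul_of_pos_left ((arccos_le_pi _).lt_of_ne fun h => ?_) two_pos,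
      mul_pos (mul_pos two_pos (sqrt_pos.2 ?_)) ?_⟩
    · linarith [arccos_eq_pi.1 h]
    · exact sub_pos.2 ((sq_lt_one_iff_abs_lt_one _).2 (abs_lt.2 ⟨hneg, hlt⟩))
    · linarith [(abs_le.1 (u.abs_apply_le t)).1]

end Motion

/-! ### Uniqueness of the motions on the stable whisker -/

section HalfLine

variable {f f' g g' : ℝ → ℝ} {a b t : ℝ}

theorem monotoneOn_Ici_of_hasDerivAt_nonneg (hf : ∀ t, 0 ≤ t → HasDerivAt f (f' t) t)
    (hf' : ∀ t, 0 ≤ t → 0 ≤ f' t) : MonotoneOn f (Ici 0) :=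
  monotoneOn_of_hasDerivWithinAt_nonneg (convex_Ici 0)
    (fun t ht => (hf t ht).continuousAt.continuousWithinAt)
    (fun t ht => (hf t (interior_subset ht)).hasDerivWithinAt)
    fun t ht => hf' t (interior_subset ht)

theorem le_of_hasDerivAt_nonneg_of_tendsto (hf : ∀ t, 0 ≤ t → HasDerivAt f (f' t) t)
    (hf' : ∀ t, 0 ≤ t → 0 ≤ f' t) (ha : Tendsto f atTop (𝓝 a)) (ht : 0 ≤ t) : f t ≤ a :=
  ge_of_tendsto ha <| (eventually_ge_atTop t).mono fun _ hs =>
    monotoneOn_Ici_of_hasDerivAt_nonneg hf hf' ht (ht.trans hs) hs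

theorem abs_sub_le_sub_of_abs_hasDerivAt_le (hf : ∀ t, 0 ≤ t → HasDerivAt f (f' t) t)
    (hg : ∀ t, 0 ≤ t → HasDerivAt g (g' t) t) (hle : ∀ t, 0 ≤ t → |f' t| ≤ g' t)
    (ha : Tendsto f atTop (𝓝 a)) (hb : Tendsto g atTop (𝓝 b)) (ht : 0 ≤ t) :
    |f t - a| ≤ b - g t := by
  have hadd : f t + g t ≤ a + b :=
    le_of_hasDerivAt_nonneg_of_tendsto (f := f + g) (fun t ht => (hf t ht).add (hg t ht))
      (fun t ht => by linarith [(abs_le.1 (hle t ht)).1]) (ha.add hb) ht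
  have hsub : g t - f t ≤ b - a :=
    le_of_hasDerivAt_nonneg_of_tendsto (f := g - f) (fun t ht => (hg t ht).sub (hf t ht))
      (fun t ht => by linarith [(abs_le.1 (hle t ht)).2]) (hb.sub ha) ht
  exact abs_le.2 ⟨by linarith, by linarith⟩

end HalfLine

/-- The pairs `T = -cos (q / 2)`, `w = p / (2 sin (q / 2))` along a motion with
`2 π / 3 ≤ q < 2 π`, `p > 0` that is asymptotic to a torus; `G` is the forcing. -/
structure IsReducedMotion (G : BC) (T w : ℝ → ℝ) : Prop where
  hasDerivAt_fst : ∀ t, 0 ≤ t → HasDerivAt T ((1 - T t ^ 2) * w t) t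
  hasDerivAt_snd : ∀ t, 0 ≤ t → HasDerivAt w (T t * (w t ^ 2 - 1 + G t)) t
  pos : ∀ t, 0 ≤ t → 0 < w t
  sq_lt : ∀ t, 0 ≤ t → 0 < 1 - T t ^ 2
  tendsto_one_sub_sq : Tendsto (fun t => 1 - T t ^ 2) atTop (𝓝 0)
  tendsto_mul : Tendsto (fun t => (1 - T t ^ 2) * w t ^ 2) atTop (𝓝 0)
  neg_half_le : -(1 / 2) ≤ T 0

theorem abs_mul_exp_sub_one_le {a θ x : ℝ} (hθ : |θ| ≤ x) :
    |a * exp θ - 1| ≤ (|a - 1| + x) * exp x := by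
  obtain ⟨hneg, hle⟩ := abs_le.1 hθ
  have hexp : |exp θ - 1| ≤ x * exp x := by
    have hmul : exp θ * exp (-θ) = 1 := by rw [← exp_add, add_neg_cancel, exp_zero]
    rw [abs_le]
    constructor
    · nlinarith [add_one_le_exp θ, add_one_le_exp x, abs_nonneg θ]
    · nlinarith [add_one_le_exp (-θ), exp_le_exp.2 hle, exp_pos θ]
  calc |a * exp θ - 1| = |(a - 1) * exp θ + (exp θ - 1)| := by ring_nf
    _ ≤ |a - 1| * exp θ + |exp θ - 1| := (abs_add_le _ _).trans_eq (by rw [abs_mul, abs_exp])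
    _ ≤ |a - 1| * exp x + x * exp x := by gcongr
    _ = (|a - 1| + x) * exp x := by ring

theorem abs_exp_mul_tanh_sub_le {x : ℝ} (hx : x ∈ Ioo (-1) 1) (t : ℝ) :
    |exp t * (tanh t - x)| ≤ 2 * (exp (-t) * |exp (2 * t) * ((1 - x) / (1 + x)) - 1|) := by
  obtain ⟨hneg, hlt⟩ := hx
  have hne : 1 + x ≠ 0 := by linarith
  have hpos : 0 < (1 - x) / (1 + x) := div_pos (by linarith) (by linarith)
  have heq : exp t * (tanh t - x) =
      2 * (exp (-t) * (exp (2 * t) * ((1 - x) / (1 + x)) - 1)) /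
        ((1 + (1 - x) / (1 + x)) * (1 + exp (-t) ^ 2)) := by
    have : 1 + (1 - x) / (1 + x) ≠ 0 := by positivity
    rw [tanh_eq_sinh_div_cosh, sinh_eq, cosh_eq, exp_neg, two_mul t, exp_add]
    field_simp
    ring
  have hden : 1 ≤ (1 + (1 - x) / (1 + x)) * (1 + exp (-t) ^ 2) :=
    one_le_mul_of_one_le_of_one_le (by linarith) (by linarith [sq_nonneg (exp (-t))])
  rw [heq, abs_div, abs_mul, abs_mul, abs_two, abs_exp, abs_of_pos (one_pos.trans_le hden)]
  exact div_le_self (by positivity) hden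

theorem abs_one_sub_div_one_add_sub_one_le {x : ℝ} (hx : -(1 / 2) ≤ x) :
    |(1 - x) / (1 + x) - 1| ≤ 4 * |x| := by
  have hpos : 0 < 1 + x := by linarith
  rw [div_sub_one hpos.ne', abs_div, abs_of_pos hpos, div_le_iff₀ hpos,
    show 1 - x - (1 + x) = -(2 * x) by ring, abs_neg, abs_mul, abs_two]
  nlinarith [abs_nonneg x]

namespace IsReducedMotion

variable {G : BC} {T w : ℝ → ℝ} {t : ℝ} (h : IsReducedMotion G T w)

include h

theorem neg_half_le_fst (ht : 0 ≤ t) : -(1 / 2) ≤ T t :=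
  h.neg_half_le.trans <| monotoneOn_Ici_of_hasDerivAt_nonneg h.hasDerivAt_fst
    (fun t ht => (mul_pos (h.sq_lt t ht) (h.pos t ht)).le) self_mem_Ici ht ht

theorem abs_fst_lt_one (ht : 0 ≤ t) : |T t| < 1 :=
  (sq_lt_one_iff_abs_lt_one _).1 (sub_pos.1 (h.sq_lt t ht))

theorem fst_lt_one (ht : 0 ≤ t) : T t < 1 := (abs_lt.1 (h.abs_fst_lt_one ht)).2

theorem tendsto_fst : Tendsto T atTop (𝓝 1) := by
  have hbound : Tendsto (fun t => 2 * (1 - T t ^ 2)) atTop (𝓝 0) := by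
    simpa only [mul_zero] using h.tendsto_one_sub_sq.const_mul 2
  have hlim : Tendsto (fun t => 1 - T t) atTop (𝓝 0) := by
    refine squeeze_zero' ?_ ?_ hbound
    · filter_upwards [eventually_ge_atTop 0] with t ht using by linarith [h.fst_lt_one ht]
    · filter_upwards [eventually_ge_atTop 0] with t ht
      nlinarith [h.fst_lt_one ht, h.neg_half_le_fst ht]
  simpa only [sub_sub_cancel, sub_zero] using hlim.const_sub 1

theorem abs_one_sub_sq_mul_le (ht : 0 ≤ t) :
    |(1 - T t ^ 2) * (w t ^ 2 - 1)| ≤ 2 * ‖G‖ * (1 - T t) := by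
  have hderiv : ∀ t, 0 ≤ t → HasDerivAt (fun t => (1 - T t ^ 2) * (w t ^ 2 - 1))
      (2 * (T t * G t) * ((1 - T t ^ 2) * w t)) t := fun t ht => by
    refine ((((h.hasDerivAt_fst t ht).fun_pow 2).const_sub 1).mul
      (((h.hasDerivAt_snd t ht).fun_pow 2).sub_const 1)).congr_deriv ?_
    simp only [Nat.cast_ofNat, Nat.add_one_sub_one, pow_one]
    ring
  have hle : ∀ t, 0 ≤ t → |2 * (T t * G t) * ((1 - T t ^ 2) * w t)| ≤
      2 * ‖G‖ * ((1 - T t ^ 2) * w t) := fun t ht => by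
    have hG : |T t| * |G t| ≤ 1 * ‖G‖ :=
      mul_le_mul (h.abs_fst_lt_one ht).le (G.abs_apply_le t) (abs_nonneg _) zero_le_one
    have hpos := mul_pos (h.sq_lt t ht) (h.pos t ht)
    rw [abs_mul, abs_of_pos hpos, abs_mul, abs_two, abs_mul]
    gcongr
    linarith
  have hlim : Tendsto (fun t => (1 - T t ^ 2) * (w t ^ 2 - 1)) atTop (𝓝 0) := by
    simpa only [mul_sub, mul_one, sub_zero] using h.tendsto_mul.sub h.tendsto_one_sub_sq
  simpa only [sub_zero, mul_one, mul_sub] using abs_sub_le_sub_of_abs_hasDerivAt_le hderiv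
    (fun t ht => (h.hasDerivAt_fst t ht).const_mul (2 * ‖G‖)) hle hlim
    (h.tendsto_fst.const_mul _) ht

theorem abs_sub_one_le (ht : 0 ≤ t) : |w t - 1| ≤ 4 * ‖G‖ := by
  have hlt := h.fst_lt_one ht
  have hge := h.neg_half_le_fst ht
  have hw := h.pos t ht
  have hmul : (1 - T t) * ((1 + T t) * (w t + 1) * |w t - 1|) ≤ (1 - T t) * (2 * ‖G‖) := by
    have hle := h.abs_one_sub_sq_mul_le ht
    have hfactor : (1 - T t ^ 2) * (w t ^ 2 - 1) =
      (1 - T t) * ((1 + T t) * (w t + 1) * (w t - 1)) := by ring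
    rw [hfactor, abs_mul, abs_mul, abs_of_pos (sub_pos.2 hlt),
      abs_of_pos (mul_pos (by linarith) (by linarith))] at hle
    linarith
  have hcancel := le_of_mul_le_mul_left hmul (sub_pos.2 hlt)
  have hfactor : 1 / 2 ≤ (1 + T t) * (w t + 1) := by nlinarith
  nlinarith [abs_nonneg (w t - 1)]

-- On the separatrix `T = tanh t`, where the logarithm is `-2 t`.
theorem hasDerivAt_log (ht : 0 ≤ t) :
    HasDerivAt (fun t => 2 * t + log ((1 - T t) / (1 + T t))) (2 * (1 - w t)) t := by
  have hsub : 1 - T t ≠ 0 := (sub_pos.2 (h.fst_lt_one ht)).ne'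
  have hadd : 1 + T t ≠ 0 := by linarith [h.neg_half_le_fst ht]
  have hT := h.hasDerivAt_fst t ht
  have hratio : HasDerivAt (fun t => (1 - T t) / (1 + T t)) _ t :=
    (hT.const_sub 1).div (hT.const_add 1) hadd
  refine (((hasDerivAt_id' t).const_mul 2).add
    (hratio.log (div_ne_zero hsub hadd))).congr_deriv ?_
  field_simp
  ring

theorem abs_exp_mul_ratio_sub_one_le (ht : 0 ≤ t) :
    |exp (2 * t) * ((1 - T t) / (1 + T t)) - 1| ≤
      (4 * |T 0| + 8 * ‖G‖ * t) * exp (8 * ‖G‖ * t) := by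
  have hpos : ∀ s, 0 ≤ s → 0 < (1 - T s) / (1 + T s) := fun s hs =>
    div_pos (sub_pos.2 (h.fst_lt_one hs)) (by linarith [h.neg_half_le_fst hs])
  set L : ℝ → ℝ := fun t => 2 * t + log ((1 - T t) / (1 + T t))
  have hexpL : ∀ s, 0 ≤ s → exp (L s) = exp (2 * s) * ((1 - T s) / (1 + T s)) := fun s hs => by
    rw [exp_add, exp_log (hpos s hs)]
  have hL_sub : |L t - L 0| ≤ 8 * ‖G‖ * t := by
    have hmean := (convex_Ici 0).norm_image_sub_le_of_norm_hasDerivWithin_le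
      (fun s hs => (h.hasDerivAt_log hs).hasDerivWithinAt) (C := 8 * ‖G‖) (fun s hs => ?_)
      self_mem_Ici ht
    · rwa [sub_zero, norm_of_nonneg ht] at hmean
    · rw [norm_eq_abs, abs_mul, abs_two, abs_sub_comm]
      linarith [h.abs_sub_one_le hs]
  have hbound := abs_mul_exp_sub_one_le (a := (1 - T 0) / (1 + T 0)) hL_sub
  have hexp0 : exp (L 0) = (1 - T 0) / (1 + T 0) := by
    rw [hexpL 0 le_rfl, mul_zero, exp_zero, one_mul]
  rw [← hexp0, ← exp_add, add_sub_cancel, hexpL t ht, hexp0] at hbound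
  exact hbound.trans (by gcongr; exact abs_one_sub_div_one_add_sub_one_le h.neg_half_le)

theorem abs_exp_mul_tanh_sub_fst_le (hG : 16 * ‖G‖ ≤ 1) (ht : 0 ≤ t) :
    |exp t * (tanh t - T t)| ≤ 8 * |T 0| + 32 * ‖G‖ := by
  have hexp : exp (-t) * exp (8 * ‖G‖ * t) ≤ exp (-(t / 2)) := by
    rw [← exp_add, exp_le_exp]
    nlinarith
  have hmul : exp (t / 2) * exp (-(t / 2)) = 1 := by rw [← exp_add, add_neg_cancel, exp_zero]
  have hsmall : exp (-(t / 2)) * t ≤ 2 := by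
    nlinarith [add_one_le_exp (t / 2), exp_pos (-(t / 2))]
  have hle_one : exp (-(t / 2)) ≤ 1 := exp_le_one_iff.2 (by linarith)
  calc |exp t * (tanh t - T t)|
      ≤ 2 * (exp (-t) * |exp (2 * t) * ((1 - T t) / (1 + T t)) - 1|) :=
        abs_exp_mul_tanh_sub_le (abs_lt.1 (h.abs_fst_lt_one ht)) t
    _ ≤ 2 * (exp (-t) * ((4 * |T 0| + 8 * ‖G‖ * t) * exp (8 * ‖G‖ * t))) := by
        gcongr; exact h.abs_exp_mul_ratio_sub_one_le ht
    _ = 2 * ((4 * |T 0| + 8 * ‖G‖ * t) * (exp (-t) * exp (8 * ‖G‖ * t))) := by ring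
    _ ≤ 2 * ((4 * |T 0| + 8 * ‖G‖ * t) * exp (-(t / 2))) := by gcongr
    _ = 8 * (|T 0| * exp (-(t / 2))) + 16 * (‖G‖ * (exp (-(t / 2)) * t)) := by ring
    _ ≤ 8 * (|T 0| * 1) + 16 * (‖G‖ * 2) := by gcongr
    _ = 8 * |T 0| + 32 * ‖G‖ := by ring

end IsReducedMotion

theorem BC.ext_of_eqOn_Ici {d e : BC} (hd : ∀ t, d (max t 0) = d t) (he : ∀ t, e (max t 0) = e t)
    (heq : EqOn d e (Ici 0)) : d = e := by
  ext t
  rw [← hd, ← he, heq (le_max_right t 0)]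

theorem eq_smul_expSechBC_add_forwardOp {d h : BC} (hd_max : ∀ t, d (max t 0) = d t)
    (hd : ∀ t, 0 < t → HasDerivAt d ((1 - 2 * tanh t) * d t + h t) t) :
    d = d 0 • expSechBC + forwardOp h := by
  refine BC.ext_of_eqOn_Ici hd_max (fun t => ?_) fun t ht => ?_
  · exact congrArg₂ (fun a b => d 0 * a + b) (ofHalfLine_max t) (forwardOp_max h t)
  set y : BC := d - (d 0 • expSechBC + forwardOp h) with hy
  have hy' : ∀ s, 0 < s → HasDerivAt y ((1 - 2 * tanh s) * y s) s := fun s hs => by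
    refine ((hd s hs).sub (((hasDerivAt_expSechBC hs).const_mul (d 0)).add
      (hasDerivAt_forwardOp h hs))).congr_deriv ?_
    simp only [hy, BoundedContinuousFunction.coe_sub, BoundedContinuousFunction.coe_add,
      BoundedContinuousFunction.coe_smul, Pi.sub_apply, Pi.add_apply, smul_eq_mul]
    ring
  have hderiv : ∀ s, 0 < s → HasDerivAt (fun s => y s / expSech s) 0 s := fun s hs => by
    refine ((hy' s hs).div (hasDerivAt_expSech s) (expSech_pos s).ne').congr_deriv ?_
    ring
  have hcont : Continuous fun s => y s / expSech s :=
    y.continuous.div continuous_expSech fun s => (expSech_pos s).ne'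
  have hconst := eqOn_const_of_hasDerivAt_zero hcont.continuousOn hderiv ht
  have hy0 : y 0 = 0 := by
    simp [hy, forwardOp_zero_time, expSechBC_apply, expSech]
  rw [hy0, zero_div, div_eq_zero_iff, or_iff_left (expSech_pos t).ne'] at hconst
  exact sub_eq_zero.1 hconst

theorem eq_neg_backwardOp {u h : BC} (hu_max : ∀ t, u (max t 0) = u t)
    (hu : ∀ t, 0 < t → HasDerivAt u (2 * tanh t * u t + h t) t) : u = -backwardOp h := by
  refine BC.ext_of_eqOn_Ici hu_max (fun t => congrArg Neg.neg (backwardOp_max h t)) fun t ht => ?_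
  set y : BC := u + backwardOp h
  have hderiv : ∀ s, 0 < s → HasDerivAt (fun s => y s / cosh s ^ 2) 0 s := fun s hs => by
    refine (((hu s hs).add (hasDerivAt_backwardOp h hs)).div (hasDerivAt_cosh_sq s)
      (cosh_sq_pos s).ne').congr_deriv ?_
    simp only [Pi.add_apply]
    ring
  have hlim : Tendsto (fun s => y s / cosh s ^ 2) atTop (𝓝 0) := by
    simp only [div_eq_inv_mul]
    refine tendsto_mul_of_tendsto_zero ?_ y
    simpa only [one_sub_tanh_sq, one_pow, sub_self] using (tendsto_tanh_atTop.pow 2).const_sub 1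
  have hcont : Continuous fun s => y s / cosh s ^ 2 :=
    y.continuous.div continuous_cosh_sq fun s => (cosh_sq_pos s).ne'
  have hzero := eqOn_zero_of_hasDerivAt_zero_of_tendsto hcont.continuousOn hderiv hlim ht
  exact eq_neg_of_add_eq_zero_left ((div_eq_zero_iff.1 hzero).resolve_right (cosh_sq_pos t).ne')

theorem defect_eq_zero_of_hasDerivAt {G d u : BC} (hd_max : ∀ t, d (max t 0) = d t)
    (hu_max : ∀ t, u (max t 0) = u t)
    (hT : ∀ t, 0 < t →
      HasDerivAt (negCosHalf d) ((1 - negCosHalf d t ^ 2) * (1 + u t)) t)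
    (hu : ∀ t, 0 < t → HasDerivAt u (negCosHalf d t * ((1 + u t) ^ 2 - 1 + G t)) t) :
    defect ((-negCosHalf d 0, G), (d, u)) = 0 := by
  have hd0 : -negCosHalf d 0 = d 0 := by
    rw [negCosHalf_apply, tanhBC_apply le_rfl, expNegBC_apply le_rfl, tanh_zero, neg_zero, exp_zero]
    ring
  rw [hd0, defect_eq_zero_iff]
  refine ⟨eq_smul_expSechBC_add_forwardOp hd_max fun t ht => ?_,
    eq_neg_backwardOp hu_max fun t ht => (hu t ht).congr_deriv ?_⟩
  · have hexp : exp t * expNegBC t = 1 := by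
      rw [expNegBC_apply ht.le, ← exp_add, add_neg_cancel, exp_zero]
    have hd_eq : d =ᶠ[𝓝 t] fun s => exp s * (tanh s - negCosHalf d s) := by
      filter_upwards [lt_mem_nhds ht] with s hs
      rw [negCosHalf_apply, tanhBC_apply hs.le, sub_sub_cancel, expNegBC_apply hs.le, ← mul_assoc,
        ← exp_add, add_neg_cancel, exp_zero, one_mul]
    refine (((hasDerivAt_exp t).mul ((hasDerivAt_tanh t).sub (hT t ht))).congr_of_eventuallyEq
      hd_eq).congr_deriv ?_
    have hsech : 1 - tanh t ^ 2 = expNegBC t * expSechBC t := by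
      rw [expNegBC_apply ht.le, expSechBC_apply ht.le, exp_neg_mul_expSech]
    rw [Pi.sub_apply, one_sub_negCosHalf_sq d ht.le, hsech, forwardSource_apply, negCosHalf_apply,
      scaledSinSq_apply, tanhBC_apply ht.le]
    linear_combination
      (d t + expSechBC t - (expSechBC t + 2 * tanh t * d t - expNegBC t * d t ^ 2) * (1 + u t)) *
        hexp
  · rw [backwardSource_apply, negCosHalf_apply, tanhBC_apply ht.le]
    ring

theorem IsReducedMotion.exists_defect_eq_zero {G : BC} {T w : ℝ → ℝ} (h : IsReducedMotion G T w)
    (hG : 16 * ‖G‖ ≤ 1) :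
    ∃ d u : BC, defect ((-T 0, G), (d, u)) = 0 ∧ EqOn (negCosHalf d) T (Ici 0) ∧
      EqOn (fun t => 1 + u t) w (Ici 0) ∧ ‖d‖ ≤ 8 * |T 0| + 32 * ‖G‖ ∧ ‖u‖ ≤ 4 * ‖G‖ := by
  have hmax : Continuous fun t : ℝ => max t 0 := continuous_id.max continuous_const
  have hT_cont : Continuous fun t => T (max t 0) := continuous_iff_continuousAt.2 fun t =>
    (h.hasDerivAt_fst _ (le_max_right t 0)).continuousAt.comp (f := (max · 0)) hmax.continuousAt
  have hw_cont : Continuous fun t => w (max t 0) := continuous_iff_continuousAt.2 fun t =>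
    (h.hasDerivAt_snd _ (le_max_right t 0)).continuousAt.comp (f := (max · 0)) hmax.continuousAt
  set d : BC := ofHalfLine (fun t => exp t * (tanh t - T (max t 0)))
    (continuous_exp.mul (continuous_tanh.sub hT_cont)) (8 * |T 0| + 32 * ‖G‖)
    fun t ht => by rw [max_eq_left ht]; exact h.abs_exp_mul_tanh_sub_fst_le hG ht
  set u : BC := ofHalfLine (fun t => w (max t 0) - 1) (hw_cont.sub continuous_const) (4 * ‖G‖)
    fun t ht => by rw [max_eq_left ht]; exact h.abs_sub_one_le ht
  have hd_apply : EqOn (negCosHalf d) T (Ici 0) := fun t ht => by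
    rw [negCosHalf_apply, tanhBC_apply ht, expNegBC_apply ht, ofHalfLine_of_nonneg ht,
      max_eq_left (mem_Ici.1 ht), ← mul_assoc, ← exp_add, neg_add_cancel, exp_zero, one_mul,
      sub_sub_cancel]
  have hu_apply : EqOn (fun t => 1 + u t) w (Ici 0) := fun t ht => by
    change 1 + u t = w t
    rw [ofHalfLine_of_nonneg ht, max_eq_left (mem_Ici.1 ht), add_sub_cancel]
  refine ⟨d, u, ?_, hd_apply, hu_apply, norm_ofHalfLine_le, norm_ofHalfLine_le⟩
  rw [← hd_apply self_mem_Ici]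
  refine defect_eq_zero_of_hasDerivAt ofHalfLine_max ofHalfLine_max (fun t ht => ?_) fun t ht => ?_
  · have hw : 1 + u t = w t := hu_apply ht.le
    rw [hd_apply ht.le, hw]
    exact (h.hasDerivAt_fst t ht.le).congr_of_eventuallyEq
      (hd_apply.eventuallyEq_of_mem (Ici_mem_nhds ht))
  · have hu_eq : u =ᶠ[𝓝 t] fun s => w s - 1 := by
      filter_upwards [lt_mem_nhds ht] with s hs
      rw [ofHalfLine_of_nonneg hs.le, max_eq_left hs.le]
    have hw : 1 + u t = w t := hu_apply ht.le
    rw [hd_apply ht.le, hw]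
    exact ((h.hasDerivAt_snd t ht.le).sub_const 1).congr_of_eventuallyEq hu_eq

/-! ### Solutions of the integral equations from motions -/

theorem torus_nonempty (B : Fin 2 → ℝ) : (torus B).Nonempty := ⟨_, 0, 0, rfl⟩

theorem abs_momentum_le_infDist (z : Phase) (B : Fin 2 → ℝ) :
    |z.2.2.1| ≤ Metric.infDist z (torus B) := by
  refine (Metric.le_infDist (torus_nonempty B)).2 ?_
  rintro _ ⟨n, φ, rfl⟩
  rw [← sub_zero z.2.2.1]
  exact le_max_of_le_right (le_max_of_le_right (le_max_left _ _))

theorem abs_action_sub_le_infDist (z : Phase) (B : Fin 2 → ℝ) (i : Fin 2) :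
    |z.2.2.2 i - B i| ≤ Metric.infDist z (torus B) := by
  refine (Metric.le_infDist (torus_nonempty B)).2 ?_
  rintro _ ⟨n, φ, rfl⟩
  exact le_max_of_le_right (le_max_of_le_right (le_max_of_le_right (dist_le_pi_dist _ B i)))

theorem abs_sin_half_le_infDist (z : Phase) (B : Fin 2 → ℝ) :
    |sin (z.1 / 2)| ≤ Metric.infDist z (torus B) := by
  refine (Metric.le_infDist (torus_nonempty B)).2 ?_
  rintro _ ⟨n, φ, rfl⟩
  refine le_max_of_le_left ?_
  calc |sin (z.1 / 2)| = |sin (z.1 / 2 - n * π)| := by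
        rw [sin_sub_int_mul_pi, abs_mul, abs_zpow, abs_neg, abs_one, one_zpow, one_mul]
    _ ≤ |z.1 / 2 - n * π| := abs_sin_le_abs
    _ = |z.1 - 2 * π * n| / 2 := by
        rw [show z.1 / 2 - n * π = (z.1 - 2 * π * n) / 2 by ring, abs_div, abs_two]
    _ ≤ |z.1 - 2 * π * n| := half_le_self (abs_nonneg _)

section Prod

variable {E F : Type*} [NormedAddCommGroup E] [NormedSpace ℝ E] [NormedAddCommGroup F]
  [NormedSpace ℝ F] {γ : ℝ → E × F} {v : E × F} {t : ℝ}

theorem hasDerivAt_fst (hγ : HasDerivAt γ v t) : HasDerivAt (fun t => (γ t).1) v.1 t :=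
  (ContinuousLinearMap.fst ℝ E F).hasFDerivAt.comp_hasDerivAt t hγ

theorem hasDerivAt_snd (hγ : HasDerivAt γ v t) : HasDerivAt (fun t => (γ t).2) v.2 t :=
  (ContinuousLinearMap.snd ℝ E F).hasFDerivAt.comp_hasDerivAt t hγ

end Prod

section Components

variable {f : (Fin 2 → ℝ) → ℝ} {ω : Fin 2 → ℝ} {μ : ℝ} {γ : ℝ → Phase}
  (hγ : IsIntegralCurve γ fun _ => flowField f ω μ) (t : ℝ)
include hγ

theorem hasDerivAt_motion_angle : HasDerivAt (fun t => (γ t).1) (γ t).2.2.1 t :=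
  hasDerivAt_fst (hγ t)

theorem motion_phase : (γ t).2.1 = (γ 0).2.1 + t • ω := by
  have hderiv : ∀ t, HasDerivAt (fun t => (γ t).2.1 - t • ω) 0 t := fun t => by
    have hphase : HasDerivAt (fun t => (γ t).2.1) ω t := hasDerivAt_fst (hasDerivAt_snd (hγ t))
    simpa using hphase.fun_sub ((hasDerivAt_id' t).smul_const ω)
  have hconst := is_const_of_deriv_eq_zero (fun t => (hderiv t).differentiableAt)
    (fun t => (hderiv t).deriv) t 0
  rw [zero_smul, sub_zero] at hconst
  exact sub_eq_iff_eq_add.1 hconst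

theorem hasDerivAt_motion_momentum :
    HasDerivAt (fun t => (γ t).2.2.1)
      (sin (γ t).1 * (1 - μ * f ((γ 0).2.1 + t • ω))) t := by
  rw [← motion_phase hγ]
  exact hasDerivAt_fst (hasDerivAt_snd (hasDerivAt_snd (hγ t)))

theorem hasDerivAt_motion_action (i : Fin 2) :
    HasDerivAt (fun t => (γ t).2.2.2 i)
      (-(μ * ((1 - cos (γ t).1) * partialDeriv i f ((γ 0).2.1 + t • ω)))) t := by
  rw [← motion_phase hγ]
  exact hasDerivAt_pi.1 (hasDerivAt_snd (hasDerivAt_snd (hasDerivAt_snd (hγ t)))) i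

theorem hasDerivAt_motion_neg_cos_half (hsin : sin ((γ t).1 / 2) ≠ 0) :
    HasDerivAt (fun t => -cos ((γ t).1 / 2))
      ((1 - (-cos ((γ t).1 / 2)) ^ 2) * ((γ t).2.2.1 / (2 * sin ((γ t).1 / 2)))) t := by
  refine ((hasDerivAt_motion_angle hγ t).div_const 2).cos.neg.congr_deriv ?_
  rw [neg_sq, ← sin_sq]
  field

theorem hasDerivAt_motion_momentum_div (hsin : sin ((γ t).1 / 2) ≠ 0) :
    HasDerivAt (fun t => (γ t).2.2.1 / (2 * sin ((γ t).1 / 2)))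
      (-cos ((γ t).1 / 2) * (((γ t).2.2.1 / (2 * sin ((γ t).1 / 2))) ^ 2 - 1 +
        μ * f ((γ 0).2.1 + t • ω))) t := by
  refine ((hasDerivAt_motion_momentum hγ t).div
    (((hasDerivAt_motion_angle hγ t).div_const 2).sin.const_mul 2)
    (mul_ne_zero two_ne_zero hsin)).congr_deriv ?_
  have hdouble : sin (γ t).1 = 2 * sin ((γ t).1 / 2) * cos ((γ t).1 / 2) := by
    rw [← sin_two_mul, mul_div_cancel₀ _ two_ne_zero]
  rw [hdouble]
  field

end Components

section StableMotion

variable {f : (Fin 2 → ℝ) → ℝ} (hf : IsTorusFunction 2 f) {ω : Fin 2 → ℝ} {μ : ℝ}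
  {B : Fin 2 → ℝ} {γ : ℝ → Phase} (hγ : IsIntegralCurve γ fun _ => flowField f ω μ)
  (hlim : Tendsto (fun t => Metric.infDist (γ t) (torus B)) atTop (𝓝 0))
include hγ hlim

theorem isReducedMotion_of_motion
    (hpos : ∀ t, 0 ≤ t → 0 < (γ t).1 ∧ (γ t).1 < 2 * π ∧ 0 < (γ t).2.2.1)
    (hq : |cos ((γ 0).1 / 2)| ≤ 1 / 2) :
    IsReducedMotion (μ • hf.orbit ω (γ 0).2.1) (fun t => -cos ((γ t).1 / 2))
      (fun t => (γ t).2.2.1 / (2 * sin ((γ t).1 / 2))) := by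
  have hsin : ∀ t, 0 ≤ t → 0 < sin ((γ t).1 / 2) := fun t ht =>
    sin_pos_of_pos_of_lt_pi (by linarith [(hpos t ht).1]) (by linarith [(hpos t ht).2.1])
  have hT_sq : ∀ t, 1 - (-cos ((γ t).1 / 2)) ^ 2 = sin ((γ t).1 / 2) ^ 2 := fun t => by
    rw [neg_sq, ← sin_sq]
  have hsin_lim : Tendsto (fun t => sin ((γ t).1 / 2)) atTop (𝓝 0) :=
    squeeze_zero_norm (fun t => abs_sin_half_le_infDist (γ t) B) hlim
  have hp_lim : Tendsto (fun t => (γ t).2.2.1) atTop (𝓝 0) :=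
    squeeze_zero_norm (fun t => abs_momentum_le_infDist (γ t) B) hlim
  refine ⟨fun t ht => hasDerivAt_motion_neg_cos_half hγ t (hsin t ht).ne',
    fun t ht => hasDerivAt_motion_momentum_div hγ t (hsin t ht).ne',
    fun t ht => div_pos (hpos t ht).2.2 (mul_pos two_pos (hsin t ht)), fun t ht => ?_, ?_, ?_, ?_⟩
  · rw [hT_sq]
    exact pow_pos (hsin t ht) 2
  · simpa only [hT_sq, zero_pow two_ne_zero] using hsin_lim.pow 2
  · have hp_sq : Tendsto (fun t => ((γ t).2.2.1 / 2) ^ 2) atTop (𝓝 0) := by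
      simpa only [zero_div, zero_pow two_ne_zero] using (hp_lim.div_const 2).pow 2
    refine hp_sq.congr' ?_
    filter_upwards [eventually_ge_atTop 0] with t ht
    have := (hsin t ht).ne'
    rw [hT_sq]
    field
  · exact neg_le_neg (le_of_abs_le hq)

theorem motion_action_zero {d : BC}
    (hd : EqOn (negCosHalf d) (fun t => -cos ((γ t).1 / 2)) (Ici 0)) :
    (γ 0).2.2.2 = B + μ • fun i => actionTail hf ω (γ 0).2.1 d i 0 := by
  funext i
  set g : ℝ → ℝ := fun t =>
    (γ t).2.2.2 i - B i - μ * (expNegBC t * actionTail hf ω (γ 0).2.1 d i t)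
  have hcont : ContinuousOn g (Ici 0) := by
    have : Continuous fun t => (γ t).2.2.2 i :=
      continuous_iff_continuousAt.2 fun t => (hasDerivAt_motion_action hγ t i).continuousAt
    exact ((this.sub continuous_const).sub
      (continuous_const.mul (expNegBC.continuous.mul (map_continuous _)))).continuousOn
  have hderiv : ∀ t, 0 < t → HasDerivAt g 0 t := fun t ht => by
    refine (((hasDerivAt_motion_action hγ t i).sub_const (B i)).sub
      ((hasDerivAt_expNegBC_mul_actionTail hf ω (γ 0).2.1 d i ht).const_mul μ)).congr_deriv ?_
    have hdouble : cos (γ t).1 = 2 * cos ((γ t).1 / 2) ^ 2 - 1 := by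
      rw [← cos_two_mul, mul_div_cancel₀ _ two_ne_zero]
    rw [hd ht.le, hdouble]
    ring
  have hg_lim : Tendsto g atTop (𝓝 0) := by
    simpa only [mul_zero, sub_zero] using (squeeze_zero_norm
      (fun t => abs_action_sub_le_infDist (γ t) B i) hlim).sub
        ((tendsto_expNegBC_mul _).const_mul μ)
  have hzero := eqOn_zero_of_hasDerivAt_zero_of_tendsto hcont hderiv hg_lim self_mem_Ici
  change (γ 0).2.2.2 i - B i - μ * (expNegBC 0 * _) = 0 at hzero
  rw [expNegBC_apply le_rfl, neg_zero, exp_zero, one_mul] at hzero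
  change _ = B i + μ * _
  linarith

end StableMotion

theorem exists_defect_of_mem_stableWhisker {f : (Fin 2 → ℝ) → ℝ} (hf : IsTorusFunction 2 f)
    {ω : Fin 2 → ℝ} {μ : ℝ} {B : Fin 2 → ℝ} {z : Phase}
    (hz : z ∈ stableWhisker (hamiltonian f ω μ) B) (hq : |cos (z.1 / 2)| ≤ 1 / 2)
    (hG : 16 * ‖μ • hf.orbit ω z.2.1‖ ≤ 1) :
    ∃ d u : BC, defect ((cos (z.1 / 2), μ • hf.orbit ω z.2.1), (d, u)) = 0 ∧
      ‖d‖ ≤ 8 * |cos (z.1 / 2)| + 32 * ‖μ • hf.orbit ω z.2.1‖ ∧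
      ‖u‖ ≤ 4 * ‖μ • hf.orbit ω z.2.1‖ ∧
      z.2.2.1 = 2 * sin (z.1 / 2) * (1 + u 0) ∧
      z.2.2.2 = B + μ • fun i => actionTail hf ω z.2.1 d i 0 := by
  obtain ⟨γ, hγ, rfl, hlim, hpos⟩ := hz
  rw [hamiltonianField_hamiltonian (hf.contDiff.differentiable two_ne_zero)] at hγ
  obtain ⟨d, u, hdefect, hd, hu, hd_norm, hu_norm⟩ :=
    (isReducedMotion_of_motion hf hγ hlim hpos hq).exists_defect_eq_zero hG
  rw [neg_neg] at hdefect
  rw [abs_neg] at hd_norm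
  refine ⟨d, u, hdefect, hd_norm, hu_norm, ?_, motion_action_zero hf hγ hlim hd⟩
  have hsin : 0 < sin ((γ 0).1 / 2) := sin_pos_of_pos_of_lt_pi
    (half_pos (hpos 0 le_rfl).1) (by linarith [(hpos 0 le_rfl).2.1])
  have hu_zero : 1 + u 0 = (γ 0).2.2.1 / (2 * sin ((γ 0).1 / 2)) := hu self_mem_Ici
  rw [hu_zero, mul_div_cancel₀ _ (by positivity)]

/-! ### The whiskers are Lagrangian -/

/-- `(d', u')` solves the integral equations linearized at `(d, u)`, for the variation `G'` of the
forcing `G` and a fixed initial angle. -/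
structure IsVariation (G d u G' d' u' : BC) : Prop where
  eq_forwardOp : d' = forwardOp (forwardSourceDeriv d u d' u')
  eq_neg_backwardOp : u' = -backwardOp (backwardSourceDeriv G d u G' d' u')

namespace IsVariation

variable {G d u G' d' u' : BC}

theorem fst_zero (h : IsVariation G d u G' d' u') : d' 0 = 0 := by
  rw [h.eq_forwardOp, forwardOp_zero_time]

theorem hasDerivAt_fst (h : IsVariation G d u G' d' u') {t : ℝ} (ht : 0 < t) :
    HasDerivAt d' ((1 - 2 * tanh t) * d' t + forwardSourceDeriv d u d' u' t) t := by
  simpa only [← h.eq_forwardOp] using hasDerivAt_forwardOp (forwardSourceDeriv d u d' u') ht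

theorem hasDerivAt_snd (h : IsVariation G d u G' d' u') {t : ℝ} (ht : 0 < t) :
    HasDerivAt u' (2 * tanh t * u' t + backwardSourceDeriv G d u G' d' u' t) t := by
  have hderiv : HasDerivAt (-backwardOp (backwardSourceDeriv G d u G' d' u') : BC) _ t :=
    (hasDerivAt_backwardOp _ ht).neg
  have hu' : backwardOp (backwardSourceDeriv G d u G' d' u') = -u' :=
    neg_eq_iff_eq_neg.1 h.eq_neg_backwardOp.symm
  rw [hu', neg_neg, BoundedContinuousFunction.coe_neg, Pi.neg_apply] at hderiv
  exact hderiv.congr_deriv (by ring)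

variable {g₁ d₁ u₁ g₂ d₂ u₂ : BC}

theorem hasDerivAt_symplectic_product (h₁ : IsVariation G d u g₁ d₁ u₁)
    (h₂ : IsVariation G d u g₂ d₂ u₂) {t : ℝ} (ht : 0 < t) :
    HasDerivAt (fun t => expNegBC t * (d₁ t * u₂ t - d₂ t * u₁ t))
      (expNegBC t * (negCosHalf d * (d₁ * g₂ - d₂ * g₁)) t) t := by
  refine ((hasDerivAt_expNegBC ht).mul (((h₁.hasDerivAt_fst ht).fun_mul
    (h₂.hasDerivAt_snd ht)).fun_sub ((h₂.hasDerivAt_fst ht).fun_mul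
    (h₁.hasDerivAt_snd ht)))).congr_deriv ?_
  simp only [forwardSourceDeriv, backwardSourceDeriv, BoundedContinuousFunction.coe_mul,
    BoundedContinuousFunction.coe_sub, BoundedContinuousFunction.coe_add,
    BoundedContinuousFunction.coe_smul, Pi.mul_apply, Pi.sub_apply, Pi.add_apply, smul_eq_mul]
  ring

theorem tailOp_negCosHalf_mul_symm (h₁ : IsVariation G d u g₁ d₁ u₁)
    (h₂ : IsVariation G d u g₂ d₂ u₂) :
    tailOp (negCosHalf d * d₁ * g₂) 0 = tailOp (negCosHalf d * d₂ * g₁) 0 := by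
  set h := negCosHalf d * (d₁ * g₂ - d₂ * g₁) with h_def
  have hconst : EqOn (fun t => expNegBC t * (tailOp h + (d₁ * u₂ - d₂ * u₁)) t) 0 (Ici 0) := by
    refine eqOn_zero_of_hasDerivAt_zero_of_tendsto ?_ (fun t ht => ?_) (tendsto_expNegBC_mul _)
    · exact (expNegBC * (tailOp h + (d₁ * u₂ - d₂ * u₁))).continuous.continuousOn
    · refine ((((hasDerivAt_expNegBC ht).fun_mul (hasDerivAt_tailOp h ht)).fun_add
        (h₁.hasDerivAt_symplectic_product h₂ ht)).congr_deriv ?_).congr_of_eventuallyEq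
        (.of_forall fun s => mul_add _ _ _)
      ring
  have hzero := hconst self_mem_Ici
  simp only [expNegBC_apply le_rfl, neg_zero, exp_zero, one_mul, BoundedContinuousFunction.coe_add,
    BoundedContinuousFunction.coe_sub, BoundedContinuousFunction.coe_mul, Pi.add_apply,
    Pi.sub_apply, Pi.mul_apply, h₁.fst_zero, h₂.fst_zero, zero_mul, sub_zero, add_zero,
    Pi.zero_apply] at hzero
  rwa [h_def, mul_sub, ← mul_assoc, ← mul_assoc, map_sub, BoundedContinuousFunction.coe_sub,
    Pi.sub_apply, sub_eq_zero] at hzero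

end IsVariation

theorem hasDerivAt_actionTail {f : (Fin 2 → ℝ) → ℝ} (hf : IsTorusFunction 2 f) (ω φ : Fin 2 → ℝ)
    {d : ℝ → BC} {d' : BC} (i j : Fin 2) (hd : HasDerivAt d d' 0) :
    HasDerivAt (fun s : ℝ => actionTail hf ω (φ + s • Pi.single j 1) (d s) i 0)
      (4 * tailOp (negCosHalf (d 0) * d' * (hf.partialDeriv i).orbit ω φ) 0 +
        2 * tailOp (scaledSinSq (d 0) * ((hf.partialDeriv i).partialDeriv j).orbit ω φ) 0) 0 := by
  have horbit := hasDerivAt_add_smul_single (i := j) (s := 0) (φ := φ)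
    (((hf.partialDeriv i).contDiff_orbit ω).differentiable one_ne_zero _)
  rw [IsTorusFunction.partialDeriv_orbit] at horbit
  have hprod := ((hasDerivAt_scaledSinSq hd).mul horbit).const_smul (2 : ℝ)
  refine (((BoundedContinuousFunction.evalCLM ℝ (0 : ℝ) : BC →L[ℝ] ℝ) ∘L
    tailOp).hasFDerivAt.comp_hasDerivAt (0 : ℝ) hprod).congr_deriv ?_
  simp only [ContinuousLinearMap.comp_apply, BoundedContinuousFunction.evalCLM_apply, zero_smul,
    add_zero, smul_add, map_add, map_smul, smul_mul_assoc, smul_eq_mul]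
  ring

/-! ### The stable whisker as a graph -/

/-- The parameters `(μ, q, φ)`. -/
abbrev Param : Type := ℝ × ℝ × (Fin 2 → ℝ)

/-- The parameters with `μ` near `0` and `q` near `π`. -/
def paramDomain (a : ℝ) : Set Param := {x | |x.1| < a ∧ |x.2.1 - π| < a}

theorem isOpen_paramDomain (a : ℝ) : IsOpen (paramDomain a) :=
  .inter (isOpen_lt (f := fun x : Param => |x.1|) (by fun_prop) continuous_const)
    (isOpen_lt (f := fun x : Param => |x.2.1 - π|) (by fun_prop) continuous_const)

theorem abs_cos_half_le (q : ℝ) : |cos (q / 2)| ≤ |q - π| := by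
  rw [← sin_pi_div_two_sub, ← sub_div, abs_sub_comm]
  refine abs_sin_le_abs.trans ?_
  rw [abs_div, abs_two]
  exact half_le_self (abs_nonneg _)

section Family

variable {f : (Fin 2 → ℝ) → ℝ} (hf : IsTorusFunction 2 f) (ω : Fin 2 → ℝ)

/-- The initial value and the forcing that belong to `(μ, q, φ)`. -/
def inputData (x : Param) : ℝ × BC :=
  (cos (x.2.1 / 2), x.1 • hf.orbit ω x.2.2)

theorem contDiff_inputData : ContDiff ℝ 1 (inputData hf ω) := by
  have := hf.contDiff_orbit ω
  unfold inputData
  fun_prop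

/-- `Φ x` is the solution of the integral equations with input data `inputData hf ω x`, unique
among the candidates that obey the a priori bounds of the motions in the stable whisker. -/
structure IsSolutionFamily (a : ℝ) (Φ : Param → BC × BC) : Prop where
  pos : 0 < a
  contDiffOn : ContDiffOn ℝ 1 Φ (paramDomain a)
  abs_cos_le (x) : x ∈ paramDomain a → |cos (x.2.1 / 2)| ≤ 1 / 2
  mem_Ioo (x) : x ∈ paramDomain a → x.2.1 ∈ Ioo 0 (2 * π)
  norm_forcing_le (x) : x ∈ paramDomain a → 16 * ‖x.1 • hf.orbit ω x.2.2‖ ≤ 1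
  norm_snd_lt (x) : x ∈ paramDomain a → ‖(Φ x).2‖ < 1
  defect_eq_zero (x) : x ∈ paramDomain a → defect (inputData hf ω x, Φ x) = 0
  eq_of_defect_eq_zero (x) : x ∈ paramDomain a → ∀ d u, defect (inputData hf ω x, (d, u)) = 0 →
    ‖d‖ ≤ 8 * |cos (x.2.1 / 2)| + 32 * ‖x.1 • hf.orbit ω x.2.2‖ →
    ‖u‖ ≤ 4 * ‖x.1 • hf.orbit ω x.2.2‖ → (d, u) = Φ x
  periodic (μ q : ℝ) (n : Fin 2 → ℤ) : Function.Periodic (fun φ => Φ (μ, q, φ)) (angleShift n)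

theorem exists_norm_inputData_lt {ε : ℝ} (hε : 0 < ε) : ∃ a, 0 < a ∧ a ≤ ε ∧ ∀ x ∈ paramDomain a,
    |cos (x.2.1 / 2)| < ε ∧ ‖x.1 • hf.orbit ω x.2.2‖ < ε := by
  obtain ⟨C, hC, hbound⟩ := hf.exists_norm_orbit_le ω
  have haε : ε / (C + 1) ≤ ε := div_le_self hε.le (by linarith)
  refine ⟨ε / (C + 1), by positivity, haε, fun x hx =>
    ⟨(abs_cos_half_le _).trans_lt (hx.2.trans_le haε), ?_⟩⟩
  calc ‖x.1 • hf.orbit ω x.2.2‖ = |x.1| * ‖hf.orbit ω x.2.2‖ := norm_smul _ _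
    _ ≤ |x.1| * (C + 1) := by gcongr; linarith [hbound x.2.2]
    _ < ε := (lt_div_iff₀ (by linarith)).1 hx.1

theorem exists_isSolutionFamily : ∃ a Φ, IsSolutionFamily hf ω a Φ := by
  obtain ⟨Ψ, ε, hε, hΨ, hsol, huniq⟩ := exists_solutionMap
  obtain ⟨a, ha, ha_le, hdata⟩ :=
    exists_norm_inputData_lt hf ω (ε := min (ε / 41) (1 / 16)) (by positivity)
  have hsmall : ∀ x ∈ paramDomain a, |cos (x.2.1 / 2)| < ε / 41 ∧ |cos (x.2.1 / 2)| < 1 / 16 ∧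
      ‖x.1 • hf.orbit ω x.2.2‖ < ε / 41 ∧ ‖x.1 • hf.orbit ω x.2.2‖ < 1 / 16 := fun x hx => by
    simpa only [lt_min_iff, and_assoc] using hdata x hx
  have hball : ∀ x ∈ paramDomain a, inputData hf ω x ∈ Metric.ball 0 ε := fun x hx => by
    obtain ⟨hcos, -, hG, -⟩ := hsmall x hx
    exact mem_ball_zero_iff.2 (max_lt (hcos.trans (by linarith)) (hG.trans (by linarith)))
  refine ⟨a, fun x => Ψ (inputData hf ω x), ha, hΨ.comp (contDiff_inputData hf ω).contDiffOn hball,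
    fun x hx => by linarith [hsmall x hx], fun x hx => ?_, fun x hx => by linarith [hsmall x hx],
    fun x hx => (norm_snd_le _).trans_lt (hsol _ (hball x hx)).1,
    fun x hx => (hsol _ (hball x hx)).2,
    fun x hx d u hdefect hd hu => huniq _ (hball x hx) _ ?_ hdefect, fun μ q n φ => ?_⟩
  · have := abs_lt.1 (hx.2.trans_le (ha_le.trans (min_le_right _ _)))
    constructor <;> linarith [pi_gt_three]
  · obtain ⟨hcos, -, hG, -⟩ := hsmall x hx
    exact mem_ball_zero_iff.2
      (max_lt (show ‖d‖ < ε by linarith) (show ‖u‖ < ε by linarith))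
  · simp only [inputData, hf.orbit_add_angleShift]

variable {hf ω} {a : ℝ} {Φ : Param → BC × BC} {x : Param}

namespace IsSolutionFamily

theorem differentiableAt (h : IsSolutionFamily hf ω a Φ) (hx : x ∈ paramDomain a) :
    DifferentiableAt ℝ (fun φ => Φ (x.1, x.2.1, φ)) x.2.2 :=
  DifferentiableAt.comp (g := Φ) x.2.2 ((h.contDiffOn.contDiffAt
    ((isOpen_paramDomain a).mem_nhds hx)).differentiableAt one_ne_zero) (by fun_prop)

theorem hasDerivAt_line (h : IsSolutionFamily hf ω a Φ) (hx : x ∈ paramDomain a) (j : Fin 2) :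
    HasDerivAt (fun s : ℝ => Φ (x.1, x.2.1, x.2.2 + s • Pi.single j 1))
      (partialDeriv j (fun φ => Φ (x.1, x.2.1, φ)) x.2.2) 0 := by
  have hline : x.2.2 + (0 : ℝ) • Pi.single j 1 = x.2.2 := by rw [zero_smul, add_zero]
  have hderiv := hasDerivAt_add_smul_single (g := fun φ => Φ (x.1, x.2.1, φ))
    (hline.symm ▸ h.differentiableAt hx)
  rwa [hline] at hderiv

theorem isVariation (h : IsSolutionFamily hf ω a Φ) (hx : x ∈ paramDomain a) (j : Fin 2) :
    IsVariation (x.1 • hf.orbit ω x.2.2) (Φ x).1 (Φ x).2 (x.1 • (hf.partialDeriv j).orbit ω x.2.2)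
      (partialDeriv j (fun φ => Φ (x.1, x.2.1, φ)) x.2.2).1
      (partialDeriv j (fun φ => Φ (x.1, x.2.1, φ)) x.2.2).2 := by
  have horbit := hasDerivAt_add_smul_single (i := j) (s := 0) (φ := x.2.2)
    ((hf.contDiff_orbit ω).differentiable one_ne_zero _)
  have hderiv := hasDerivAt_defect (hasDerivAt_const (0 : ℝ) (cos (x.2.1 / 2)))
    (horbit.const_smul x.1) (h.hasDerivAt_line hx j).fst (h.hasDerivAt_line hx j).snd
  have hzero := (hderiv.congr_of_eventuallyEq (.of_forall fun s =>
    (h.defect_eq_zero (x.1, x.2.1, x.2.2 + s • Pi.single j 1) hx).symm)).unique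
      (hasDerivAt_const (0 : ℝ) 0)
  simp only [IsTorusFunction.partialDeriv_orbit, Pi.smul_apply, zero_smul, add_zero, sub_zero,
    Prod.mk_eq_zero] at hzero
  exact ⟨sub_eq_zero.1 hzero.1, eq_neg_of_add_eq_zero_left hzero.2⟩

theorem differentiableAt_actionTail (h : IsSolutionFamily hf ω a Φ) (hx : x ∈ paramDomain a)
    (i : Fin 2) :
    DifferentiableAt ℝ (fun φ => actionTail hf ω φ (Φ (x.1, x.2.1, φ)).1 i 0) x.2.2 := by
  have := (h.differentiableAt hx).fst
  have := ((hf.partialDeriv i).contDiff_orbit ω).differentiable one_ne_zero x.2.2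
  unfold actionTail scaledSinSq
  exact ((BoundedContinuousFunction.evalCLM ℝ (0 : ℝ) : BC →L[ℝ] ℝ) ∘L
    tailOp).differentiableAt.comp x.2.2 (by fun_prop)

theorem partialDeriv_actionTail (h : IsSolutionFamily hf ω a Φ) (hx : x ∈ paramDomain a)
    (i j : Fin 2) :
    partialDeriv j (fun φ => actionTail hf ω φ (Φ (x.1, x.2.1, φ)).1 i 0) x.2.2 =
      4 * tailOp (negCosHalf (Φ x).1 * (partialDeriv j (fun φ => Φ (x.1, x.2.1, φ)) x.2.2).1 *
        (hf.partialDeriv i).orbit ω x.2.2) 0 +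
      2 * tailOp (scaledSinSq (Φ x).1 * ((hf.partialDeriv i).partialDeriv j).orbit ω x.2.2) 0 := by
  have hderiv := hasDerivAt_actionTail hf ω x.2.2 i j (h.hasDerivAt_line hx j).fst
  simp only [zero_smul, add_zero] at hderiv
  rw [partialDeriv, ← (h.differentiableAt_actionTail hx i).lineDeriv_eq_fderiv]
  exact hderiv.deriv

theorem partialDeriv_actionTail_symm (h : IsSolutionFamily hf ω a Φ) (hx : x ∈ paramDomain a)
    (hx0 : x.1 ≠ 0) (i j : Fin 2) :
    partialDeriv j (fun φ => actionTail hf ω φ (Φ (x.1, x.2.1, φ)).1 i 0) x.2.2 =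
      partialDeriv i (fun φ => actionTail hf ω φ (Φ (x.1, x.2.1, φ)).1 j 0) x.2.2 := by
  have hlagr := (h.isVariation hx j).tailOp_negCosHalf_mul_symm (h.isVariation hx i)
  simp only [mul_smul_comm, map_smul, BoundedContinuousFunction.coe_smul] at hlagr
  have hhess : ((hf.partialDeriv i).partialDeriv j).orbit ω x.2.2 =
      ((hf.partialDeriv j).partialDeriv i).orbit ω x.2.2 := by
    ext t
    exact congr($(partialDeriv_comm hf.contDiff j i) _)
  rw [h.partialDeriv_actionTail hx, h.partialDeriv_actionTail hx, smul_right_injective ℝ hx0 hlagr,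
    hhess]

end IsSolutionFamily

end Family

/-- `P` and `A` describe the stable whiskers as graphs over the angles with `q` near `π`. -/
structure IsStableGraph (f : (Fin 2 → ℝ) → ℝ) (ω : Fin 2 → ℝ) (a : ℝ) (P : Param → ℝ)
    (A : Param → Fin 2 → ℝ) : Prop where
  pos : 0 < a
  contDiffOn_momentum : ContDiffOn ℝ 1 P (paramDomain a)
  contDiffOn_action : ContDiffOn ℝ 1 A (paramDomain a)
  momentum_pos (x) : x ∈ paramDomain a → 0 < P x
  momentum_le (x) : x ∈ paramDomain a → P x ≤ 4
  action_periodic (μ q : ℝ) (n : Fin 2 → ℤ) :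
    Function.Periodic (fun φ => A (μ, q, φ)) (angleShift n)
  mem_iff (x) : x ∈ paramDomain a → ∀ (B : Fin 2 → ℝ) (p : ℝ) (A' : Fin 2 → ℝ),
    (x.2.1, x.2.2, p, A') ∈ stableWhisker (hamiltonian f ω x.1) B ↔ p = P x ∧ A' = B + x.1 • A x
  partialDeriv_symm (x) : x ∈ paramDomain a → x.1 ≠ 0 → ∀ i j,
    partialDeriv j (fun φ => A (x.1, x.2.1, φ) i) x.2.2 =
      partialDeriv i (fun φ => A (x.1, x.2.1, φ) j) x.2.2

namespace IsSolutionFamily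

variable {f : (Fin 2 → ℝ) → ℝ} {hf : IsTorusFunction 2 f} {ω : Fin 2 → ℝ} {a : ℝ}
  {Φ : Param → BC × BC}

theorem contDiffOn_momentum (h : IsSolutionFamily hf ω a Φ) :
    ContDiffOn ℝ 1 (fun x => 2 * sin (x.2.1 / 2) * (1 + (Φ x).2 0)) (paramDomain a) := by
  have hsin : ContDiff ℝ 1 fun x : Param => 2 * sin (x.2.1 / 2) := by fun_prop
  exact hsin.contDiffOn.mul (contDiffOn_const.add
    ((BoundedContinuousFunction.evalCLM ℝ (0 : ℝ) : BC →L[ℝ] ℝ).contDiff.comp_contDiffOn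
      (contDiff_snd.comp_contDiffOn h.contDiffOn)))

theorem contDiffOn_action (h : IsSolutionFamily hf ω a Φ) :
    ContDiffOn ℝ 1 (fun x i => actionTail hf ω x.2.2 (Φ x).1 i 0) (paramDomain a) := by
  refine contDiffOn_pi.2 fun i => ?_
  have hΦ_fst := contDiff_fst.comp_contDiffOn h.contDiffOn
  have hscaled : ContDiff ℝ 1 scaledSinSq := by unfold scaledSinSq; fun_prop
  have horbit : ContDiff ℝ 1 fun x : Param => (hf.partialDeriv i).orbit ω x.2.2 :=
    ((hf.partialDeriv i).contDiff_orbit ω).comp (by fun_prop)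
  exact ((BoundedContinuousFunction.evalCLM ℝ (0 : ℝ) : BC →L[ℝ] ℝ) ∘L
    tailOp).contDiff.comp_contDiffOn
      (((hscaled.comp_contDiffOn hΦ_fst).mul horbit.contDiffOn).const_smul (2 : ℝ))

theorem mem_stableWhisker_iff (h : IsSolutionFamily hf ω a Φ) {x : Param} (hx : x ∈ paramDomain a)
    (B : Fin 2 → ℝ) (p : ℝ) (A' : Fin 2 → ℝ) :
    (x.2.1, x.2.2, p, A') ∈ stableWhisker (hamiltonian f ω x.1) B ↔
      p = 2 * sin (x.2.1 / 2) * (1 + (Φ x).2 0) ∧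
        A' = B + x.1 • fun i => actionTail hf ω x.2.2 (Φ x).1 i 0 := by
  refine ⟨fun hmem => ?_, ?_⟩
  · obtain ⟨d, u, hdefect, hd, hu, hp, hA⟩ := exists_defect_of_mem_stableWhisker hf hmem
      (h.abs_cos_le x hx) (h.norm_forcing_le x hx)
    rw [← h.eq_of_defect_eq_zero x hx d u hdefect hd hu]
    exact ⟨hp, hA⟩
  · rintro ⟨rfl, rfl⟩
    exact mem_stableWhisker_of_defect (h.mem_Ioo x hx) (h.norm_snd_lt x hx) (h.defect_eq_zero x hx)

theorem isStableGraph (h : IsSolutionFamily hf ω a Φ) :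
    IsStableGraph f ω a (fun x => 2 * sin (x.2.1 / 2) * (1 + (Φ x).2 0))
      fun x i => actionTail hf ω x.2.2 (Φ x).1 i 0 := by
  have hw : ∀ x ∈ paramDomain a, 0 < 1 + (Φ x).2 0 ∧ 1 + (Φ x).2 0 ≤ 2 := fun x hx => by
    have := abs_le.1 ((Φ x).2.abs_apply_le 0)
    have := h.norm_snd_lt x hx
    constructor <;> linarith
  refine ⟨h.pos, h.contDiffOn_momentum, h.contDiffOn_action, fun x hx => ?_, fun x hx => ?_,
    fun μ q n φ => ?_, fun x hx => h.mem_stableWhisker_iff hx,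
    fun x hx hx0 => h.partialDeriv_actionTail_symm hx hx0⟩
  · obtain ⟨hq0, hq⟩ := h.mem_Ioo x hx
    have := sin_pos_of_pos_of_lt_pi (x := x.2.1 / 2) (by linarith) (by linarith)
    have := (hw x hx).1
    positivity
  · calc 2 * sin (x.2.1 / 2) * (1 + (Φ x).2 0) ≤ 2 * 1 * 2 := by
          gcongr
          exacts [(hw x hx).1.le, sin_le_one _, (hw x hx).2]
      _ = 4 := by norm_num
  · simp only [actionTail, (hf.partialDeriv _).orbit_add_angleShift, h.periodic μ q n φ]

end IsSolutionFamily

theorem exists_isStableGraph {f : (Fin 2 → ℝ) → ℝ} (hf : IsTorusFunction 2 f) (ω : Fin 2 → ℝ) :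
    ∃ a P A, IsStableGraph f ω a P A :=
  have ⟨a, _, h⟩ := exists_isSolutionFamily hf ω
  ⟨a, _, _, h.isStableGraph⟩

/-! ### Time reversal -/

/-- The reversing symmetry `(q, φ, p, A) ↦ (2π - q, -φ, p, A)`. -/
def reflect (z : Phase) : Phase := (2 * π - z.1, -z.2.1, z.2.2.1, z.2.2.2)

theorem involutive_reflect : Function.Involutive reflect := fun z => by
  simp only [reflect, sub_sub_cancel, neg_neg]

theorem isometry_reflect : Isometry reflect := .of_dist_eq fun z z' => by
  simp only [reflect, Prod.dist_eq, dist_neg_neg, dist_sub_left]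

theorem reflect_mem_torus {B : Fin 2 → ℝ} {z : Phase} (hz : z ∈ torus B) :
    reflect z ∈ torus B := by
  obtain ⟨n, φ, rfl⟩ := hz
  refine ⟨1 - n, -φ, ?_⟩
  simp only [reflect, Prod.mk.injEq, and_true]
  push_cast
  ring

theorem infDist_reflect (B : Fin 2 → ℝ) (z : Phase) :
    Metric.infDist (reflect z) (torus B) = Metric.infDist z (torus B) := by
  have himage : reflect '' torus B = torus B :=
    (mapsTo_iff_image_subset.1 fun z => reflect_mem_torus).antisymm fun z hz =>
      ⟨reflect z, reflect_mem_torus hz, involutive_reflect z⟩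
  conv_lhs => rw [← himage]
  exact Metric.infDist_image isometry_reflect

section Reversible

variable {f : (Fin 2 → ℝ) → ℝ} {ω : Fin 2 → ℝ} {μ : ℝ} {B : Fin 2 → ℝ}

theorem reflect_flowField (hf : Function.Even f) (z : Phase) :
    flowField f ω μ (reflect z) =
      ((flowField f ω μ z).1, ω, -(flowField f ω μ z).2.2.1, -(flowField f ω μ z).2.2.2) := by
  refine Prod.ext rfl (Prod.ext rfl (Prod.ext ?_ (funext fun i => ?_)))
  · simp only [flowField, reflect, sin_two_pi_sub, hf z.2.1, neg_mul]
  · simp only [flowField, reflect, cos_two_pi_sub, partialDeriv_neg hf, mul_neg, Pi.neg_apply]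

theorem isIntegralCurve_reflect (hf : Function.Even f) {γ : ℝ → Phase}
    (hγ : IsIntegralCurve γ fun _ => flowField f ω μ) :
    IsIntegralCurve (fun t => reflect (γ (-t))) fun _ => flowField f ω μ := fun t => by
  have hneg : HasDerivAt (fun t => γ (-t)) (-flowField f ω μ (γ (-t))) t := by
    rw [← neg_one_smul ℝ]
    exact (hγ (-t)).scomp t (hasDerivAt_neg t)
  have hreflect := ((hasDerivAt_fst hneg).const_sub (2 * π)).prodMk
    ((hasDerivAt_fst (hasDerivAt_snd hneg)).fun_neg.prodMk (hasDerivAt_snd (hasDerivAt_snd hneg)))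
  change HasDerivAt _ (flowField f ω μ (reflect (γ (-t)))) t
  rw [reflect_flowField hf]
  exact HasDerivAt.congr_deriv hreflect
    (Prod.ext (neg_neg _) (Prod.ext (neg_neg _) rfl))

theorem reflect_mem_unstableWhisker (hf : IsPotential f) {z : Phase}
    (hz : z ∈ stableWhisker (hamiltonian f ω μ) B) :
    reflect z ∈ unstableWhisker (hamiltonian f ω μ) B := by
  obtain ⟨γ, hγ, rfl, hlim, hpos⟩ := hz
  rw [hamiltonianField_hamiltonian (hf.contDiff.differentiable two_ne_zero)] at hγ
  refine ⟨fun t => reflect (γ (-t)), ?_, congr(reflect (γ $neg_zero)), ?_, fun t ht => ?_⟩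
  · rw [hamiltonianField_hamiltonian (hf.contDiff.differentiable two_ne_zero)]
    exact isIntegralCurve_reflect hf.even hγ
  · simp_rw [infDist_reflect]
    exact hlim.comp tendsto_neg_atBot_atTop
  · obtain ⟨hq0, hq, hp⟩ := hpos (-t) (neg_nonneg.2 ht)
    exact ⟨sub_pos.2 hq, sub_lt_self _ hq0, hp⟩

theorem mem_unstableWhisker_iff (hf : IsPotential f) {z : Phase} :
    z ∈ unstableWhisker (hamiltonian f ω μ) B ↔
      reflect z ∈ stableWhisker (hamiltonian f ω μ) B := by
  refine ⟨fun hz => ?_, fun hz =>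
    involutive_reflect z ▸ reflect_mem_unstableWhisker hf hz⟩
  obtain ⟨γ, hγ, rfl, hlim, hpos⟩ := hz
  rw [hamiltonianField_hamiltonian (hf.contDiff.differentiable two_ne_zero)] at hγ
  refine ⟨fun t => reflect (γ (-t)), ?_, congr(reflect (γ $neg_zero)), ?_, fun t ht => ?_⟩
  · rw [hamiltonianField_hamiltonian (hf.contDiff.differentiable two_ne_zero)]
    exact isIntegralCurve_reflect hf.even hγ
  · simp_rw [infDist_reflect]
    exact hlim.comp tendsto_neg_atTop_atBot
  · obtain ⟨hq0, hq, hp⟩ := hpos (-t) (neg_nonpos.2 ht)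
    exact ⟨sub_pos.2 hq, sub_lt_self _ hq0, hp⟩

end Reversible

/-! ### Conservation of energy -/

theorem fderiv_hamiltonianField_eq_zero (H : Phase → ℝ) (z : Phase) :
    fderiv ℝ H z (hamiltonianField H z) = 0 := by
  set D := fderiv ℝ H z with D_def
  have hD : ∀ v : Phase, D v = v.1 * D (1, 0, 0, 0) + (v.2.1 0 * D (0, Pi.single 0 1, 0, 0) +
      v.2.1 1 * D (0, Pi.single 1 1, 0, 0)) + v.2.2.1 * D (0, 0, 1, 0) +
      (v.2.2.2 0 * D (0, 0, 0, Pi.single 0 1) + v.2.2.2 1 * D (0, 0, 0, Pi.single 1 1)) := by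
    intro v
    have hv : v = v.1 • ((1, 0, 0, 0) : Phase) + (v.2.1 0 • ((0, Pi.single 0 1, 0, 0) : Phase) +
        v.2.1 1 • ((0, Pi.single 1 1, 0, 0) : Phase)) + v.2.2.1 • ((0, 0, 1, 0) : Phase) +
        (v.2.2.2 0 • ((0, 0, 0, Pi.single 0 1) : Phase) +
          v.2.2.2 1 • ((0, 0, 0, Pi.single 1 1) : Phase)) := by
      refine Prod.ext ?_ (.trans (Prod.ext ?_ (Prod.ext ?_ ?_)) rfl)
      · simp
      · funext i; fin_cases i <;> simp
      · simp
      · funext i; fin_cases i <;> simp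
    conv_lhs => rw [hv]
    simp only [map_add, map_smul, smul_eq_mul]
  rw [hD]
  simp only [hamiltonianField, ← D_def]
  ring

theorem hamiltonian_eq_of_isIntegralCurve {H : Phase → ℝ} (hH : Differentiable ℝ H) {γ : ℝ → Phase}
    (hγ : IsIntegralCurve γ fun _ => hamiltonianField H) (t s : ℝ) : H (γ t) = H (γ s) := by
  have hderiv : ∀ t, HasDerivAt (fun t => H (γ t)) 0 t := fun t =>
    ((hH (γ t)).hasFDerivAt.comp_hasDerivAt t (hγ t)).congr_deriv
      (fderiv_hamiltonianField_eq_zero H (γ t))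
  exact is_const_of_deriv_eq_zero (fun t => (hderiv t).differentiableAt)
    (fun t => (hderiv t).deriv) t s

section Energy

variable {f : (Fin 2 → ℝ) → ℝ} (hf : IsTorusFunction 2 f) {ω : Fin 2 → ℝ} {μ : ℝ} {B : Fin 2 → ℝ}
include hf

theorem tendsto_hamiltonian_of_tendsto_infDist {l : Filter ℝ} {γ : ℝ → Phase}
    (hγ : Tendsto (fun t => Metric.infDist (γ t) (torus B)) l (𝓝 0)) :
    Tendsto (fun t => hamiltonian f ω μ (γ t)) l (𝓝 (ω 0 * B 0 + ω 1 * B 1)) := by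
  obtain ⟨C, -, hbound⟩ := hf.exists_bound
  have hA : ∀ i, Tendsto (fun t => (γ t).2.2.2 i) l (𝓝 (B i)) := fun i =>
    tendsto_iff_norm_sub_tendsto_zero.2 (squeeze_zero (fun t => norm_nonneg _)
      (fun t => abs_action_sub_le_infDist (γ t) B i) hγ)
  have hp : Tendsto (fun t => (γ t).2.2.1) l (𝓝 0) :=
    squeeze_zero_norm (fun t => abs_momentum_le_infDist (γ t) B) hγ
  have hsin : Tendsto (fun t => sin ((γ t).1 / 2)) l (𝓝 0) :=
    squeeze_zero_norm (fun t => abs_sin_half_le_infDist (γ t) B) hγ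
  have hforce : Tendsto (fun t => sin ((γ t).1 / 2) * f (γ t).2.1) l (𝓝 0) :=
    hsin.zero_mul_isBoundedUnder_le (isBoundedUnder_of ⟨C, fun t => hbound _⟩)
  have hlim := ((((hA 0).const_mul (ω 0)).add ((hA 1).const_mul (ω 1))).add
    ((hp.pow 2).div_const 2)).add ((hsin.mul ((hforce.const_mul μ).sub hsin)).const_mul 2)
  refine (hlim.congr fun t => ?_).trans_eq (by simp)
  have hcos := cos_two_mul' ((γ t).1 / 2)
  rw [mul_div_cancel₀ _ two_ne_zero, cos_sq'] at hcos
  simp only [hamiltonian, hcos]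
  ring

theorem hamiltonian_eq_of_tendsto_infDist {l : Filter ℝ} [l.NeBot] {γ : ℝ → Phase}
    (hγ : IsIntegralCurve γ fun _ => hamiltonianField (hamiltonian f ω μ))
    (hlim : Tendsto (fun t => Metric.infDist (γ t) (torus B)) l (𝓝 0)) (t : ℝ) :
    hamiltonian f ω μ (γ t) = ω 0 * B 0 + ω 1 * B 1 :=
  tendsto_nhds_unique (tendsto_const_nhds.congr fun s => hamiltonian_eq_of_isIntegralCurve
    ((contDiff_hamiltonian hf.contDiff ω μ).differentiable two_ne_zero) hγ t s)
    (tendsto_hamiltonian_of_tendsto_infDist hf hlim)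

theorem hamiltonian_eq_of_mem_stableWhisker {z : Phase}
    (hz : z ∈ stableWhisker (hamiltonian f ω μ) B) :
    hamiltonian f ω μ z = ω 0 * B 0 + ω 1 * B 1 := by
  obtain ⟨γ, hγ, rfl, hlim, -⟩ := hz
  exact hamiltonian_eq_of_tendsto_infDist hf hγ hlim 0

theorem hamiltonian_eq_of_mem_unstableWhisker {z : Phase}
    (hz : z ∈ unstableWhisker (hamiltonian f ω μ) B) :
    hamiltonian f ω μ z = ω 0 * B 0 + ω 1 * B 1 := by
  obtain ⟨γ, hγ, rfl, hlim, -⟩ := hz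
  exact hamiltonian_eq_of_tendsto_infDist hf hγ hlim 0

end Energy

/-! ### Invariance of the whiskers -/

theorem exists_hasDerivAt_mem_stableWhisker {H : Phase → ℝ} {B : Fin 2 → ℝ} {z : Phase}
    (hz : z ∈ stableWhisker H B) : ∃ γ : ℝ → Phase, HasDerivAt γ (hamiltonianField H z) 0 ∧
      γ 0 = z ∧ ∀ t, 0 ≤ t → γ t ∈ stableWhisker H B := by
  obtain ⟨γ, hγ, rfl, hlim, hpos⟩ := hz
  refine ⟨γ, hγ 0, rfl, fun t ht =>
    ⟨fun s => γ (s + t), fun s => (hγ (s + t)).comp_add_const s t, congr(γ $(zero_add t)),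
      hlim.comp (tendsto_atTop_add_const_right _ t tendsto_id), fun s hs => hpos _ (by linarith)⟩⟩

theorem exists_hasDerivAt_mem_unstableWhisker {H : Phase → ℝ} {B : Fin 2 → ℝ} {z : Phase}
    (hz : z ∈ unstableWhisker H B) : ∃ γ : ℝ → Phase, HasDerivAt γ (hamiltonianField H z) 0 ∧
      γ 0 = z ∧ ∀ t, t ≤ 0 → γ t ∈ unstableWhisker H B := by
  obtain ⟨γ, hγ, rfl, hlim, hpos⟩ := hz
  refine ⟨γ, hγ 0, rfl, fun t ht =>
    ⟨fun s => γ (s + t), fun s => (hγ (s + t)).comp_add_const s t, congr(γ $(zero_add t)),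
      hlim.comp (tendsto_atBot_add_const_right _ t tendsto_id), fun s hs => hpos _ (by linarith)⟩⟩

/-! ### Graphs over the angles -/

/-- The space of angles `(q, φ)`, and also the space of momenta `(p, A)`. -/
abbrev HalfPhase : Type := ℝ × (Fin 2 → ℝ)

/-- The angles `(q, φ)` of a point. -/
def angles : Phase →L[ℝ] HalfPhase :=
  (ContinuousLinearMap.fst ℝ HalfPhase HalfPhase).comp
    ((ContinuousLinearEquiv.prodAssoc ℝ ℝ (Fin 2 → ℝ) HalfPhase).symm : Phase →L[ℝ] _)

/-- The momenta `(p, A)` of a point. -/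
def momenta : Phase →L[ℝ] HalfPhase :=
  (ContinuousLinearMap.snd ℝ HalfPhase HalfPhase).comp
    ((ContinuousLinearEquiv.prodAssoc ℝ ℝ (Fin 2 → ℝ) HalfPhase).symm : Phase →L[ℝ] _)

/-- The point with given angles and momenta. -/
def join : HalfPhase × HalfPhase →L[ℝ] Phase :=
  ContinuousLinearEquiv.prodAssoc ℝ ℝ (Fin 2 → ℝ) HalfPhase

theorem angles_join (x y : HalfPhase) : angles (join (x, y)) = x := rfl

theorem momenta_join (x y : HalfPhase) : momenta (join (x, y)) = y := rfl

theorem join_angles_momenta (z : Phase) : join (angles z, momenta z) = z := rfl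

/-- The linear map `v ↦ momenta v - L (angles v)`, whose kernel is the graph of `L`. -/
def graphDefect (L : HalfPhase →L[ℝ] HalfPhase) : Phase →L[ℝ] HalfPhase :=
  momenta - L.comp angles

theorem mem_ker_graphDefect {L : HalfPhase →L[ℝ] HalfPhase} {v : Phase} :
    v ∈ LinearMap.ker (graphDefect L : Phase →ₗ[ℝ] HalfPhase) ↔ momenta v = L (angles v) :=
  sub_eq_zero

/-- Over the angles in `V`, the set `S` is the graph of `g`. -/
def IsGraphOver (S : Set Phase) (V : Set HalfPhase) (g : HalfPhase → HalfPhase) : Prop :=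
  ∀ z : Phase, angles z ∈ V → (z ∈ S ↔ momenta z = g (angles z))

namespace IsGraphOver

variable {S : Set Phase} {V : Set HalfPhase} {g : HalfPhase → HalfPhase} (hS : IsGraphOver S V g)
include hS

theorem join_mem {x : HalfPhase} (hx : x ∈ V) : join (x, g x) ∈ S := (hS _ hx).2 rfl

theorem graphMomenta_eq {q : ℝ} {φ : Fin 2 → ℝ} (hx : (q, φ) ∈ V) :
    graphMomenta S q φ = g (q, φ) :=
  (hS (join ((q, φ), graphMomenta S q φ)) hx).1
    (Classical.epsilon_spec (p := fun y : HalfPhase => (q, φ, y.1, y.2) ∈ S) ⟨_, hS.join_mem hx⟩)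

theorem hasTangentSpaceAt (hV : IsOpen V) (hg : ContDiffOn ℝ 1 g V) {z : Phase}
    (hz : angles z ∈ V) :
    HasTangentSpaceAt 3 S z
      (LinearMap.ker (graphDefect (fderiv ℝ g (angles z)) : Phase →ₗ[ℝ] HalfPhase)) := by
  have hdim : Module.finrank ℝ HalfPhase = Module.finrank ℝ (Fin 3 → ℝ) := by simp
  set e := ContinuousLinearEquiv.ofFinrankEq hdim
  have hderiv : HasFDerivAt (fun z => e (momenta z - g (angles z)))
      ((e : HalfPhase →L[ℝ] (Fin 3 → ℝ)).comp (graphDefect (fderiv ℝ g (angles z)))) z :=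
    e.hasFDerivAt.comp z (momenta.hasFDerivAt.sub
      (((hg.contDiffAt (hV.mem_nhds hz)).differentiableAt one_ne_zero).hasFDerivAt.comp z
        angles.hasFDerivAt))
  refine ⟨angles ⁻¹' V, fun z => e (momenta z - g (angles z)), hV.preimage angles.continuous, hz,
    e.contDiff.comp_contDiffOn (momenta.contDiff.contDiffOn.sub
      (hg.comp angles.contDiff.contDiffOn fun _ => id)), ?_, ?_, ?_⟩
  · ext z'
    simp only [mem_inter_iff, mem_preimage, mem_ofPred_eq, map_eq_zero_iff e e.injective,
      sub_eq_zero]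
    exact ⟨fun h => ⟨h.2, (hS z' h.2).1 h.1⟩, fun h => ⟨(hS z' h.1).2 h.2, h.1⟩⟩
  · rw [hderiv.fderiv]
    refine fun w => ⟨join (0, e.symm w), ?_⟩
    simp only [graphDefect, ContinuousLinearMap.comp_apply, sub_apply, angles_join, momenta_join,
      map_zero, sub_zero]
    exact e.apply_symm_apply w
  · rw [hderiv.fderiv]
    ext v
    exact (map_eq_zero_iff e e.injective).symm

theorem fderiv_apply_eq (hV : IsOpen V) {z v : Phase} (hz : angles z ∈ V)
    (hg : DifferentiableAt ℝ g (angles z)) {γ : ℝ → Phase} {J : Set ℝ}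
    (hJ : UniqueDiffWithinAt ℝ J 0) (hzero : (0 : ℝ) ∈ J) (hγ : HasDerivAt γ v 0) (hγz : γ 0 = z)
    (hmem : ∀ t ∈ J, γ t ∈ S) :
    fderiv ℝ g (angles z) (angles v) = momenta v := by
  subst hγz
  have hangles : HasDerivAt (fun t => angles (γ t)) (angles v) 0 :=
    angles.hasFDerivAt.comp_hasDerivAt 0 hγ
  have hgraph : ∀ᶠ t in 𝓝[J] 0, momenta (γ t) = g (angles (γ t)) := by
    filter_upwards [self_mem_nhdsWithin, mem_nhdsWithin_of_mem_nhds
      (hangles.continuousAt.preimage_mem_nhds (hV.mem_nhds hz))] with t ht htV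
    exact (hS _ htV).1 (hmem t ht)
  exact hJ.eq_deriv _
    ((hg.hasFDerivAt.comp_hasDerivAt (0 : ℝ) hangles).hasDerivWithinAt.congr_of_eventuallyEq hgraph
      ((hS _ hz).1 (hmem 0 hzero)))
    (momenta.hasFDerivAt.comp_hasDerivAt 0 hγ).hasDerivWithinAt

end IsGraphOver

theorem fderiv_join_eq_zero {H : Phase → ℝ} {V : Set HalfPhase} {g : HalfPhase → HalfPhase} {E : ℝ}
    {x : HalfPhase} (hV : V ∈ 𝓝 x) (hg : DifferentiableAt ℝ g x)
    (hH : DifferentiableAt ℝ H (join (x, g x))) (hE : ∀ x ∈ V, H (join (x, g x)) = E)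
    (v : HalfPhase) :
    fderiv ℝ H (join (x, g x)) (join (v, fderiv ℝ g x v)) = 0 := by
  have hcomp : HasFDerivAt (fun x => H (join (x, g x)))
      ((fderiv ℝ H (join (x, g x))).comp (join.comp ((ContinuousLinearMap.id ℝ HalfPhase).prod
        (fderiv ℝ g x)))) x :=
    hH.hasFDerivAt.comp x
      (join.hasFDerivAt.comp x ((hasFDerivAt_id x).prodMk hg.hasFDerivAt))
  have hconst : HasFDerivAt (fun x => H (join (x, g x))) (0 : HalfPhase →L[ℝ] ℝ) x :=
    (hasFDerivAt_const E x).congr_of_eventuallyEq (by filter_upwards [hV] using hE)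
  exact DFunLike.congr_fun (hcomp.unique hconst) v

theorem ker_graphDefect_le {ℓ : Phase →L[ℝ] ℝ} {L : HalfPhase →L[ℝ] HalfPhase}
    (hL : ∀ x, ℓ (join (x, L x)) = 0) :
    LinearMap.ker (graphDefect L : Phase →ₗ[ℝ] HalfPhase) ≤
      LinearMap.ker (ℓ : Phase →ₗ[ℝ] ℝ) := fun v hv => by
  have hangles := hL (angles v)
  rwa [← mem_ker_graphDefect.1 hv, join_angles_momenta] at hangles

theorem ker_graphDefect_sup_ker {ℓ : Phase →L[ℝ] ℝ} {L L' : HalfPhase →L[ℝ] HalfPhase}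
    (hL : ∀ x, ℓ (join (x, L x)) = 0) (hL' : ∀ x, ℓ (join (x, L' x)) = 0)
    (hp : ℓ (0, 0, 1, 0) ≠ 0) (hsurj : Function.Surjective fun x => (L' x).2 - (L x).2) :
    LinearMap.ker (graphDefect L : Phase →ₗ[ℝ] HalfPhase) ⊔
      LinearMap.ker (graphDefect L' : Phase →ₗ[ℝ] HalfPhase) =
      LinearMap.ker (ℓ : Phase →ₗ[ℝ] ℝ) := by
  refine (sup_le (ker_graphDefect_le hL) (ker_graphDefect_le hL')).antisymm fun v hv => ?_
  obtain ⟨x, hx⟩ := hsurj ((momenta v).2 - (L (angles v)).2)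
  set t := join (angles v - x, L (angles v - x)) with ht
  set t' := join (x, L' x) with ht'
  have hmomentum : v - (t + t') = (v - (t + t')).2.2.1 • ((0, 0, 1, 0) : Phase) := by
    have hangles : angles (v - (t + t')) = 0 := by
      rw [map_sub, map_add, angles_join, angles_join, sub_add_cancel, sub_self]
    have haction : (momenta (v - (t + t'))).2 = 0 := by
      rw [map_sub, map_add, momenta_join, momenta_join, map_sub, Prod.snd_sub, Prod.snd_add,
        Prod.snd_sub, sub_add_comm, sub_eq_zero]
      exact (eq_sub_iff_add_eq.1 hx).symm
    rw [← join_angles_momenta (v - (t + t')), hangles,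
      ← Prod.mk.eta (p := momenta (v - (t + t'))), haction]
    simp [join]
  have hzero : ℓ (v - (t + t')) = 0 := by
    rw [map_sub, map_add, ht, ht', hL, hL', add_zero, sub_zero]
    exact hv
  rw [hmomentum, map_smul, smul_eq_mul] at hzero
  rw [(mul_eq_zero.1 hzero).resolve_right hp, zero_smul, sub_eq_zero] at hmomentum
  rw [hmomentum]
  exact Submodule.add_mem_sup (mem_ker_graphDefect.2 rfl) (mem_ker_graphDefect.2 rfl)

/-! ### The two whiskers and the gap between their actions -/

/-- The action of the time reversal on the parameters. -/
def reflectParam (x : Param) : Param := (x.1, 2 * π - x.2.1, -x.2.2)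

/-- The gap between the actions of the stable whisker and of its reflection, the unstable one. -/
def actionGap (A : Param → Fin 2 → ℝ) : Param → Fin 2 → ℝ := A - A ∘ reflectParam

/-- The map from the angles to the momenta whose graph is the whisker of `T(B)` at parameter `μ`. -/
def graphMap (P : Param → ℝ) (A : Param → Fin 2 → ℝ) (μ : ℝ) (B : Fin 2 → ℝ) (x : HalfPhase) :
    HalfPhase :=
  (P (μ, x), B + μ • A (μ, x))

/-- The angles over which the whiskers are described as graphs. -/
def angleDomain (a : ℝ) : Set HalfPhase := {x | |x.1 - π| < a}

theorem isOpen_angleDomain (a : ℝ) : IsOpen (angleDomain a) :=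
  isOpen_lt (by fun_prop) continuous_const

theorem contDiff_reflectParam : ContDiff ℝ 1 reflectParam := by
  unfold reflectParam
  fun_prop

theorem mapsTo_reflectParam (a : ℝ) : MapsTo reflectParam (paramDomain a) (paramDomain a) :=
  fun x hx => ⟨hx.1, by
    rw [reflectParam, two_mul, add_sub_right_comm, add_sub_cancel_right, abs_sub_comm]
    exact hx.2⟩

section GraphMap

variable {P : Param → ℝ} {A : Param → Fin 2 → ℝ} {a μ : ℝ} {x : HalfPhase}

theorem contDiffOn_graphMap (hP : ContDiffOn ℝ 1 P (paramDomain a))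
    (hA : ContDiffOn ℝ 1 A (paramDomain a)) (hμ : |μ| < a) (B : Fin 2 → ℝ) :
    ContDiffOn ℝ 1 (graphMap P A μ B) (angleDomain a) := by
  have hmk : ContDiffOn ℝ 1 (fun x : HalfPhase => ((μ, x) : Param)) (angleDomain a) :=
    contDiffOn_const.prodMk contDiffOn_id
  have hmaps : MapsTo (fun x : HalfPhase => ((μ, x) : Param)) (angleDomain a) (paramDomain a) :=
    fun x hx => ⟨hμ, hx⟩
  exact (hP.comp hmk hmaps).prodMk (contDiffOn_const.add ((hA.comp hmk hmaps).const_smul μ))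

theorem differentiableAt_graphMap (hP : DifferentiableAt ℝ P (μ, x))
    (hA : DifferentiableAt ℝ A (μ, x)) (B : Fin 2 → ℝ) :
    DifferentiableAt ℝ (graphMap P A μ B) x := by
  have hmk := (hasFDerivAt_prodMk_right (𝕜 := ℝ) μ x).differentiableAt
  exact (hP.comp x hmk).prodMk (((hA.comp x hmk).const_smul μ).const_add B)

theorem fderiv_graphMap_snd (hP : DifferentiableAt ℝ P (μ, x)) (hA : DifferentiableAt ℝ A (μ, x))
    (B : Fin 2 → ℝ) (v : HalfPhase) :
    (fderiv ℝ (graphMap P A μ B) x v).2 = μ • fderiv ℝ A (μ, x) (0, v) := by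
  have hmk := hasFDerivAt_prodMk_right (𝕜 := ℝ) μ x
  have hgraph : HasFDerivAt (graphMap P A μ B) _ x :=
    (hP.hasFDerivAt.comp x hmk).prodMk (((hA.hasFDerivAt.comp x hmk).const_smul μ).const_add B)
  rw [hgraph.fderiv]
  rfl

end GraphMap

theorem partialDeriv_slice {G : Param → Fin 2 → ℝ} {x : Param} (hG : DifferentiableAt ℝ G x)
    (i j : Fin 2) :
    partialDeriv j (fun φ => G (x.1, x.2.1, φ) i) x.2.2 = fderiv ℝ G x (0, 0, Pi.single j 1) i := by
  have hmk : HasFDerivAt (fun φ : Fin 2 → ℝ => ((x.1, x.2.1, φ) : Param))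
      (.inr ℝ ℝ HalfPhase ∘L .inr ℝ ℝ (Fin 2 → ℝ)) x.2.2 :=
    (hasFDerivAt_prodMk_right x.1 (x.2.1, x.2.2)).comp x.2.2
      (hasFDerivAt_prodMk_right x.2.1 x.2.2)
  have hslice : HasFDerivAt (fun φ => G (x.1, x.2.1, φ) i) _ x.2.2 :=
    (ContinuousLinearMap.proj (R := ℝ) (φ := fun _ : Fin 2 => ℝ) i).hasFDerivAt.comp x.2.2
      (hG.hasFDerivAt.comp x.2.2 hmk)
  rw [partialDeriv, hslice.fderiv]
  rfl

theorem fderiv_comp_reflectParam {G : Param → Fin 2 → ℝ} {x : Param}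
    (hG : DifferentiableAt ℝ G (reflectParam x)) (v : Fin 2 → ℝ) :
    fderiv ℝ (G ∘ reflectParam) x (0, 0, v) = -fderiv ℝ G (reflectParam x) (0, 0, v) := by
  have haffine : reflectParam = fun x : Param =>
      (0, 2 * π, 0) + ((ContinuousLinearMap.fst ℝ ℝ HalfPhase).prod
        (-ContinuousLinearMap.snd ℝ ℝ HalfPhase)) x := by
    funext x
    simp [reflectParam, sub_eq_add_neg, Prod.ext_iff]
  have hreflect : HasFDerivAt reflectParam
      ((ContinuousLinearMap.fst ℝ ℝ HalfPhase).prod (-ContinuousLinearMap.snd ℝ ℝ HalfPhase)) x :=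
    haffine ▸ (ContinuousLinearMap.hasFDerivAt _).const_add _
  rw [(hG.hasFDerivAt.comp x hreflect).fderiv, ← map_neg]
  simp

namespace IsStableGraph

variable {f : (Fin 2 → ℝ) → ℝ} {ω : Fin 2 → ℝ} {a : ℝ} {P : Param → ℝ} {A : Param → Fin 2 → ℝ}
  {μ q δ : ℝ} {φ : Fin 2 → ℝ} {x : Param}

section Regularity

variable (h : IsStableGraph f ω a P A)
include h

theorem contDiffOn_unstableMomentum : ContDiffOn ℝ 1 (P ∘ reflectParam) (paramDomain a) :=
  h.contDiffOn_momentum.comp contDiff_reflectParam.contDiffOn (mapsTo_reflectParam a)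

theorem contDiffOn_unstableAction : ContDiffOn ℝ 1 (A ∘ reflectParam) (paramDomain a) :=
  h.contDiffOn_action.comp contDiff_reflectParam.contDiffOn (mapsTo_reflectParam a)

theorem contDiffOn_actionGap : ContDiffOn ℝ 1 (actionGap A) (paramDomain a) :=
  h.contDiffOn_action.sub h.contDiffOn_unstableAction

theorem differentiableAt_momentum (hx : x ∈ paramDomain a) : DifferentiableAt ℝ P x :=
  (h.contDiffOn_momentum.differentiableOn one_ne_zero).differentiableAt
    ((isOpen_paramDomain a).mem_nhds hx)

theorem differentiableAt_action (hx : x ∈ paramDomain a) : DifferentiableAt ℝ A x :=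
  (h.contDiffOn_action.differentiableOn one_ne_zero).differentiableAt
    ((isOpen_paramDomain a).mem_nhds hx)

theorem differentiableAt_unstableMomentum (hx : x ∈ paramDomain a) :
    DifferentiableAt ℝ (P ∘ reflectParam) x :=
  (h.differentiableAt_momentum (mapsTo_reflectParam a hx)).comp x
    (contDiff_reflectParam.differentiable one_ne_zero x)

theorem differentiableAt_unstableAction (hx : x ∈ paramDomain a) :
    DifferentiableAt ℝ (A ∘ reflectParam) x :=
  (h.differentiableAt_action (mapsTo_reflectParam a hx)).comp x
    (contDiff_reflectParam.differentiable one_ne_zero x)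

theorem differentiableAt_actionGap (hx : x ∈ paramDomain a) : DifferentiableAt ℝ (actionGap A) x :=
  (h.differentiableAt_action hx).sub (h.differentiableAt_unstableAction hx)

theorem actionGap_periodic (μ q : ℝ) (n : Fin 2 → ℤ) :
    Function.Periodic (fun φ => actionGap A (μ, q, φ)) (angleShift n) := fun φ => by
  have hneg : -(φ + angleShift n) = -φ - angleShift n := neg_add' φ _
  simp only [actionGap, Pi.sub_apply, Function.comp_apply, reflectParam, hneg]
  exact congr_arg₂ _ (h.action_periodic μ q n φ) ((h.action_periodic μ _ n).sub_eq _)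

theorem fderiv_actionGap (hx : x ∈ paramDomain a) :
    fderiv ℝ (actionGap A) x = fderiv ℝ A x - fderiv ℝ (A ∘ reflectParam) x :=
  fderiv_sub (h.differentiableAt_action hx) (h.differentiableAt_unstableAction hx)

theorem fderiv_actionGap_symm (hx : x ∈ paramDomain a) (hμ : x.1 ≠ 0) (i j : Fin 2) :
    fderiv ℝ (actionGap A) x (0, 0, Pi.single j 1) i =
      fderiv ℝ (actionGap A) x (0, 0, Pi.single i 1) j := by
  have hx' := mapsTo_reflectParam a hx
  have hsplit : ∀ i j, fderiv ℝ (actionGap A) x (0, 0, Pi.single j 1) i =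
      partialDeriv j (fun φ => A (x.1, x.2.1, φ) i) x.2.2 +
        partialDeriv j (fun φ => A (x.1, 2 * π - x.2.1, φ) i) (-x.2.2) := fun i j => by
    rw [h.fderiv_actionGap hx, sub_apply, fderiv_comp_reflectParam (h.differentiableAt_action hx'),
      sub_neg_eq_add, partialDeriv_slice (h.differentiableAt_action hx)]
    exact congr_arg _ (partialDeriv_slice (h.differentiableAt_action hx') i j).symm
  rw [hsplit, hsplit, h.partialDeriv_symm x hx hμ i j]
  exact congr_arg _ (h.partialDeriv_symm _ hx' hμ i j)

end Regularity

section Whiskers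

theorem isGraphOver_stable (h : IsStableGraph f ω a P A) (hμ : |μ| < a) (B : Fin 2 → ℝ) :
    IsGraphOver (stableWhisker (hamiltonian f ω μ) B) (angleDomain a) (graphMap P A μ B) :=
  fun z hz => (h.mem_iff (μ, angles z) ⟨hμ, hz⟩ B z.2.2.1 z.2.2.2).trans
    (Prod.ext_iff (x := momenta z) (y := graphMap P A μ B (angles z))).symm

theorem isGraphOver_unstable (h : IsStableGraph f ω a P A) (hf : IsPotential f) (hμ : |μ| < a)
    (B : Fin 2 → ℝ) : IsGraphOver (unstableWhisker (hamiltonian f ω μ) B) (angleDomain a)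
      (graphMap (P ∘ reflectParam) (A ∘ reflectParam) μ B) := fun z hz =>
  (mem_unstableWhisker_iff hf).trans
    ((h.mem_iff _ (mapsTo_reflectParam a (x := (μ, angles z)) ⟨hμ, hz⟩) B z.2.2.1 z.2.2.2).trans
      (Prod.ext_iff (x := momenta z)
        (y := graphMap (P ∘ reflectParam) (A ∘ reflectParam) μ B (angles z))).symm)

variable (h : IsStableGraph f ω a P A) (hf : IsPotential f) (hμ : μ ≠ 0)
  (hx : ((μ, q, φ) : Param) ∈ paramDomain a)
include h hf hμ hx

theorem ΔA_eq_actionGap : ΔA f ω μ q φ = actionGap A (μ, q, φ) := by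
  rw [ΔA, AS, AU, (h.isGraphOver_stable hx.1 0).graphMomenta_eq hx.2,
    (h.isGraphOver_unstable hf hx.1 0).graphMomenta_eq hx.2]
  simp only [graphMap, zero_add, inv_smul_smul₀ hμ]
  rfl

theorem unstablePoint_eq_join (B : Fin 2 → ℝ) :
    unstablePoint f ω μ B q φ =
      join ((q, φ), graphMap (P ∘ reflectParam) (A ∘ reflectParam) μ B (q, φ)) := by
  rw [unstablePoint, pU, AU, (h.isGraphOver_unstable hf hx.1 0).graphMomenta_eq hx.2]
  simp only [graphMap, zero_add, inv_smul_smul₀ hμ, mul_inv_cancel_left₀ hμ, add_sub_cancel]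
  rfl

theorem Mse_apply (i j : Fin 2) :
    Mse f ω μ q φ i j = fderiv ℝ (actionGap A) (μ, q, φ) (0, 0, Pi.single j 1) i := by
  have hslice : (fun φ => ΔA f ω μ q φ i) = fun φ => actionGap A (μ, q, φ) i :=
    funext fun ψ => congr($(h.ΔA_eq_actionGap hf hμ (φ := ψ) hx) i)
  rw [Mse, Matrix.of_apply, hslice]
  exact partialDeriv_slice (h.differentiableAt_actionGap hx) i j

end Whiskers

end IsStableGraph

/-! ### Heteroclinic points -/

namespace IsStableGraph

variable {f : (Fin 2 → ℝ) → ℝ} {ω : Fin 2 → ℝ} {a : ℝ} {P : Param → ℝ} {A : Param → Fin 2 → ℝ}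
  {μ q δ : ℝ} {φ : Fin 2 → ℝ} (h : IsStableGraph f ω a P A)
  (hx : ((μ, q, φ) : Param) ∈ paramDomain a)
include h hx

theorem differentiableAt_stableGraph (B : Fin 2 → ℝ) :
    DifferentiableAt ℝ (graphMap P A μ B) (q, φ) :=
  differentiableAt_graphMap (h.differentiableAt_momentum hx) (h.differentiableAt_action hx) B

theorem differentiableAt_unstableGraph (B : Fin 2 → ℝ) :
    DifferentiableAt ℝ (graphMap (P ∘ reflectParam) (A ∘ reflectParam) μ B) (q, φ) :=
  differentiableAt_graphMap (h.differentiableAt_unstableMomentum hx)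
    (h.differentiableAt_unstableAction hx) B

theorem fderiv_graphMap_sub_snd (B B' : Fin 2 → ℝ) (v : HalfPhase) :
    (fderiv ℝ (graphMap P A μ B) (q, φ) v).2 -
      (fderiv ℝ (graphMap (P ∘ reflectParam) (A ∘ reflectParam) μ B') (q, φ) v).2 =
      μ • fderiv ℝ (actionGap A) (μ, q, φ) (0, v) := by
  rw [fderiv_graphMap_snd (h.differentiableAt_momentum hx) (h.differentiableAt_action hx),
    fderiv_graphMap_snd (h.differentiableAt_unstableMomentum hx)
      (h.differentiableAt_unstableAction hx), ← smul_sub, h.fderiv_actionGap hx, sub_apply]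

variable (hf : IsPotential f)
include hf

section Gap

variable (hgap : μ • actionGap A (μ, q, φ) = -(δ • perp ω))
include hgap

-- The two points have the same energy, since `ω ⬝ perp ω = 0`, and positive momentum `p`.
theorem momentum_eq_of_actionGap : P (μ, q, φ) = P (reflectParam (μ, q, φ)) := by
  have hstable := hamiltonian_eq_of_mem_stableWhisker hf.toIsTorusFunction
    ((h.isGraphOver_stable hx.1 (δ • perp ω)).join_mem hx.2)
  have hunstable := hamiltonian_eq_of_mem_unstableWhisker hf.toIsTorusFunction
    ((h.isGraphOver_unstable hf hx.1 0).join_mem hx.2)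
  have hgap_zero := congr_fun hgap 0
  have hgap_one := congr_fun hgap 1
  simp only [actionGap, perp, Pi.smul_apply, Pi.sub_apply, Pi.neg_apply, smul_eq_mul,
    Function.comp_apply, Matrix.cons_val_zero, Matrix.cons_val_one] at hgap_zero hgap_one
  change hamiltonian f ω μ (q, φ, P (μ, q, φ), δ • perp ω + μ • A (μ, q, φ)) = _ at hstable
  change hamiltonian f ω μ (q, φ, P (reflectParam (μ, q, φ)),
    0 + μ • A (reflectParam (μ, q, φ))) = _ at hunstable
  simp only [hamiltonian, perp, Pi.add_apply, Pi.smul_apply, smul_eq_mul, Matrix.cons_val_zero,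
    Matrix.cons_val_one, Pi.zero_apply] at hstable hunstable
  refine (sq_eq_sq₀ (h.momentum_pos _ hx).le
    (h.momentum_pos _ (mapsTo_reflectParam a hx)).le).1 ?_
  linear_combination
    2 * hstable - 2 * hunstable - 2 * ω 0 * hgap_zero - 2 * ω 1 * hgap_one

theorem graphMap_eq_of_actionGap (B : Fin 2 → ℝ) :
    graphMap P A μ (B + δ • perp ω) (q, φ) =
      graphMap (P ∘ reflectParam) (A ∘ reflectParam) μ B (q, φ) := by
  refine Prod.ext (h.momentum_eq_of_actionGap hx hf hgap) ?_
  rw [actionGap, Pi.sub_apply, smul_sub, sub_eq_iff_eq_add] at hgap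
  change B + δ • perp ω + μ • A (μ, q, φ) = B + μ • (A ∘ reflectParam) (μ, q, φ)
  rw [hgap]
  abel

-- Both whiskers contain the motion through their common point.
theorem fderiv_graphMap_eq_of_actionGap :
    fderiv ℝ (graphMap P A μ (δ • perp ω)) (q, φ) (P (μ, q, φ), ω) =
      fderiv ℝ (graphMap (P ∘ reflectParam) (A ∘ reflectParam) μ 0) (q, φ) (P (μ, q, φ), ω) := by
  have hpoint := h.graphMap_eq_of_actionGap hx hf hgap 0
  rw [zero_add] at hpoint
  have hS := h.isGraphOver_stable hx.1 (δ • perp ω)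
  have hU := h.isGraphOver_unstable hf hx.1 0
  have hmemU := hU.join_mem hx.2
  rw [← hpoint] at hmemU
  obtain ⟨γ, hγ, hγ_zero, hγ_mem⟩ := exists_hasDerivAt_mem_stableWhisker (hS.join_mem hx.2)
  obtain ⟨γ', hγ', hγ'_zero, hγ'_mem⟩ := exists_hasDerivAt_mem_unstableWhisker hmemU
  have htangentS := hS.fderiv_apply_eq (isOpen_angleDomain a) hx.2
    (h.differentiableAt_stableGraph hx _)
    (uniqueDiffOn_Ici (0 : ℝ) 0 self_mem_Ici) self_mem_Ici hγ hγ_zero hγ_mem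
  have htangentU := hU.fderiv_apply_eq (isOpen_angleDomain a) hx.2
    (h.differentiableAt_unstableGraph hx _)
    (uniqueDiffOn_Iic (0 : ℝ) 0 self_mem_Iic) self_mem_Iic hγ' hγ'_zero hγ'_mem
  rw [hamiltonianField_hamiltonian (hf.contDiff.differentiable two_ne_zero)] at htangentS htangentU
  exact htangentS.trans htangentU.symm

theorem fderiv_actionGap_flow (hμ : μ ≠ 0) :
    fderiv ℝ (actionGap A) (μ, q, φ) (0, P (μ, q, φ), ω) = 0 := by
  have hsub := h.fderiv_graphMap_sub_snd hx (δ • perp ω) 0 (P (μ, q, φ), ω)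
  rw [h.fderiv_graphMap_eq_of_actionGap hx hf hgap, sub_self] at hsub
  exact (smul_eq_zero.1 hsub.symm).resolve_left hμ

theorem transversalAt_of_actionGap (hμ : μ ≠ 0) (B : Fin 2 → ℝ)
    (hsurj : Function.Surjective fun v => fderiv ℝ (actionGap A) (μ, q, φ) (0, v)) :
    TransversalAt (hamiltonian f ω μ) (unstableWhisker (hamiltonian f ω μ) B)
      (stableWhisker (hamiltonian f ω μ) (B + δ • perp ω)) (unstablePoint f ω μ B q φ) := by
  have hH : Differentiable ℝ (hamiltonian f ω μ) :=
    (contDiff_hamiltonian hf.contDiff ω μ).differentiable two_ne_zero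
  have hV := isOpen_angleDomain a
  have hVx : angleDomain a ∈ 𝓝 (q, φ) := hV.mem_nhds hx.2
  have hS := h.isGraphOver_stable hx.1 (B + δ • perp ω)
  have hU := h.isGraphOver_unstable hf hx.1 B
  have hpoint := h.graphMap_eq_of_actionGap hx hf hgap B
  have hmemS := hS.join_mem hx.2
  rw [hpoint] at hmemS
  rw [h.unstablePoint_eq_join hf hμ hx]
  refine ⟨hU.join_mem hx.2, hmemS, _, _,
    hU.hasTangentSpaceAt hV (contDiffOn_graphMap h.contDiffOn_unstableMomentum
      h.contDiffOn_unstableAction hx.1 B) hx.2,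
    hS.hasTangentSpaceAt hV (contDiffOn_graphMap h.contDiffOn_momentum h.contDiffOn_action hx.1 _)
      hx.2, ker_graphDefect_sup_ker ?_ ?_ ?_ ?_⟩
  · exact fderiv_join_eq_zero hVx (h.differentiableAt_unstableGraph hx B) (hH _) fun x hx' =>
      hamiltonian_eq_of_mem_unstableWhisker hf.toIsTorusFunction (hU.join_mem hx')
  · rw [← hpoint]
    exact fderiv_join_eq_zero hVx (h.differentiableAt_stableGraph hx _) (hH _) fun x hx' =>
      hamiltonian_eq_of_mem_stableWhisker hf.toIsTorusFunction (hS.join_mem hx')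
  · have hfield := hamiltonianField_hamiltonian (hf.contDiff.differentiable two_ne_zero) ω μ
    exact (congr_arg Prod.fst (congr_fun hfield _)).trans_ne
      (h.momentum_pos _ (mapsTo_reflectParam a hx)).ne'
  · intro s
    obtain ⟨v, hv⟩ := hsurj (μ⁻¹ • s)
    exact ⟨v, (h.fderiv_graphMap_sub_snd hx _ B v).trans
      ((congr_arg (μ • ·) hv).trans (smul_inv_smul₀ hμ s))⟩

end Gap

end IsStableGraph

/-! ### A quantitative inverse function theorem -/

section InverseFunction

variable {E F : Type*} [NormedAddCommGroup E] [NormedSpace ℝ E]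
  [NormedAddCommGroup F] [NormedSpace ℝ F]

theorem norm_le_two_mul_of_norm_sub_le {T S : E →L[ℝ] F} {N : ℝ} (hN : 0 < N)
    (hT : ∀ v, ‖v‖ ≤ N * ‖T v‖) (hS : ‖S - T‖ ≤ 1 / (2 * N)) (v : E) :
    ‖v‖ ≤ 2 * N * ‖S v‖ := by
  have hsub : ‖T v‖ - ‖S v‖ ≤ 1 / (2 * N) * ‖v‖ := by
    rw [← norm_neg (S v), ← norm_neg (T v)]
    calc ‖-T v‖ - ‖-S v‖ ≤ ‖(S - T) v‖ := by
          simpa [neg_add_eq_sub] using norm_sub_norm_le (-T v) (-S v)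
      _ ≤ 1 / (2 * N) * ‖v‖ := (S - T).le_of_opNorm_le hS v
  have hhalf : N * (1 / (2 * N) * ‖v‖) = ‖v‖ / 2 := by field_simp
  linarith [hT v, mul_le_mul_of_nonneg_left hsub hN.le]

theorem exists_openPartialHomeomorph [CompleteSpace E] (e : E ≃L[ℝ] F) {Φ : E → F} {y₀ : E}
    {r N : ℝ} (hr : 0 < r) (hN : 0 < N) (he : ‖(e.symm : F →L[ℝ] E)‖ ≤ N)
    (hΦ : ApproximatesLinearOn Φ (e : E →L[ℝ] F) (Metric.ball y₀ r) (toNNReal (1 / (2 * N)))) :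
    ∃ f : OpenPartialHomeomorph E F, ⇑f = Φ ∧ f.source = Metric.ball y₀ r ∧
      Metric.ball (Φ y₀) (r / (4 * N)) ⊆ f.target := by
  have hcoe : (toNNReal (1 / (2 * N)) : ℝ) = 1 / (2 * N) := coe_toNNReal _ (by positivity)
  have hle_inv : 0 < ‖(e.symm : F →L[ℝ] E)‖ → N⁻¹ ≤ ‖(e.symm : F →L[ℝ] E)‖⁻¹ :=
    fun hpos => inv_anti₀ hpos he
  have hc : Subsingleton E ∨ toNNReal (1 / (2 * N)) < ‖(e.symm : F →L[ℝ] E)‖₊⁻¹ := by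
    refine e.subsingleton_or_nnnorm_symm_pos.imp_right fun hpos => ?_
    rw [← NNReal.coe_lt_coe, hcoe, NNReal.coe_inv, coe_nnnorm]
    calc 1 / (2 * N) < N⁻¹ := by rw [one_div]; exact inv_strictAnti₀ hN (by linarith)
      _ ≤ _ := hle_inv hpos
  refine ⟨hΦ.toOpenPartialHomeomorph Φ _ hc Metric.isOpen_ball, rfl, rfl, ?_⟩
  rcases e.subsingleton_or_nnnorm_symm_pos with _ | hpos
  · intro w _
    have _ : Subsingleton F := e.symm.toEquiv.subsingleton
    rw [Subsingleton.elim w (Φ y₀)]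
    exact mem_image_of_mem Φ (Metric.mem_ball_self hr)
  · have hsub : Metric.closedBall y₀ (r / 2) ⊆ Metric.ball y₀ r :=
      Metric.closedBall_subset_ball (by linarith)
    refine (Metric.ball_subset_closedBall.trans (Metric.closedBall_subset_closedBall ?_)).trans
      (hΦ.closedBall_subset_target hc Metric.isOpen_ball (by positivity) hsub)
    rw [hcoe, NNReal.coe_inv, coe_nnnorm]
    calc r / (4 * N) = (N⁻¹ - 1 / (2 * N)) * (r / 2) := by field_simp; ring
      _ ≤ _ := by gcongr

variable [FiniteDimensional ℝ E] [FiniteDimensional ℝ F]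

theorem exists_continuousLinearEquiv_of_norm_le (hdim : Module.finrank ℝ E = Module.finrank ℝ F)
    {T : E →L[ℝ] F} {N : ℝ} (hT : ∀ v, ‖v‖ ≤ N * ‖T v‖) :
    ∃ e : E ≃L[ℝ] F, (e : E →L[ℝ] F) = T := by
  have hinj : Function.Injective (T : E →ₗ[ℝ] F) :=
    (injective_iff_map_eq_zero _).2 fun v hv => by
      simpa [show T v = 0 from hv] using hT v
  exact ⟨(LinearMap.linearEquivOfInjective _ hinj hdim).toContinuousLinearEquiv, rfl⟩

theorem exists_localInverse (hdim : Module.finrank ℝ E = Module.finrank ℝ F) {Φ : E → F} {y₀ : E}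
    {r N : ℝ} (hr : 0 < r) (hN : 0 < N) {T : E →L[ℝ] F} (hT : ∀ v, ‖v‖ ≤ N * ‖T v‖)
    (hΦ : ContDiffOn ℝ 1 Φ (Metric.ball y₀ r))
    (hfd : ∀ y ∈ Metric.ball y₀ r, ‖fderiv ℝ Φ y - T‖ ≤ 1 / (2 * N)) :
    ∃ g : F → E, g (Φ y₀) = y₀ ∧ ∀ w ∈ Metric.ball (Φ y₀) (r / (4 * N)),
      g w ∈ Metric.ball y₀ r ∧ Φ (g w) = w ∧ ContDiffAt ℝ 1 g w ∧
        ∀ v, ‖fderiv ℝ g w v‖ ≤ 2 * N * ‖v‖ := by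
  have _ := FiniteDimensional.complete ℝ E
  obtain ⟨e, rfl⟩ := exists_continuousLinearEquiv_of_norm_le hdim hT
  have hd : ∀ y ∈ Metric.ball y₀ r, ContDiffAt ℝ 1 Φ y := fun y hy =>
    hΦ.contDiffAt (Metric.isOpen_ball.mem_nhds hy)
  have he : ‖(e.symm : F →L[ℝ] E)‖ ≤ N :=
    ContinuousLinearMap.opNorm_le_bound _ hN.le fun w => by simpa using hT (e.symm w)
  have happrox : ApproximatesLinearOn Φ (e : E →L[ℝ] F) (Metric.ball y₀ r)
      (toNNReal (1 / (2 * N))) := fun x hx y hy => by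
    rw [coe_toNNReal _ (by positivity)]
    exact (convex_ball y₀ r).norm_image_sub_le_of_norm_fderiv_le'
      (fun z hz => (hd z hz).differentiableAt one_ne_zero) hfd hy hx
  obtain ⟨f, rfl, hsource, htarget⟩ := exists_openPartialHomeomorph e hr hN he happrox
  refine ⟨f.symm, f.left_inv (hsource ▸ Metric.mem_ball_self hr), fun w hw => ?_⟩
  have hw_target := htarget hw
  have hmem : f.symm w ∈ Metric.ball y₀ r := hsource ▸ f.map_target hw_target
  have hlow := norm_le_two_mul_of_norm_sub_le hN hT (hfd _ hmem)
  obtain ⟨e', he'⟩ := exists_continuousLinearEquiv_of_norm_le hdim hlow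
  have hderiv : HasFDerivAt f (e' : E →L[ℝ] F) (f.symm w) :=
    he' ▸ ((hd _ hmem).differentiableAt one_ne_zero).hasFDerivAt
  refine ⟨hmem, f.right_inv hw_target, f.contDiffAt_symm hw_target hderiv (hd _ hmem),
    fun v => ?_⟩
  rw [(f.hasFDerivAt_symm hw_target hderiv).fderiv]
  simpa [← he'] using hlow (e'.symm v)

end InverseFunction

/-! ### Linear algebra of the derivative of the gap -/

section TwoByTwo

open Matrix

variable {M : Matrix (Fin 2) (Fin 2) ℝ}

theorem dotProduct_mulVec_ne_zero_of_det_pos (hM : M.IsSymm) (hdet : 0 < M.det)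
    {v : Fin 2 → ℝ} (hv : v ≠ 0) : v ⬝ᵥ M *ᵥ v ≠ 0 := by
  have hsymm : M 1 0 = M 0 1 := hM.apply 0 1
  intro hform
  simp only [mulVec_eq_sum, dotProduct, Fin.sum_univ_two, Pi.add_apply, Pi.smul_apply,
    transpose_apply, MulOpposite.smul_eq_mul_unop, MulOpposite.unop_op, hsymm] at hform
  rw [det_fin_two, hsymm] at hdet
  have hfst : (M 0 1 * v 0 + M 1 1 * v 1) ^ 2 +
      (M 0 0 * M 1 1 - M 0 1 * M 0 1) * v 0 ^ 2 = 0 := by linear_combination M 1 1 * hform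
  have hsnd : (M 0 0 * v 0 + M 0 1 * v 1) ^ 2 +
      (M 0 0 * M 1 1 - M 0 1 * M 0 1) * v 1 ^ 2 = 0 := by linear_combination M 0 0 * hform
  refine hv (funext <| Fin.forall_fin_two.2 ⟨?_, ?_⟩) <;> by_contra hne
  · linarith [sq_nonneg (M 0 1 * v 0 + M 1 1 * v 1), mul_pos hdet (sq_pos_of_ne_zero hne)]
  · linarith [sq_nonneg (M 0 0 * v 0 + M 0 1 * v 1), mul_pos hdet (sq_pos_of_ne_zero hne)]

theorem norm_mulVec_le_of_entries {K : ℝ} (hM : ∀ i j, |M i j| ≤ K) (v : Fin 2 → ℝ) :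
    ‖M *ᵥ v‖ ≤ 2 * K * ‖v‖ := by
  have hK : 0 ≤ K := (abs_nonneg _).trans (hM 0 0)
  refine (pi_norm_le_iff_of_nonneg (by positivity)).2 fun i => ?_
  calc ‖(M *ᵥ v) i‖ ≤ ∑ j, ‖M i j * v j‖ := norm_sum_le Finset.univ fun j => M i j * v j
    _ = ∑ j, |M i j| * ‖v j‖ := Finset.sum_congr rfl fun j _ => norm_mul _ _
    _ ≤ ∑ _ : Fin 2, K * ‖v‖ :=
        Finset.sum_le_sum fun j _ => mul_le_mul (hM i j) (norm_le_pi_norm v j) (norm_nonneg _) hK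
    _ = 2 * K * ‖v‖ := by rw [Fin.sum_const, nsmul_eq_mul]; ring

theorem norm_le_mul_norm_mulVec {K d : ℝ} (hM : ∀ i j, |M i j| ≤ K) (hd : 0 < d)
    (hdet : d ≤ M.det) (v : Fin 2 → ℝ) : ‖v‖ ≤ 2 * K / d * ‖M *ᵥ v‖ := by
  have hadj : ∀ i j, |M.adjugate i j| ≤ K := by
    simp only [adjugate_fin_two, Fin.forall_fin_two, of_apply, cons_val', cons_val_zero,
      cons_val_one, cons_val_fin_one, abs_neg]
    exact ⟨⟨hM 1 1, hM 0 1⟩, hM 1 0, hM 0 0⟩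
  have hcramer : M.adjugate *ᵥ M *ᵥ v = M.det • v := by
    rw [mulVec_mulVec, adjugate_mul, smul_mulVec, one_mulVec]
  have hscaled : d * ‖v‖ ≤ 2 * K * ‖M *ᵥ v‖ :=
    calc d * ‖v‖ ≤ ‖M.det‖ * ‖v‖ := by gcongr; exact hdet.trans (le_abs_self _)
      _ = ‖M.adjugate *ᵥ M *ᵥ v‖ := by rw [hcramer, norm_smul]
      _ ≤ 2 * K * ‖M *ᵥ v‖ := norm_mulVec_le_of_entries hadj _
  rwa [div_mul_eq_mul_div, le_div_iff₀' hd]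

end TwoByTwo

section AngleBlock

open Matrix

/-- The inclusion `(q, φ₁) ↦ (0, q, (φ₁, 0))`. -/
def inclusion : ℝ × ℝ →L[ℝ] Param :=
  (0 : ℝ × ℝ →L[ℝ] ℝ).prod ((ContinuousLinearMap.fst ℝ ℝ ℝ).prod
    (ContinuousLinearMap.pi ![ContinuousLinearMap.snd ℝ ℝ ℝ, 0]))

theorem inclusion_apply (y : ℝ × ℝ) : inclusion y = (0, y.1, ![y.2, 0]) :=
  Prod.ext rfl (Prod.ext rfl (funext (Fin.forall_fin_two.2 ⟨rfl, rfl⟩)))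

theorem norm_inclusion_apply (y : ℝ × ℝ) : ‖inclusion y‖ = ‖y‖ := by
  have hvec : ‖![y.2, 0]‖ = ‖y.2‖ := by
    simp [Pi.norm_def, Fin.univ_succ]
  rw [inclusion_apply, Prod.norm_mk, Prod.norm_mk, hvec, norm_zero]
  exact max_eq_right (norm_nonneg y)

/-- The block `∂ΔA/∂φ` of a derivative `D` of `ΔA` with respect to `(μ, q, φ)`. -/
def angleBlock (D : Param →L[ℝ] (Fin 2 → ℝ)) : Matrix (Fin 2) (Fin 2) ℝ :=
  .of fun i j => D (0, 0, Pi.single j 1) i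

theorem abs_angleBlock_le (D : Param →L[ℝ] (Fin 2 → ℝ)) (i j : Fin 2) :
    |angleBlock D i j| ≤ ‖D‖ := by
  have hunit : ‖((0, 0, Pi.single j 1) : Param)‖ = 1 := by
    simp [Prod.norm_def, Pi.norm_single]
  exact (norm_le_pi_norm (D (0, 0, Pi.single j 1)) i).trans (D.unit_le_opNorm _ hunit.le)

theorem continuous_angleBlock : Continuous angleBlock := by
  unfold angleBlock
  fun_prop

theorem apply_angle (D : Param →L[ℝ] (Fin 2 → ℝ)) (ψ : Fin 2 → ℝ) :
    D (0, 0, ψ) = angleBlock D *ᵥ ψ := by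
  have hψ : ((0, 0, ψ) : Param) = ∑ j, ψ j • (0, 0, Pi.single j 1) := by
    simp [Fin.sum_univ_two, Prod.ext_iff, funext_iff, Fin.forall_fin_two]
  ext i
  simp only [hψ, map_sum, map_smul, Finset.sum_apply, Pi.smul_apply, smul_eq_mul, mulVec,
    dotProduct, angleBlock, of_apply, mul_comm]

variable {D : Param →L[ℝ] (Fin 2 → ℝ)}

theorem surjective_of_det_angleBlock_ne_zero (hdet : (angleBlock D).det ≠ 0) :
    Function.Surjective fun v => D (0, v) := fun b => by
  obtain ⟨ψ, hψ⟩ := (mulVec_surjective_iff_isUnit.2 ((isUnit_iff_isUnit_det _).2 hdet.isUnit)) b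
  exact ⟨(0, ψ), (apply_angle D ψ).trans hψ⟩

variable {p : ℝ} {ω : Fin 2 → ℝ} (hflow : D (0, p, ω) = 0)
include hflow

theorem apply_eq_mulVec_of_flow (hp : p ≠ 0) (s : ℝ) (ψ : Fin 2 → ℝ) :
    D (0, s, ψ) = angleBlock D *ᵥ (ψ - (s / p) • ω) := by
  have hdecomp : ((0, s, ψ) : Param) = (s / p) • (0, p, ω) + (0, 0, ψ - (s / p) • ω) := by
    simp [div_mul_cancel₀ s hp]
  rw [hdecomp, map_add, map_smul, hflow, smul_zero, zero_add, apply_angle]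

theorem snd_ne_zero_of_apply_inclusion_eq_perp (hp : p ≠ 0) (hω : ω ≠ 0)
    (hsymm : (angleBlock D).IsSymm) (hdet : 0 < (angleBlock D).det) {k : ℝ} (hk : k ≠ 0)
    {y : ℝ × ℝ} (hy : D (inclusion y) = k • perp ω) : y.2 ≠ 0 := by
  intro hy_snd
  have hzero : ![(0 : ℝ), 0] = 0 := by simp
  rw [inclusion_apply, hy_snd, hzero, apply_eq_mulVec_of_flow hflow hp, zero_sub, ← neg_smul,
    mulVec_smul] at hy
  have horth : ω ⬝ᵥ perp ω = 0 := by simp [perp, dotProduct, mul_comm]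
  have hcoeff : -(y.1 / p) * (ω ⬝ᵥ angleBlock D *ᵥ ω) = 0 := by
    rw [← smul_eq_mul, ← dotProduct_smul, hy, dotProduct_smul, horth, smul_zero]
  have hy_fst := (mul_eq_zero.1 hcoeff).resolve_right
    (dotProduct_mulVec_ne_zero_of_det_pos hsymm hdet hω)
  rw [hy_fst, zero_smul] at hy
  have hperp := (smul_eq_zero.1 hy.symm).resolve_left hk
  exact hω (funext (Fin.forall_fin_two.2
    ⟨congr_fun hperp 1, neg_eq_zero.1 (congr_fun hperp 0)⟩))

theorem norm_le_of_flow (hp : 0 < p) (hω : ω 1 ≠ 0) {m K : ℝ} (hm : 0 < m)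
    (hdet : m ≤ (angleBlock D).det) (hD : ‖D‖ ≤ K) (y : ℝ × ℝ) :
    ‖y‖ ≤ 2 * K / m * (1 + (p + ‖ω‖) / |ω 1|) * ‖D (inclusion y)‖ := by
  set U := 2 * K / m * ‖D (inclusion y)‖ with hU
  have hω_pos : 0 < |ω 1| := abs_pos.2 hω
  have hbound : ‖![y.2, 0] - (y.1 / p) • ω‖ ≤ U := by
    rw [hU, inclusion_apply, apply_eq_mulVec_of_flow hflow hp.ne']
    exact norm_le_mul_norm_mulVec (fun i j => (abs_angleBlock_le D i j).trans hD) hm hdet _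
  have hzero : |y.2 - y.1 / p * ω 0| ≤ U := (norm_le_pi_norm _ 0).trans hbound
  have hone : |y.1 / p| ≤ U / |ω 1| := by
    rw [le_div_iff₀ hω_pos, ← abs_mul, ← abs_neg, ← zero_sub]
    exact (norm_le_pi_norm _ 1).trans hbound
  have hU_nonneg : 0 ≤ U := (abs_nonneg _).trans hzero
  have htotal : 2 * K / m * (1 + (p + ‖ω‖) / |ω 1|) * ‖D (inclusion y)‖ =
      U + U / |ω 1| * p + U / |ω 1| * ‖ω‖ := by rw [hU]; field_simp; ring
  rw [htotal]
  refine max_le ?_ ?_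
  · rw [abs_div, abs_of_pos hp, div_le_iff₀ hp] at hone
    have : 0 ≤ U / |ω 1| * ‖ω‖ := by positivity
    exact (norm_eq_abs _).trans_le (by linarith)
  · have hprod : |y.1 / p * ω 0| ≤ U / |ω 1| * ‖ω‖ := by
      rw [abs_mul]
      exact mul_le_mul hone (norm_le_pi_norm ω 0) (abs_nonneg _) (by positivity)
    have htriangle := abs_add_le (y.2 - y.1 / p * ω 0) (y.1 / p * ω 0)
    rw [sub_add_cancel] at htriangle
    have : 0 ≤ U / |ω 1| * p := by positivity
    exact (norm_eq_abs _).trans_le (by linarith)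

end AngleBlock

/-! ### The heteroclinic curve -/

theorem exists_compact_subset_paramDomain {a : ℝ} (ha : 0 < a) : ∃ K, IsCompact K ∧
    K ⊆ paramDomain a ∧ ∀ x ∈ paramDomain (a / 2), ∃ n, x + (0, 0, angleShift n) ∈ K := by
  refine ⟨Metric.closedBall 0 (a / 2) ×ˢ Metric.closedBall π (a / 2) ×ˢ Icc 0 fun _ => 2 * π,
    (isCompact_closedBall _ _).prod ((isCompact_closedBall _ _).prod isCompact_Icc), ?_, ?_⟩
  · rintro x ⟨hμ, hq, -⟩
    rw [Metric.mem_closedBall, dist_eq] at hμ hq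
    rw [sub_zero] at hμ
    exact ⟨by linarith, by linarith⟩
  · rintro x ⟨hμ, hq⟩
    obtain ⟨n, hn⟩ := exists_add_angleShift_mem_Icc x.2.2
    refine ⟨n, ?_, ?_, hn⟩
    · simpa [dist_eq] using hμ.le
    · simpa [dist_eq] using hq.le

theorem paramDomain_half_subset {a : ℝ} (ha : 0 < a) : paramDomain (a / 2) ⊆ paramDomain a :=
  fun _ hx => ⟨hx.1.trans (half_lt_self ha), hx.2.trans (half_lt_self ha)⟩

theorem mem_paramDomain_of_dist_lt {a : ℝ} {x y : Param} (hx : x ∈ paramDomain (a / 2))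
    (hxy : dist x y < a / 2) : y ∈ paramDomain a := by
  rw [dist_comm, Prod.dist_eq, Prod.dist_eq, max_lt_iff, max_lt_iff, dist_eq, dist_eq] at hxy
  constructor
  · linarith [hx.1, hxy.1, abs_sub_abs_le_abs_sub y.1 x.1]
  · linarith [hx.2, hxy.2.1, abs_sub_le y.2.1 x.2.1 π]

/-- The parametrization by `(q, φ₁)` of the parameters with given `μ` and `φ₂`. -/
def slice (μ φ₂ : ℝ) (y : ℝ × ℝ) : Param := (μ, y.1, ![y.2, φ₂])

theorem slice_eq_add (μ φ₂ : ℝ) (y : ℝ × ℝ) : slice μ φ₂ y = inclusion y + (μ, 0, ![0, φ₂]) := by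
  simp [slice, inclusion_apply]

theorem hasFDerivAt_slice (μ φ₂ : ℝ) (y : ℝ × ℝ) : HasFDerivAt (slice μ φ₂) inclusion y :=
  (inclusion.hasFDerivAt.add_const _).congr_of_eventuallyEq
    (.of_forall (slice_eq_add μ φ₂))

theorem contDiff_slice (μ φ₂ : ℝ) : ContDiff ℝ 1 (slice μ φ₂) :=
  funext (slice_eq_add μ φ₂) ▸ inclusion.contDiff.add contDiff_const

theorem dist_slice (μ φ₂ : ℝ) (y z : ℝ × ℝ) : dist (slice μ φ₂ y) (slice μ φ₂ z) = dist y z := by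
  rw [slice_eq_add, slice_eq_add, dist_add_right, dist_eq_norm, ← map_sub, norm_inclusion_apply,
    dist_eq_norm]

theorem slice_pi_self (μ : ℝ) (φ₀ : Fin 2 → ℝ) : slice μ (φ₀ 1) (π, φ₀ 0) = (μ, π, φ₀) := by
  simp [slice, funext_iff, Fin.forall_fin_two]

namespace IsStableGraph

variable {f : (Fin 2 → ℝ) → ℝ} {ω : Fin 2 → ℝ} {a : ℝ} {P : Param → ℝ} {A : Param → Fin 2 → ℝ}
  (h : IsStableGraph f ω a P A)
include h

theorem continuousAt_fderiv_actionGap {x : Param} (hx : x ∈ paramDomain a) :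
    ContinuousAt (fderiv ℝ (actionGap A)) x :=
  (h.contDiffOn_actionGap.continuousOn_fderiv_of_isOpen (isOpen_paramDomain a)
    le_rfl).continuousAt ((isOpen_paramDomain a).mem_nhds hx)

theorem fderiv_actionGap_periodic (n : Fin 2 → ℤ) :
    Function.Periodic (fderiv ℝ (actionGap A)) (0, 0, angleShift n) :=
  fderiv_periodic fun x => by
    have hx : x + (0, 0, angleShift n) = (x.1, x.2.1, x.2.2 + angleShift n) := by
      simp [Prod.ext_iff]
    rw [hx]
    exact h.actionGap_periodic x.1 x.2.1 n x.2.2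

theorem exists_norm_fderiv_actionGap_le :
    ∃ C, 0 ≤ C ∧ ∀ x ∈ paramDomain (a / 2), ‖fderiv ℝ (actionGap A) x‖ ≤ C := by
  obtain ⟨K, hK, hsub, hcover⟩ := exists_compact_subset_paramDomain h.pos
  exact exists_bound_of_periodic hK (fun x hx => h.continuousAt_fderiv_actionGap (hsub hx))
    fun x hx => (hcover x hx).imp' _ fun n hn => ⟨h.fderiv_actionGap_periodic n, hn⟩

theorem exists_dist_fderiv_actionGap_lt {X : Type*} [PseudoMetricSpace X]
    {Θ : (Param →L[ℝ] (Fin 2 → ℝ)) → X} (hΘ : Continuous Θ) {ε : ℝ} (hε : 0 < ε) :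
    ∃ r > 0, ∀ x ∈ paramDomain (a / 2), ∀ y, dist x y < r →
      dist (Θ (fderiv ℝ (actionGap A) x)) (Θ (fderiv ℝ (actionGap A) y)) < ε := by
  obtain ⟨K, hK, hsub, hcover⟩ := exists_compact_subset_paramDomain h.pos
  exact exists_dist_lt_of_periodic (F := Θ ∘ fderiv ℝ (actionGap A)) hK
    (fun x hx => hΘ.continuousAt.comp (h.continuousAt_fderiv_actionGap (hsub hx)))
    (fun x hx => (hcover x hx).imp' _ fun n hn => ⟨(h.fderiv_actionGap_periodic n).comp Θ, hn⟩) hε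

theorem exists_norm_le_fderiv_inclusion (hω : ω 1 ≠ 0) {m : ℝ} (hm : 0 < m) :
    ∃ N > 0, ∀ x ∈ paramDomain (a / 2), fderiv ℝ (actionGap A) x (0, P x, ω) = 0 →
      m ≤ (angleBlock (fderiv ℝ (actionGap A) x)).det →
      ∀ y, ‖y‖ ≤ N * ‖fderiv ℝ (actionGap A) x (inclusion y)‖ := by
  obtain ⟨C, hC, hbound⟩ := h.exists_norm_fderiv_actionGap_le
  refine ⟨2 * (C + 1) / m * (1 + (4 + ‖ω‖) / |ω 1|), by positivity, fun x hx hflow hdet y => ?_⟩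
  have hxa := paramDomain_half_subset h.pos hx
  refine (norm_le_of_flow hflow (h.momentum_pos x hxa) hω hm hdet
    ((hbound x hx).trans (le_add_of_nonneg_right zero_le_one)) y).trans ?_
  gcongr
  exact h.momentum_le x hxa

theorem exists_radius_fderiv_actionGap {ε m : ℝ} (hε : 0 < ε) (hm : 0 < m) :
    ∃ r > 0, ∀ x ∈ paramDomain (a / 2), ∀ y, dist x y < r → y ∈ paramDomain a ∧
      ‖fderiv ℝ (actionGap A) y ∘L inclusion - fderiv ℝ (actionGap A) x ∘L inclusion‖ ≤ ε ∧
      (angleBlock (fderiv ℝ (actionGap A) x)).det - m <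
        (angleBlock (fderiv ℝ (actionGap A) y)).det := by
  obtain ⟨r₁, hr₁, hfderiv⟩ := h.exists_dist_fderiv_actionGap_lt
    (Θ := fun D => D ∘L inclusion) (by fun_prop) hε
  obtain ⟨r₂, hr₂, hdet⟩ :=
    h.exists_dist_fderiv_actionGap_lt continuous_angleBlock.matrix_det hm
  refine ⟨min (min r₁ r₂) (a / 2), lt_min (lt_min hr₁ hr₂) (half_pos h.pos),
    fun x hx y hxy => ?_⟩
  rw [lt_min_iff, lt_min_iff] at hxy
  refine ⟨mem_paramDomain_of_dist_lt hx hxy.2, ?_, ?_⟩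
  · rw [← dist_eq_norm, dist_comm]
    exact (hfderiv x hx y hxy.1.1).le
  · linarith [(abs_lt.1 (hdet x hx y hxy.1.2)).2]

theorem hasFDerivAt_actionGap_slice {μ φ₂ : ℝ} {y : ℝ × ℝ} (hy : slice μ φ₂ y ∈ paramDomain a) :
    HasFDerivAt (fun z => actionGap A (slice μ φ₂ z))
      (fderiv ℝ (actionGap A) (slice μ φ₂ y) ∘L inclusion) y :=
  (h.differentiableAt_actionGap hy).hasFDerivAt.comp y (hasFDerivAt_slice μ φ₂ y)

theorem isSymm_angleBlock {x : Param} (hx : x ∈ paramDomain a) (hμ : x.1 ≠ 0) :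
    (angleBlock (fderiv ℝ (actionGap A) x)).IsSymm :=
  Matrix.IsSymm.ext fun i j => h.fderiv_actionGap_symm hx hμ j i

section Splitting

variable (hf : IsPotential f) {m μ : ℝ} {φ₀ : Fin 2 → ℝ} (hμ : μ ≠ 0)
include hf hμ

variable (hx : ((μ, π, φ₀) : Param) ∈ paramDomain a) (hsplit : SplittingCondition f ω m μ φ₀)
include hx hsplit

theorem actionGap_eq_zero_of_splitting : actionGap A (μ, π, φ₀) = 0 := by
  have hzero := hsplit.1
  rw [splittingMap, h.ΔA_eq_actionGap hf hμ hx, zero_smul, zero_add] at hzero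
  exact (smul_eq_zero.1 hzero).resolve_left hμ

theorem le_det_angleBlock_of_splitting :
    m ≤ (angleBlock (fderiv ℝ (actionGap A) (μ, π, φ₀))).det := by
  have hMse : Mse f ω μ π φ₀ = angleBlock (fderiv ℝ (actionGap A) (μ, π, φ₀)) :=
    Matrix.ext fun i j => h.Mse_apply hf hμ hx i j
  exact hMse ▸ hsplit.2

theorem fderiv_actionGap_flow_of_splitting :
    fderiv ℝ (actionGap A) (μ, π, φ₀) (0, P (μ, π, φ₀), ω) = 0 :=
  h.fderiv_actionGap_flow (δ := 0) hx hf
    (by rw [h.actionGap_eq_zero_of_splitting hf hμ hx hsplit, smul_zero, zero_smul, neg_zero]) hμ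

end Splitting

end IsStableGraph

/-- `g` inverts the gap `ΔA`, as a function of `(q, φ₁)` for given `μ` and `φ₂`, on the ball of
radius `ρ` about `0`. The derivative of `g` is bounded by `N`, and `∂ΔA/∂φ` has positive
determinant on the range of `g`. -/
structure IsGapInverse (a : ℝ) (A : Param → Fin 2 → ℝ) (μ φ₂ ρ N : ℝ) (g : (Fin 2 → ℝ) → ℝ × ℝ) :
    Prop where
  slice_mem (w) : w ∈ Metric.ball 0 ρ → slice μ φ₂ (g w) ∈ paramDomain a
  actionGap_eq (w) : w ∈ Metric.ball 0 ρ → actionGap A (slice μ φ₂ (g w)) = w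
  contDiffAt (w) : w ∈ Metric.ball 0 ρ → ContDiffAt ℝ 1 g w
  norm_fderiv_le (w) : w ∈ Metric.ball 0 ρ → ∀ v, ‖fderiv ℝ g w v‖ ≤ N * ‖v‖
  det_pos (w) : w ∈ Metric.ball 0 ρ →
    0 < (angleBlock (fderiv ℝ (actionGap A) (slice μ φ₂ (g w)))).det

namespace IsStableGraph

variable {f : (Fin 2 → ℝ) → ℝ} {ω : Fin 2 → ℝ} {a : ℝ} {P : Param → ℝ} {A : Param → Fin 2 → ℝ}
  (h : IsStableGraph f ω a P A)
include h

theorem exists_isGapInverse (hf : IsPotential f) (hω : ω 1 ≠ 0) {m : ℝ} (hm : 0 < m) :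
    ∃ ρ > 0, ∃ N > 0, ∀ μ, 0 < μ → μ < a / 2 → ∀ φ₀, SplittingCondition f ω m μ φ₀ →
      ∃ g, g 0 = (π, φ₀ 0) ∧ IsGapInverse a A μ (φ₀ 1) ρ N g := by
  obtain ⟨N, hN, hnorm⟩ := h.exists_norm_le_fderiv_inclusion hω hm
  obtain ⟨r, hr, hclose⟩ := h.exists_radius_fderiv_actionGap (one_div_pos.2 (mul_pos two_pos hN)) hm
  refine ⟨r / (4 * N), by positivity, 2 * N, by positivity, fun μ hμ hμa φ₀ hsplit => ?_⟩
  have hx₀ : ((μ, π, φ₀) : Param) ∈ paramDomain (a / 2) := by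
    simpa [paramDomain, abs_of_pos hμ, hμa] using h.pos
  have hx₀a := paramDomain_half_subset h.pos hx₀
  have hslice : slice μ (φ₀ 1) (π, φ₀ 0) = (μ, π, φ₀) := slice_pi_self μ φ₀
  have hflow := h.fderiv_actionGap_flow_of_splitting hf hμ.ne' hx₀a hsplit
  have hdet := h.le_det_angleBlock_of_splitting hf hμ.ne' hx₀a hsplit
  have hdist : ∀ y ∈ Metric.ball (π, φ₀ 0) r, dist (μ, π, φ₀) (slice μ (φ₀ 1) y) < r :=
    fun y hy => by rwa [← hslice, dist_slice, dist_comm]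
  have hnear := fun y hy => hclose _ hx₀ _ (hdist y hy)
  obtain ⟨g, hg_zero, hg⟩ := exists_localInverse (Φ := fun y => actionGap A (slice μ (φ₀ 1) y))
    (by simp) hr hN (T := fderiv ℝ (actionGap A) (μ, π, φ₀) ∘L inclusion)
    (hnorm _ hx₀ hflow hdet)
    (h.contDiffOn_actionGap.comp (contDiff_slice μ (φ₀ 1)).contDiffOn fun y hy =>
      (hnear y hy).1) fun y hy => by
        rw [(h.hasFDerivAt_actionGap_slice (hnear y hy).1).fderiv]
        exact (hnear y hy).2.1
  rw [hslice, h.actionGap_eq_zero_of_splitting hf hμ.ne' hx₀a hsplit] at hg_zero hg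
  refine ⟨g, hg_zero, fun w hw => (hnear _ (hg w hw).1).1, fun w hw => (hg w hw).2.1,
    fun w hw => (hg w hw).2.2.1, fun w hw => (hg w hw).2.2.2, fun w hw => ?_⟩
  linarith [(hnear _ (hg w hw).1).2.2]

end IsStableGraph

theorem IsDiophantine.snd_ne_zero {ω : Fin 2 → ℝ} {C τ : ℝ} (hω : IsDiophantine ω C τ) :
    ω 1 ≠ 0 := fun hzero => by
  have hbound := hω.2.2 (0, 1) (by simp)
  simp [hzero, hω.1.not_ge] at hbound

theorem isPotential_trigPoly (Γ : ℕ) (c : ℤ × ℤ → ℝ) : IsPotential (trigPoly Γ c) where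
  contDiff := by
    unfold trigPoly
    fun_prop
  periodic n φ := by
    refine Finset.sum_congr rfl fun k _ => congr_arg _ ?_
    have hshift : k.1 * (φ + angleShift n) 0 + k.2 * (φ + angleShift n) 1 =
        k.1 * φ 0 + k.2 * φ 1 + (k.1 * n 0 + k.2 * n 1 : ℤ) * (2 * π) := by
      simp only [Pi.add_apply, angleShift_apply]
      push_cast
      ring
    rw [hshift, cos_add_int_mul_two_pi]
  even φ := by
    refine Finset.sum_congr rfl fun k _ => congr_arg _ ?_
    rw [← cos_neg, Pi.neg_apply, Pi.neg_apply]
    congr 1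
    ring

/-- The value that the gap `ΔA` takes where `W^u(T(B))` meets `W^s(T(B + δ ω^⊥))`. -/
def gapTarget (ω : Fin 2 → ℝ) (μ δ : ℝ) : Fin 2 → ℝ := -((δ / μ) • perp ω)

theorem smul_gapTarget (ω : Fin 2 → ℝ) {μ : ℝ} (hμ : μ ≠ 0) (δ : ℝ) :
    μ • gapTarget ω μ δ = -(δ • perp ω) := by
  rw [gapTarget, smul_neg, smul_smul, mul_div_cancel₀ δ hμ]

theorem gapTarget_zero (ω : Fin 2 → ℝ) (μ : ℝ) : gapTarget ω μ 0 = 0 := by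
  rw [gapTarget, zero_div, zero_smul, neg_zero]

theorem contDiff_gapTarget (ω : Fin 2 → ℝ) (μ : ℝ) : ContDiff ℝ 1 (gapTarget ω μ) := by
  unfold gapTarget
  fun_prop

theorem hasDerivAt_gapTarget (ω : Fin 2 → ℝ) (μ δ : ℝ) :
    HasDerivAt (gapTarget ω μ) (-μ⁻¹ • perp ω) δ := by
  rw [neg_smul, ← one_div]
  exact (((hasDerivAt_id δ).div_const μ).smul_const (perp ω)).neg

theorem gapTarget_mem_ball {ω : Fin 2 → ℝ} {μ δ ρ : ℝ} (hμ : 0 < μ)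
    (hδ : δ ∈ Ioo (-(ρ / (‖perp ω‖ + 1) * μ)) (ρ / (‖perp ω‖ + 1) * μ)) :
    gapTarget ω μ δ ∈ Metric.ball 0 ρ := by
  have hratio : |δ| / μ < ρ / (‖perp ω‖ + 1) := (div_lt_iff₀ hμ).2 (abs_lt.2 hδ)
  rw [mem_ball_zero_iff, gapTarget, norm_neg, norm_smul, norm_eq_abs, abs_div, abs_of_pos hμ]
  calc |δ| / μ * ‖perp ω‖ ≤ |δ| / μ * (‖perp ω‖ + 1) := by gcongr; exact (lt_add_one _).le
    _ < ρ / (‖perp ω‖ + 1) * (‖perp ω‖ + 1) := by gcongr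
    _ = ρ := div_mul_cancel₀ _ (by positivity)

namespace IsGapInverse

variable {f : (Fin 2 → ℝ) → ℝ} {ω : Fin 2 → ℝ} {a : ℝ} {P : Param → ℝ} {A : Param → Fin 2 → ℝ}
  {μ φ₂ ρ N δ : ℝ} {g : (Fin 2 → ℝ) → ℝ × ℝ} (hg : IsGapInverse a A μ φ₂ ρ N g)
include hg

theorem fderiv_actionGap_inclusion (h : IsStableGraph f ω a P A) {w : Fin 2 → ℝ}
    (hw : w ∈ Metric.ball 0 ρ) (v : Fin 2 → ℝ) :
    fderiv ℝ (actionGap A) (slice μ φ₂ (g w)) (inclusion (fderiv ℝ g w v)) = v := by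
  have hcomp := (h.hasFDerivAt_actionGap_slice (hg.slice_mem w hw)).comp w
    ((hg.contDiffAt w hw).differentiableAt one_ne_zero).hasFDerivAt
  have hid : HasFDerivAt ((fun z => actionGap A (slice μ φ₂ z)) ∘ g)
      (ContinuousLinearMap.id ℝ (Fin 2 → ℝ)) w :=
    (hasFDerivAt_id w).congr_of_eventuallyEq <| by
      filter_upwards [Metric.isOpen_ball.mem_nhds hw] using hg.actionGap_eq
  exact DFunLike.congr_fun (hcomp.unique hid) v

variable (hδ : gapTarget ω μ δ ∈ Metric.ball 0 ρ)
include hδ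

theorem contDiffAt_comp_gapTarget : ContDiffAt ℝ 1 (fun δ => g (gapTarget ω μ δ)) δ :=
  (hg.contDiffAt _ hδ).comp δ (contDiff_gapTarget ω μ).contDiffAt

theorem hasDerivAt_comp_gapTarget : HasDerivAt (fun δ => g (gapTarget ω μ δ))
    (fderiv ℝ g (gapTarget ω μ δ) (-μ⁻¹ • perp ω)) δ :=
  ((hg.contDiffAt _ hδ).differentiableAt one_ne_zero).hasFDerivAt.comp_hasDerivAt δ
    (hasDerivAt_gapTarget ω μ δ)

theorem deriv_fst_comp_gapTarget : deriv (fun δ => (g (gapTarget ω μ δ)).1) δ =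
    (fderiv ℝ g (gapTarget ω μ δ) (-μ⁻¹ • perp ω)).1 :=
  HasDerivAt.deriv (hg.hasDerivAt_comp_gapTarget hδ).fst

theorem deriv_snd_comp_gapTarget : deriv (fun δ => (g (gapTarget ω μ δ)).2) δ =
    (fderiv ℝ g (gapTarget ω μ δ) (-μ⁻¹ • perp ω)).2 :=
  HasDerivAt.deriv (hg.hasDerivAt_comp_gapTarget hδ).snd

theorem norm_fderiv_gapTarget_le (hN : 0 < N) (hμ : 0 < μ) :
    ‖fderiv ℝ g (gapTarget ω μ δ) (-μ⁻¹ • perp ω)‖ ≤ N * (‖perp ω‖ + 1) / μ := by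
  refine (hg.norm_fderiv_le _ hδ _).trans ?_
  rw [norm_smul, norm_neg, norm_inv, norm_eq_abs, abs_of_pos hμ, inv_mul_eq_div, mul_div_assoc]
  gcongr
  exact (lt_add_one _).le

theorem abs_deriv_fst_le (hN : 0 < N) (hμ : 0 < μ) :
    |deriv (fun δ => (g (gapTarget ω μ δ)).1) δ| ≤ N * (‖perp ω‖ + 1) / μ := by
  rw [hg.deriv_fst_comp_gapTarget hδ]
  exact (norm_fst_le _).trans (hg.norm_fderiv_gapTarget_le hδ hN hμ)

theorem abs_deriv_snd_le (hN : 0 < N) (hμ : 0 < μ) :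
    |deriv (fun δ => (g (gapTarget ω μ δ)).2) δ| ≤ N * (‖perp ω‖ + 1) / μ := by
  rw [hg.deriv_snd_comp_gapTarget hδ]
  exact (norm_snd_le _).trans (hg.norm_fderiv_gapTarget_le hδ hN hμ)

theorem smul_actionGap_eq (hμ : μ ≠ 0) :
    μ • actionGap A (slice μ φ₂ (g (gapTarget ω μ δ))) = -(δ • perp ω) := by
  rw [hg.actionGap_eq _ hδ, smul_gapTarget ω hμ]

variable (h : IsStableGraph f ω a P A) (hμ : μ ≠ 0) (hf : IsPotential f)
include h hμ hf

theorem deriv_snd_ne_zero (hω : ω ≠ 0) : deriv (fun δ => (g (gapTarget ω μ δ)).2) δ ≠ 0 := by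
  rw [hg.deriv_snd_comp_gapTarget hδ]
  have hx := hg.slice_mem _ hδ
  exact snd_ne_zero_of_apply_inclusion_eq_perp
    (h.fderiv_actionGap_flow hx hf (hg.smul_actionGap_eq hδ hμ) hμ) (h.momentum_pos _ hx).ne' hω
    (h.isSymm_angleBlock hx hμ) (hg.det_pos _ hδ) (neg_ne_zero.2 (inv_ne_zero hμ))
    (hg.fderiv_actionGap_inclusion h hδ _)

theorem transversalAt (B : Fin 2 → ℝ) :
    TransversalAt (hamiltonian f ω μ) (unstableWhisker (hamiltonian f ω μ) B)
      (stableWhisker (hamiltonian f ω μ) (B + δ • perp ω))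
      (unstablePoint f ω μ B (g (gapTarget ω μ δ)).1 ![(g (gapTarget ω μ δ)).2, φ₂]) :=
  h.transversalAt_of_actionGap (hg.slice_mem _ hδ) hf (hg.smul_actionGap_eq hδ hμ) hμ B
    (surjective_of_det_angleBlock_ne_zero (hg.det_pos _ hδ).ne')

end IsGapInverse

end Isochronous

end

open Isochronous in
theorem mainTheorem5_general {f : (Fin 2 → ℝ) → ℝ} (hf : IsPotential f) {ω : Fin 2 → ℝ}
    (hω : ω 1 ≠ 0) {m : ℝ} (hm : 0 < m) :
    ∃ μ₀ > 0, ∃ κ > 0, ∃ K > 0, ∀ μ : ℝ, 0 < μ → μ < μ₀ → ∀ φ₀ : Fin 2 → ℝ,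
      SplittingCondition f ω m μ φ₀ →
      ∃ q φ₁ : ℝ → ℝ, q 0 = Real.pi ∧ φ₁ 0 = φ₀ 0 ∧
        ContDiffOn ℝ 1 q (Set.Ioo (-(κ * μ)) (κ * μ)) ∧
        ContDiffOn ℝ 1 φ₁ (Set.Ioo (-(κ * μ)) (κ * μ)) ∧
        ∀ δ ∈ Set.Ioo (-(κ * μ)) (κ * μ),
          (∀ B : Fin 2 → ℝ,
            TransversalAt (hamiltonian f ω μ) (unstableWhisker (hamiltonian f ω μ) B)
              (stableWhisker (hamiltonian f ω μ) (B + δ • perp ω))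
              (unstablePoint f ω μ B (q δ) ![φ₁ δ, φ₀ 1])) ∧
          deriv φ₁ δ ≠ 0 ∧ |deriv φ₁ δ| ≤ K / μ ∧ |deriv q δ| ≤ K / μ := by
  obtain ⟨a, P, A, h⟩ := exists_isStableGraph hf.toIsTorusFunction ω
  obtain ⟨ρ, hρ, N, hN, hinverse⟩ := h.exists_isGapInverse hf hω hm
  refine ⟨a / 2, half_pos h.pos, ρ / (‖perp ω‖ + 1), by positivity, N * (‖perp ω‖ + 1),
    by positivity, fun μ hμ hμa φ₀ hsplit => ?_⟩
  obtain ⟨g, hg_zero, hg⟩ := hinverse μ hμ hμa φ₀ hsplit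
  have hcurve : ContDiffOn ℝ 1 (fun δ => g (gapTarget ω μ δ))
      (Set.Ioo (-(ρ / (‖perp ω‖ + 1) * μ)) (ρ / (‖perp ω‖ + 1) * μ)) := fun δ hδ =>
    (hg.contDiffAt_comp_gapTarget (gapTarget_mem_ball hμ hδ)).contDiffWithinAt
  have hω_ne : ω ≠ 0 := fun hzero => hω (congr_fun hzero 1)
  refine ⟨fun δ => (g (gapTarget ω μ δ)).1, fun δ => (g (gapTarget ω μ δ)).2,
    by simp only [gapTarget_zero, hg_zero], by simp only [gapTarget_zero, hg_zero],
    hcurve.fst, hcurve.snd, fun δ hδ => ?_⟩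
  have hmem : gapTarget ω μ δ ∈ Metric.ball 0 ρ := gapTarget_mem_ball hμ hδ
  exact ⟨hg.transversalAt hmem h hμ.ne' hf, hg.deriv_snd_ne_zero hmem h hμ.ne' hf hω_ne,
    hg.abs_deriv_snd_le hmem hN hμ, hg.abs_deriv_fst_le hmem hN hμ⟩

theorem mainTheorem5 (Γ : ℕ) (c : ℤ × ℤ → ℝ)
    (hsymm : ∀ k ∈ Isochronous.waveVectors Γ, c (-k) = c k)
    (hpos : ∀ k ∈ Isochronous.waveVectors Γ, 0 < c k)
    (ω : Fin 2 → ℝ) (C τ : ℝ) (hω : Isochronous.IsDiophantine ω C τ)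
    (m : ℝ) (hm : 0 < m) :
    ∃ μ₀ > 0, ∃ κ > 0, ∃ K > 0, ∀ μ : ℝ, 0 < μ → μ < μ₀ → ∀ φ₀ : Fin 2 → ℝ,
      Isochronous.SplittingCondition (Isochronous.trigPoly Γ c) ω m μ φ₀ →
      ∃ q φ₁ : ℝ → ℝ, q 0 = Real.pi ∧ φ₁ 0 = φ₀ 0 ∧
        ContDiffOn ℝ 1 q (Set.Ioo (-(κ * μ)) (κ * μ)) ∧
        ContDiffOn ℝ 1 φ₁ (Set.Ioo (-(κ * μ)) (κ * μ)) ∧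
        ∀ δ ∈ Set.Ioo (-(κ * μ)) (κ * μ),
          (∀ B : Fin 2 → ℝ,
            Isochronous.TransversalAt
              (Isochronous.hamiltonian (Isochronous.trigPoly Γ c) ω μ)
              (Isochronous.unstableWhisker
                (Isochronous.hamiltonian (Isochronous.trigPoly Γ c) ω μ) B)
              (Isochronous.stableWhisker
                (Isochronous.hamiltonian (Isochronous.trigPoly Γ c) ω μ)
                (B + δ • Isochronous.perp ω))
              (Isochronous.unstablePoint (Isochronous.trigPoly Γ c) ω μ B
                (q δ) ![φ₁ δ, φ₀ 1])) ∧
          deriv φ₁ δ ≠ 0 ∧ |deriv φ₁ δ| ≤ K / μ ∧ |deriv q δ| ≤ K / μ :=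
  mainTheorem5_general (Isochronous.isPotential_trigPoly Γ c) hω.snd_ne_zero hm
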